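/- Consider the planar system $$\dot v=\mu v-\omega w+f(v,w)+f_q(v,w)+f_c(v,w),\qquad \dot w=\omega v+\mu w+g(v,w)+g_q(v,w)+g_c(v,w)$$ with $\mu\in\mathbb R$, real $\omega\neq0$, and nonlinear terms with arbitrary real coefficients $$f=a_{11}v|v|+a_{12}v|w|+a_{21}w|v|+a_{22}w|w|,\qquad g=b_{11}v|v|+b_{12}v|w|+b_{21}w|v|+b_{22}w|w|,$$ $$f_q=a_1v^2+a_2vw+a_3w^2,\qquad g_q=b_1v^2+b_2vw+b_3w^2,$$ $$f_c=c_{a1}v^3+c_{a2}vw^2+c_{a3}v^2w+c_{a4}w^3,\qquad g_c=c_{b1}v^3+c_{b2}vw^2+c_{b3}v^2w+c_{b4}w^3.$$ Put $\sigma_\#=2a_{11}+a_{12}+b_{21}+2b_{22}$, $$\sigma_2=\tfrac13(b_{12}a_{11}-b_{21}a_{22}-a_{21}b_{22}+a_{12}b_{11}-2a_{11}a_{22}-2a_{12}a_{21}+2b_{12}b_{21}+2b_{11}b_{22})+\tfrac\pi4(b_{12}b_{22}-a_{12}a_{22}-a_{11}a_{21}+b_{21}b_{11}+2a_{11}b_{11}-2b_{22}a_{22}),$$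 $$S_q=a_1a_2+a_2a_3-b_1b_2-b_2b_3-2a_1b_1+2a_3b_3,\qquad S_c=3c_{a1}+c_{a2}+c_{b3}+3c_{b4}.$$ All constants below may depend on $\omega$ and the coefficients, but not on $\mu$. **Theorem.** There are $\mu_0,\delta>0$, an open neighbourhood $U$ of the origin of $\mathbb R^2$, and an averaged radial equation $\bar r'=F(\bar r,\mu)$, $0\le\bar r<\delta$, $|\mu|<\mu_0$ (the prime denotes $d/d\varphi$), with $$F(\bar r,\mu)=\frac{\mu}{\omega}\bar r+\frac{2}{3\pi\omega}\sigma_\#\bar r^2+\Big(\frac{S_q}{8\omega^2}+\frac{S_c}{8\omega}-\frac{\sigma_2}{2\pi\omega^2}\Big)\bar r^3+R(\bar r,\mu),\qquad R=\mathcal O(\bar r^4+|\mu|\bar r^2),$$ where $F$ is continuous, and $R$ is $C^1$ in $\bar r$ with $\partial_{\bar r}R=\mathcal O(\bar r^3+|\mu|\bar r)$, such that the following hold. 1. In polar coordinates $v=r\cos\varphi$, $w=r\sin\varphi$, with $\varphi$ as independent variable, a $C^1$ near-identity change of the radial coordinate $r=\bar r+\mathcal O(\bar r^2)$, $2\pi$-periodic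 in $\varphi$, turns the radial equation of the system into $\bar r'=F(\bar r,\mu)+\mathcal O(\bar r^4+|\mu|\bar r^2)$. 2. For $0<|\mu|<\mu_0$ the equilibria $\bar r\in(0,\delta)$ of $\bar r'=F(\bar r,\mu)$ are in one-to-one correspondence with the non-constant periodic solutions (up to phase shift) of the planar system in $U$, and the radius along the periodic solution that corresponds to $\bar r$ is $\bar r+\mathcal O(\bar r^2)$. **Corollary.** If $\sigma_\#\neq0$, then moreover $F$, $\mu_0,\delta,U$ can be taken such that: 1. For $|\mu|<\mu_0$, the equation $\bar r'=F(\bar r,\mu)$ has no equilibrium in $(0,\delta)$ if $\mu\sigma_\#\ge0$, and exactly one, $r_0(\mu)=-\frac{3\pi}{2\sigma_\#}\mu+\mathcal O(\mu^2)$, if $\mu\sigma_\#<0$. 2. The planar system has no non-constant periodic solution in $U$ if $\mu\sigma_\#>0$, and exactly one (up to phase shift) if $\mu\sigma_\#<0$; along it the radius is $-\frac{3\pi}{2\sigma_\#}\mu+\mathcal O(\mu^2)$. 3. The bifurcation is subcritical if $\sigma_\#>0$ and supercritical if $\sigma_\#<0$; that is, in every sufficiently small neighbourhood of the origin and for all sufficiently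 small $\mu\neq0$, there are non-constant periodic orbits exactly for those $\mu$ for which the origin is asymptotically stable, respectively unstable. 4. The periodic orbit is orbitally (asymptotically) stable if and only if $r_0(\mu)$ is an (asymptotically) stable equilibrium of the averaged equation $\dot{\bar r}=\omega F(\bar r,\mu)$ (that is, with respect to the direction of the original time $t$; for $\omega>0$ this is the stability for $\bar r'=F(\bar r,\mu)$). The orbit is asymptotically stable if it exists for $\mu>0$ and unstable if it exists for $\mu<0$. -/

import Mathlib

open Set Filter Topology

noncomputable section

namespace NonsmoothHopf

/-- The coefficients of the planar system, without the bifurcation parameter `μ`. -/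
structure Coeffs where
  (ω : ℝ)
  (a11 a12 a21 a22 b11 b12 b21 b22 : ℝ)
  (a1 a2 a3 b1 b2 b3 : ℝ)
  (ca1 ca2 ca3 ca4 cb1 cb2 cb3 cb4 : ℝ)

/-- All nonlinear terms of the `v`-equation: second order modulus, quadratic and cubic terms. -/
def nonlinV (p : Coeffs) (v w : ℝ) : ℝ :=
  (p.a11 * v * |v| + p.a12 * v * |w| + p.a21 * w * |v| + p.a22 * w * |w|)
    + (p.a1 * v ^ 2 + p.a2 * v * w + p.a3 * w ^ 2)
    + (p.ca1 * v ^ 3 + p.ca2 * v * w ^ 2 + p.ca3 * v ^ 2 * w + p.ca4 * w ^ 3)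

/-- All nonlinear terms of the `w`-equation: second order modulus, quadratic and cubic terms. -/
def nonlinW (p : Coeffs) (v w : ℝ) : ℝ :=
  (p.b11 * v * |v| + p.b12 * v * |w| + p.b21 * w * |v| + p.b22 * w * |w|)
    + (p.b1 * v ^ 2 + p.b2 * v * w + p.b3 * w ^ 2)
    + (p.cb1 * v ^ 3 + p.cb2 * v * w ^ 2 + p.cb3 * v ^ 2 * w + p.cb4 * w ^ 3)

/-- The vector field of the planar system, `z = (v, w)`. -/
def field (p : Coeffs) (μ : ℝ) (z : ℝ × ℝ) : ℝ × ℝ :=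
  (μ * z.1 - p.ω * z.2 + nonlinV p z.1 z.2, p.ω * z.1 + μ * z.2 + nonlinW p z.1 z.2)

def sigmaSharp (p : Coeffs) : ℝ := 2 * p.a11 + p.a12 + p.b21 + 2 * p.b22

def sigma2 (p : Coeffs) : ℝ :=
  1 / 3 * (p.b12 * p.a11 - p.b21 * p.a22 - p.a21 * p.b22 + p.a12 * p.b11
      - 2 * p.a11 * p.a22 - 2 * p.a12 * p.a21 + 2 * p.b12 * p.b21 + 2 * p.b11 * p.b22)
    + Real.pi / 4 * (p.b12 * p.b22 - p.a12 * p.a22 - p.a11 * p.a21 + p.b21 * p.b11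
      + 2 * p.a11 * p.b11 - 2 * p.b22 * p.a22)

def Sq (p : Coeffs) : ℝ :=
  p.a1 * p.a2 + p.a2 * p.a3 - p.b1 * p.b2 - p.b2 * p.b3 - 2 * p.a1 * p.b1 + 2 * p.a3 * p.b3

def Sc (p : Coeffs) : ℝ := 3 * p.ca1 + p.ca2 + p.cb3 + 3 * p.cb4

/-- The averaged radial right-hand side up to third order. -/
def normalFormCubic (p : Coeffs) (μ r : ℝ) : ℝ :=
  μ / p.ω * r + 2 / (3 * Real.pi * p.ω) * sigmaSharp p * r ^ 2
    + (Sq p / (8 * p.ω ^ 2) + Sc p / (8 * p.ω) - sigma2 p / (2 * Real.pi * p.ω ^ 2)) * r ^ 3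

/-- The Euclidean norm `r` of `z = (v, w)`. -/
def radius (z : ℝ × ℝ) : ℝ := Real.sqrt (z.1 ^ 2 + z.2 ^ 2)

/-- The radial velocity `dr/dt` at `(v, w) = (r cos φ, r sin φ)`. -/
def radialSpeed (p : Coeffs) (μ r φ : ℝ) : ℝ :=
  Real.cos φ * (field p μ (r * Real.cos φ, r * Real.sin φ)).1
    + Real.sin φ * (field p μ (r * Real.cos φ, r * Real.sin φ)).2

/-- The angular velocity `dφ/dt` at `(v, w) = (r cos φ, r sin φ)`, for `r > 0`. -/
def angularSpeed (p : Coeffs) (μ r φ : ℝ) : ℝ :=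
  (Real.cos φ * (field p μ (r * Real.cos φ, r * Real.sin φ)).2
    - Real.sin φ * (field p μ (r * Real.cos φ, r * Real.sin φ)).1) / r

/-- The right-hand side of the radial equation `dr/dφ`. Its value at `r = 0` is `0`, which is
also its limit. -/
def radialRHS (p : Coeffs) (μ r φ : ℝ) : ℝ := radialSpeed p μ r φ / angularSpeed p μ r φ

/-- `x` solves the autonomous equation `x' = X x` on the interval `I` (one-sided derivatives at
the end points that belong to `I`). -/
def IsSolutionOn {E : Type*} [NormedAddCommGroup E] [NormedSpace ℝ E]
    (X : E → E) (x : ℝ → E) (I : Set ℝ) : Prop :=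
  ∀ t ∈ I, HasDerivWithinAt x (X (x t)) I t

/-- `γ` is the orbit of a non-constant periodic solution of `x' = X x`. -/
def IsPeriodicOrbit (X : ℝ × ℝ → ℝ × ℝ) (γ : Set (ℝ × ℝ)) : Prop :=
  ∃ (x : ℝ → ℝ × ℝ) (T : ℝ), 0 < T ∧ IsSolutionOn X x univ ∧ Function.Periodic x T ∧
    (∃ t, x t ≠ x 0) ∧ γ = range x

/-- Lyapunov stability (orbital stability, if `K` is a periodic orbit) of a compact invariant
set `K` of `x' = X x`. -/
def LyapunovStable {E : Type*} [NormedAddCommGroup E] [NormedSpace ℝ E]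
    (X : E → E) (K : Set E) : Prop :=
  ∀ ε > 0, ∃ η > 0, ∀ (x : ℝ → E) (T : ℝ), IsSolutionOn X x (Ico 0 T) →
    Metric.infDist (x 0) K < η → ∀ t ∈ Ico 0 T, Metric.infDist (x t) K < ε

/-- Asymptotic (orbital) stability of a compact invariant set `K` of `x' = X x`. -/
def AsymptoticallyStable {E : Type*} [NormedAddCommGroup E] [NormedSpace ℝ E]
    (X : E → E) (K : Set E) : Prop :=
  LyapunovStable X K ∧ ∃ η > 0, ∀ x : ℝ → E, IsSolutionOn X x (Ici 0) →
    Metric.infDist (x 0) K < η → Tendsto (fun t => Metric.infDist (x t) K) atTop (𝓝 0)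

/-- Subcritical bifurcation at `μ = 0` from the equilibrium `0` of `x' = X μ x`: in every small
neighbourhood of `0`, for all small `μ ≠ 0`, periodic orbits exist precisely if they coexist
with the stable equilibrium. -/
def IsSubcritical (X : ℝ → ℝ × ℝ → ℝ × ℝ) : Prop :=
  ∃ V ∈ 𝓝 (0 : ℝ × ℝ), ∀ W ∈ 𝓝 (0 : ℝ × ℝ), W ⊆ V → ∃ μ₀ > 0, ∀ μ : ℝ, 0 < |μ| → |μ| < μ₀ →
    ((∃ γ, IsPeriodicOrbit (X μ) γ ∧ γ ⊆ W) ↔ AsymptoticallyStable (X μ) {0})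

/-- Supercritical bifurcation at `μ = 0` from the equilibrium `0` of `x' = X μ x`: in every small
neighbourhood of `0`, for all small `μ ≠ 0`, periodic orbits exist precisely if they coexist
with the unstable equilibrium. -/
def IsSupercritical (X : ℝ → ℝ × ℝ → ℝ × ℝ) : Prop :=
  ∃ V ∈ 𝓝 (0 : ℝ × ℝ), ∀ W ∈ 𝓝 (0 : ℝ × ℝ), W ⊆ V → ∃ μ₀ > 0, ∀ μ : ℝ, 0 < |μ| → |μ| < μ₀ →
    ((∃ γ, IsPeriodicOrbit (X μ) γ ∧ γ ⊆ W) ↔ ¬ LyapunovStable (X μ) {0})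

/-- `F μ r`, `|μ| < μ₀`, `0 ≤ r < δ`, has the form
`normalFormCubic p μ r + O(r ^ 4 + |μ| r ^ 2)` with a remainder that is `C¹` in `r` and whose
`r`-derivative is `O(r ^ 3 + |μ| r)`. -/
def HasNormalFormExpansion (p : Coeffs) (μ₀ δ : ℝ) (F : ℝ → ℝ → ℝ) : Prop :=
  ContinuousOn (fun q : ℝ × ℝ => F q.1 q.2) (Ioo (-μ₀) μ₀ ×ˢ Ico 0 δ) ∧
  (∀ μ, |μ| < μ₀ → ContDiffOn ℝ 1 (F μ) (Ico 0 δ)) ∧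
  ∃ C, ∀ μ, |μ| < μ₀ → ∀ r ∈ Ico 0 δ,
    |F μ r - normalFormCubic p μ r| ≤ C * (r ^ 4 + |μ| * r ^ 2) ∧
    |derivWithin (fun s => F μ s - normalFormCubic p μ s) (Ico 0 δ) r|
      ≤ C * (r ^ 3 + |μ| * r)

/-- A near-identity change of the radial coordinate `r = h μ φ r̄ = r̄ + O(r̄ ^ 2)`, `2π`-periodic
in `φ`, transforms the radial equation `dr/dφ = radialRHS p μ r φ` into
`dr̄/dφ = F μ r̄ + E μ φ r̄` with `E = O(r̄ ^ 4 + |μ| r̄ ^ 2)`. -/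
def IsObtainedByAveraging (p : Coeffs) (μ₀ δ : ℝ) (F : ℝ → ℝ → ℝ) : Prop :=
  ∃ (h E : ℝ → ℝ → ℝ → ℝ) (C : ℝ), ∀ μ, |μ| < μ₀ →
    ContDiff ℝ 1 (fun q : ℝ × ℝ => h μ q.1 q.2) ∧
    (∀ r, Function.Periodic (fun φ => h μ φ r) (2 * Real.pi)) ∧
    ∀ φ, ∀ r ∈ Ico 0 δ,
      |h μ φ r - r| ≤ C * r ^ 2 ∧
      |deriv (fun s => h μ φ s) r - 1| ≤ C * r ∧
      0 < deriv (fun s => h μ φ s) r ∧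
      (0 < r → 0 < h μ φ r ∧ 0 < p.ω * angularSpeed p μ (h μ φ r) φ) ∧
      |E μ φ r| ≤ C * (r ^ 4 + |μ| * r ^ 2) ∧
      deriv (fun θ => h μ θ r) φ + deriv (fun s => h μ φ s) r * (F μ r + E μ φ r)
        = radialRHS p μ (h μ φ r) φ

/-- The non-trivial equilibria in `(0, δ)` of the scalar equation `r' = f r`. -/
def equilibria (f : ℝ → ℝ) (δ : ℝ) : Set ℝ := {r | r ∈ Ioo 0 δ ∧ f r = 0}

/-- The non-constant periodic orbits of `x' = X x` that lie in `U`. -/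
def periodicOrbits (X : ℝ × ℝ → ℝ × ℝ) (U : Set (ℝ × ℝ)) : Set (Set (ℝ × ℝ)) :=
  {γ | IsPeriodicOrbit X γ ∧ γ ⊆ U}

end NonsmoothHopf

end

open NonsmoothHopf

/-! All nonlinear terms are positively homogeneous of degree two or three. For `r ≥ 0` the radial
and angular velocities are therefore polynomials in `r` with continuous `2π`-periodic coefficients
in `φ`. The absolute values spoil smoothness in `φ` only. Near the origin the angular velocity stays
close to `ω ≠ 0`, so `φ` can serve as time, and the radial equation reads `dr/dφ = r ⬝ rate` with
`rate` rational in `r` and affine in `μ`. Its flow is differentiable in the initial radius although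
the planar field need not be differentiable.

The return map after one turn is `r ⬝ exp (K μ r)` with `K = logGrowth`, the integral of `rate`
along the trajectory. With `c = avgQuad` and `d = avgCub` one has `K / (2π) = μ/ω + c r + (d + π c²)
r² + O(r³ + |μ| r)`. The averaged field is defined exactly, not as a truncated series, by `F = r (1
- π c r) K / (2π)`. The factor `1 - π c r` removes the spurious `π c²`, so `F` has the required
cubic normal form, and it does not vanish for small `r`, so the positive zeros of `F` are exactly
the fixed points of the return map. The expansion is proved first for `∂K/∂r`
(`exists_logGrowthDeriv_expand`) and then integrated from `r = 0`, which controls the remainder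
together with its derivative. The numbers `c` and `d` are integrals over four quadrants, on each of
which the coefficients are polynomials in `cos` and `sin` (`integral_radialQuad`,
`integral_rateCub`).

The same two means come from averaging: an explicit change `r̄ + A(φ) r̄² + B(φ) r̄³` cancels the
oscillating parts of the second and third order coefficients (`exists_isObtainedByAveraging`).

Conversely, along any non-constant periodic solution near the origin the polar angle is strictly
monotone, so the orbit is the graph of a solution of the radial equation over the angle. It comes
back after some nonzero number of turns, and because scalar trajectories do not cross, it already
closes after one (`closed_of_return`). Choosing `U` as a disc slit along a ray makes "orbit in `U`"
equivalent to "starting radius below `δ`" (`bijOn_orbitOf`).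

If `σ# ≠ 0` then `c ≠ 0` and `∂K/∂r` stays close to `2π c`, so `K` is strictly monotone in `r`.
Since `K μ 0 = 2π μ/ω`, a positive zero exists exactly when `μ σ# < 0`, and it is unique. For
stability, the derivative of the return map at the fixed point is `1 + r ∂K/∂r`, so the Floquet
exponent `λ` has the sign of `c`. A weighted squared radial gap (`orbitEnergy`) decays or grows
exponentially in time according to the sign of `ω λ`. The scalar equation has the rate sign of `ω c
= 2 σ# / (3π)`, so orbit and equilibrium are both asymptotically stable or both Lyapunov unstable.
-/

noncomputable section

namespace NonsmoothHopf

open scoped NNReal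

/-! ### Global flows of bounded, uniformly Lipschitz fields -/

section GlobalFlow
variable {E : Type*} [NormedAddCommGroup E] [NormedSpace ℝ E]

/-- A bounded vector field that is globally Lipschitz in space has global solutions. -/
theorem exists_global_solution [CompleteSpace E] {f : ℝ → E → E} {K L : ℝ≥0}
    (hlip : ∀ t, LipschitzWith K (f t)) (hcont : ∀ x, Continuous fun t => f t x)
    (hbd : ∀ t x, ‖f t x‖ ≤ L) (x₀ : E) :
    ∃ x : ℝ → E, x 0 = x₀ ∧ ∀ t, HasDerivAt x (f t (x t)) t := by
  have key : ∀ n : ℕ, ∃ x : ℝ → E, x 0 = x₀ ∧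
      ∀ t ∈ Ioo (-((n : ℝ) + 1)) (n + 1), HasDerivAt x (f t (x t)) t := by
    intro n
    have hn : (0 : ℝ) < n + 1 := by positivity
    let t₀ : Icc (-((n : ℝ) + 1)) (n + 1) := ⟨0, by constructor <;> linarith⟩
    -- The radius `L (n + 1)` is the farthest a solution of speed at most `L` can travel in time `n
    -- + 1`. No smallness of the time interval is needed, because the Lipschitz bound is global.
    have hpl : IsPicardLindelof f t₀ x₀ (L * (n + 1)) 0 L K :=
      { lipschitzOnWith := fun t _ => (hlip t).lipschitzOnWith
        continuousOn := fun x _ => (hcont x).continuousOn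
        norm_le := fun t _ x _ => hbd t x
        mul_max_le := by simp [t₀] }
    obtain ⟨x, hx0, hx⟩ := hpl.exists_eq_forall_mem_Icc_hasDerivWithinAt₀
    exact ⟨x, hx0, fun t ht => (hx t (Ioo_subset_Icc_self ht)).hasDerivAt (Icc_mem_nhds ht.1 ht.2)⟩
  choose y hy0 hy using key
  have hagree : ∀ m n : ℕ, m ≤ n → ∀ t ∈ Ioo (-((m : ℝ) + 1)) (m + 1), y m t = y n t := by
    intro m n hmn
    have hmn' : (m : ℝ) ≤ n := by exact_mod_cast hmn
    refine ODE_solution_unique_of_mem_Ioo (v := f) (s := fun _ => univ) (K := K) (t₀ := 0)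
      (fun t _ => (hlip t).lipschitzOnWith) ?_ (fun t ht => ⟨hy m t ht, trivial⟩)
      (fun t ht => ⟨hy n t ⟨by linarith [ht.1], by linarith [ht.2]⟩, trivial⟩)
      (by rw [hy0, hy0])
    constructor <;> linarith [(Nat.cast_nonneg m : (0 : ℝ) ≤ m)]
  -- At time `t` the local solution with index `⌈|t|⌉₊` is used. Its interval has half-length one
  -- more than the index, so `t` is interior and the glued function is differentiable there.
  refine ⟨fun t => y ⌈|t|⌉₊ t, by simp [hy0], fun t => ?_⟩
  set n := ⌈|t|⌉₊ with hn
  have htn : |t| ≤ n := Nat.le_ceil _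
  have htmem : t ∈ Ioo (-((n : ℝ) + 1)) (n + 1) := by
    rw [abs_le] at htn; constructor <;> linarith [htn.1, htn.2]
  refine (hy n t htmem).congr_of_eventuallyEq ?_
  filter_upwards [Ioo_mem_nhds htmem.1 htmem.2] with s hs
  have hsn : |s| < n + 1 := abs_lt.2 hs
  have hs' : |s| ≤ ⌈|s|⌉₊ := Nat.le_ceil _
  rcases le_total ⌈|s|⌉₊ n with h | h
  · refine hagree _ _ h s ?_
    rw [abs_le] at hs'; constructor <;> linarith [hs'.1, hs'.2]
  · exact (hagree _ _ h s hs).symm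

theorem global_solution_unique {f : ℝ → E → E} {K : ℝ≥0}
    (hlip : ∀ t, LipschitzWith K (f t)) {x y : ℝ → E} (hx : ∀ t, HasDerivAt x (f t (x t)) t)
    (hy : ∀ t, HasDerivAt y (f t (y t)) t) {t₀ : ℝ} (h : x t₀ = y t₀) : x = y :=
  ODE_solution_unique_univ (v := f) (s := fun _ => univ) (K := K)
    (fun t => (hlip t).lipschitzOnWith) (fun t => ⟨hx t, trivial⟩) (fun t => ⟨hy t, trivial⟩) h

end GlobalFlow

/-! ### Lyapunov criteria for stability and instability of compact sets -/

section Stability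
variable {E : Type*} [NormedAddCommGroup E] [NormedSpace ℝ E]

/-- A continuous function on `[0, T)` stays below `ε` if it cannot reach `ε` for the first time. -/
theorem lt_of_no_first_exit {f : ℝ → ℝ} {T ε : ℝ} (hf : ContinuousOn f (Ico 0 T))
    (h0 : f 0 < ε) (hstep : ∀ t₁ ∈ Ioo 0 T, (∀ t ∈ Ico 0 t₁, f t < ε) → f t₁ ≠ ε) :
    ∀ t ∈ Ico 0 T, f t < ε := by
  by_contra! hcon
  obtain ⟨b, hb, hfb⟩ := hcon
  have hcont : ContinuousOn f (Icc 0 b) := hf.mono fun t ht => ⟨ht.1, ht.2.trans_lt hb.2⟩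
  have hcl : IsClosed (Icc 0 b ∩ f ⁻¹' Ici ε) := hcont.preimage_isClosed_of_isClosed isClosed_Icc
    isClosed_Ici
  have hne : (Icc 0 b ∩ f ⁻¹' Ici ε).Nonempty := ⟨b, ⟨hb.1, le_rfl⟩, hfb⟩
  have hbdd : BddBelow (Icc 0 b ∩ f ⁻¹' Ici ε) := ⟨0, fun t ht => ht.1.1⟩
  set t₁ := sInf (Icc 0 b ∩ f ⁻¹' Ici ε) with ht₁
  have hmem : t₁ ∈ Icc 0 b ∩ f ⁻¹' Ici ε := hcl.csInf_mem hne hbdd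
  have hlt : ∀ t ∈ Ico 0 t₁, f t < ε := by
    intro t ht
    by_contra! hge
    exact absurd (csInf_le hbdd ⟨⟨ht.1, ht.2.le.trans hmem.1.2⟩, hge⟩) (not_le.2 ht.2)
  have hpos : 0 < t₁ := by
    rcases hmem.1.1.eq_or_lt with h | h
    · have : ε ≤ f t₁ := hmem.2
      rw [← h] at this; linarith
    · exact h
  refine hstep t₁ ⟨hpos, hmem.1.2.trans_lt hb.2⟩ hlt (le_antisymm ?_ hmem.2)
  have hc : ContinuousWithinAt f (Ico 0 t₁) t₁ :=
    (hcont t₁ hmem.1).mono fun t ht => ⟨ht.1, ht.2.le.trans hmem.1.2⟩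
  have : (𝓝[Ico 0 t₁] t₁).NeBot := by
    rw [← mem_closure_iff_nhdsWithin_neBot, closure_Ico hpos.ne]
    exact ⟨hpos.le, le_rfl⟩
  exact le_of_tendsto hc (eventually_mem_nhdsWithin.mono fun t ht => (hlt t ht).le)

theorem IsSolutionOn.continuousOn {X : E → E} {x : ℝ → E} {I : Set ℝ} (h : IsSolutionOn X x I) :
    ContinuousOn x I := fun t ht => (h t ht).continuousWithinAt

theorem IsSolutionOn.mono {X : E → E} {x : ℝ → E} {I J : Set ℝ} (h : IsSolutionOn X x I)
    (hJ : J ⊆ I) : IsSolutionOn X x J := fun t ht => (h t (hJ ht)).mono hJ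

theorem IsSolutionOn.continuousOn_infDist {X : E → E} {x : ℝ → E} {I : Set ℝ}
    (h : IsSolutionOn X x I) (K : Set E) : ContinuousOn (fun t => Metric.infDist (x t) K) I :=
  (Metric.continuous_infDist_pt K).comp_continuousOn h.continuousOn

/-- Asymptotic stability from a Lyapunov function that decays exponentially along solutions. -/
theorem asymptoticallyStable_of_decay {X : E → E} {K : Set E} {V : E → ℝ} {ε₀ c : ℝ}
    (hε₀ : 0 < ε₀) (hc : 0 < c) (hV0 : ∀ z, 0 ≤ V z)
    (hV1 : ∀ ε > 0, ∃ η > 0, ∀ z, Metric.infDist z K < η → V z < ε)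
    (hV2 : ∀ ε > 0, ∃ η > 0, ∀ z, Metric.infDist z K < ε₀ → V z < η → Metric.infDist z K < ε)
    (hdec : ∀ (x : ℝ → E) (T : ℝ), IsSolutionOn X x (Ico 0 T) →
      (∀ t ∈ Ico 0 T, Metric.infDist (x t) K < ε₀) →
      ∀ t ∈ Ico 0 T, V (x t) ≤ V (x 0) * Real.exp (-(c * t))) :
    AsymptoticallyStable X K := by
  have hdec' : ∀ (x : ℝ → E) (T : ℝ), IsSolutionOn X x (Ico 0 T) →
      (∀ t ∈ Ico 0 T, Metric.infDist (x t) K < ε₀) → ∀ t ∈ Ico 0 T, V (x t) ≤ V (x 0) := by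
    intro x T hx hT t ht
    refine (hdec x T hx hT t ht).trans (mul_le_of_le_one_right (hV0 _) ?_)
    rw [Real.exp_le_one_iff]
    have := mul_nonneg hc.le ht.1
    linarith
  have hstab : LyapunovStable X K := by
    intro ε hε
    set ε' := min ε ε₀ with hε'
    have hε'pos : 0 < ε' := lt_min hε hε₀
    -- Half of `ε'` leaves a gap: before a first exit the distance stays below `ε' / 2`, so by
    -- continuity it cannot equal `ε'` at the exit.
    obtain ⟨η₂, hη₂, h2⟩ := hV2 (ε' / 2) (by positivity)
    obtain ⟨η₁, hη₁, h1⟩ := hV1 η₂ hη₂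
    refine ⟨min η₁ ε', lt_min hη₁ hε'pos, fun x T hx h0 => ?_⟩
    have hmain : ∀ t ∈ Ico 0 T, Metric.infDist (x t) K < ε' := by
      refine lt_of_no_first_exit (hx.continuousOn_infDist K)
        (h0.trans_le (min_le_right _ _)) ?_
      intro t₁ ht₁ hlt heq
      have hsub : Ico 0 t₁ ⊆ Ico 0 T := Ico_subset_Ico_right ht₁.2.le
      have hle : ∀ t ∈ Ico 0 t₁, Metric.infDist (x t) K < ε' / 2 := by
        intro t ht
        refine h2 _ ((hlt t ht).trans_le (min_le_right _ _)) ?_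
        refine (hdec' x t₁ (hx.mono hsub)
          (fun s hs => (hlt s hs).trans_le (min_le_right _ _)) t ht).trans_lt ?_
        exact h1 _ (h0.trans_le (min_le_left _ _))
      have hc : ContinuousWithinAt (fun t => Metric.infDist (x t) K) (Ico 0 t₁) t₁ :=
        (hx.continuousOn_infDist K t₁ ⟨ht₁.1.le, ht₁.2⟩).mono hsub
      have : (𝓝[Ico 0 t₁] t₁).NeBot := by
        rw [← mem_closure_iff_nhdsWithin_neBot, closure_Ico ht₁.1.ne]
        exact ⟨ht₁.1.le, le_rfl⟩
      have := le_of_tendsto hc (eventually_mem_nhdsWithin.mono fun t ht => (hle t ht).le)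
      simp only [heq] at this
      linarith
    exact fun t ht => (hmain t ht).trans_le (min_le_left _ _)
  refine ⟨hstab, ?_⟩
  obtain ⟨η, hη, h⟩ := hstab ε₀ hε₀
  refine ⟨η, hη, fun x hx h0 => ?_⟩
  have hin : ∀ t, 0 ≤ t → Metric.infDist (x t) K < ε₀ := fun t ht =>
    h x (t + 1) (hx.mono Ico_subset_Ici_self) h0 t ⟨ht, by linarith⟩
  have hVt : Tendsto (fun t => V (x 0) * Real.exp (-(c * t))) atTop (𝓝 0) := by
    have : Tendsto (fun t => Real.exp (-(c * t))) atTop (𝓝 0) :=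
      Real.tendsto_exp_neg_atTop_nhds_zero.comp (tendsto_id.const_mul_atTop hc)
    simpa using this.const_mul (V (x 0))
  rw [Metric.tendsto_atTop]
  intro ε hε
  obtain ⟨η₂, hη₂, h2⟩ := hV2 ε hε
  obtain ⟨N, hN⟩ := (Filter.eventually_atTop.1 ((hVt.eventually_lt_const hη₂).and
    (eventually_ge_atTop 0)))
  refine ⟨N, fun t ht => ?_⟩
  obtain ⟨h3, h4⟩ := hN t ht
  rw [Real.dist_eq, sub_zero, abs_of_nonneg Metric.infDist_nonneg]
  refine h2 _ (hin t h4) ((hdec x (t + 1) (hx.mono Ico_subset_Ici_self)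
    (fun s hs => hin s hs.1) t ⟨h4, by linarith⟩).trans_lt h3)

/-- Instability from a function that grows exponentially along solutions. -/
theorem not_lyapunovStable_of_growth {X : E → E} {K : Set E} {V : E → ℝ} {ε₀ c B : ℝ}
    (hε₀ : 0 < ε₀) (hc : 0 < c)
    (hex : ∀ z₀ : E, ∃ x : ℝ → E, x 0 = z₀ ∧ Continuous x ∧ ∀ T,
      (∀ t ∈ Ico 0 T, Metric.infDist (x t) K < ε₀) → IsSolutionOn X x (Ico 0 T))
    (hV : ∀ η > 0, ∃ z, Metric.infDist z K < η ∧ 0 < V z)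
    (hB : ∀ z, Metric.infDist z K < ε₀ → V z ≤ B)
    (hgrow : ∀ (x : ℝ → E) (T : ℝ), IsSolutionOn X x (Ico 0 T) →
      (∀ t ∈ Ico 0 T, Metric.infDist (x t) K < ε₀) →
      ∀ t ∈ Ico 0 T, V (x 0) * Real.exp (c * t) ≤ V (x t)) :
    ¬ LyapunovStable X K := by
  intro hstab
  obtain ⟨η, hη, h⟩ := hstab (ε₀ / 2) (by positivity)
  obtain ⟨z, hz, hVz⟩ := hV (min η ε₀) (lt_min hη hε₀)
  obtain ⟨x, hx0, hxc, hx⟩ := hex z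
  -- If `K` were stable, the chosen curve would stay within `ε₀ / 2`. It therefore never leaves the
  -- region where it solves the equation, and `V` would grow past its bound `B` there.
  have hstay : ∀ T, ∀ t ∈ Ico 0 T, Metric.infDist (x t) K < ε₀ := by
    intro T
    refine lt_of_no_first_exit ((Metric.continuous_infDist_pt K).comp hxc).continuousOn
      (by rw [hx0]; exact hz.trans_le (min_le_right _ _)) ?_
    intro t₁ ht₁ hlt heq
    have hle := h x t₁ (hx t₁ hlt) (by rw [hx0]; exact hz.trans_le (min_le_left _ _))
    have hcw : ContinuousWithinAt (fun t => Metric.infDist (x t) K) (Ico 0 t₁) t₁ :=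
      ((Metric.continuous_infDist_pt K).comp hxc).continuousWithinAt
    have : (𝓝[Ico 0 t₁] t₁).NeBot := by
      rw [← mem_closure_iff_nhdsWithin_neBot, closure_Ico ht₁.1.ne]
      exact ⟨ht₁.1.le, le_rfl⟩
    have := le_of_tendsto hcw (eventually_mem_nhdsWithin.mono fun t ht => (hle t ht).le)
    simp only [heq] at this
    linarith
  have hlim : Tendsto (fun t => V z * Real.exp (c * t)) atTop atTop :=
    (Real.tendsto_exp_atTop.comp (tendsto_id.const_mul_atTop hc)).const_mul_atTop hVz
  obtain ⟨t, ht, ht0⟩ := ((hlim.eventually_gt_atTop B).and (eventually_ge_atTop 0)).exists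
  have hst := hstay (t + 1)
  have h1 := hgrow x (t + 1) (hx _ hst) hst t ⟨ht0, by linarith⟩
  rw [hx0] at h1
  exact absurd (hB _ (hst t ⟨ht0, by linarith⟩)) (not_le.2 (ht.trans_le h1))

/-- Exponential comparison: `u' ≤ -c u` implies decay. -/
theorem le_mul_exp_of_deriv_le {u u' : ℝ → ℝ} {c T : ℝ} (hu : ContinuousOn u (Ico 0 T))
    (hd : ∀ t ∈ Ioo 0 T, HasDerivAt u (u' t) t) (hle : ∀ t ∈ Ioo 0 T, u' t ≤ -c * u t) :
    ∀ t ∈ Ico 0 T, u t ≤ u 0 * Real.exp (-(c * t)) := by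
  intro t ht
  have hanti : AntitoneOn (fun t => u t * Real.exp (c * t)) (Icc 0 t) := by
    refine antitoneOn_of_hasDerivWithinAt_nonpos (convex_Icc _ _)
      (f' := fun s => u' s * Real.exp (c * s) + u s * (Real.exp (c * s) * c)) ?_ ?_ ?_
    · exact (hu.mono fun s hs => ⟨hs.1, hs.2.trans_lt ht.2⟩).mul (by fun_prop)
    · intro s hs
      rw [interior_Icc] at hs
      have h1 : HasDerivAt (fun s => Real.exp (c * s)) (Real.exp (c * s) * c) s := by
        simpa using ((hasDerivAt_id s).const_mul c).exp
      exact ((hd s ⟨hs.1, hs.2.trans ht.2⟩).mul h1).hasDerivWithinAt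
    · intro s hs
      rw [interior_Icc] at hs
      have h1 := hle s ⟨hs.1, hs.2.trans ht.2⟩
      have h2 := Real.exp_pos (c * s)
      nlinarith
  have h := hanti ⟨le_rfl, ht.1⟩ ⟨ht.1, le_rfl⟩ ht.1
  simp only [mul_zero, Real.exp_zero, mul_one] at h
  have h2 : Real.exp (c * t) * Real.exp (-(c * t)) = 1 := by rw [← Real.exp_add]; simp
  calc u t = u t * Real.exp (c * t) * Real.exp (-(c * t)) := by rw [mul_assoc, h2, mul_one]
    _ ≤ _ := mul_le_mul_of_nonneg_right h (Real.exp_pos _).le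

/-- Exponential comparison: `c u ≤ u'` implies growth. -/
theorem mul_exp_le_of_le_deriv {u u' : ℝ → ℝ} {c T : ℝ} (hu : ContinuousOn u (Ico 0 T))
    (hd : ∀ t ∈ Ioo 0 T, HasDerivAt u (u' t) t) (hle : ∀ t ∈ Ioo 0 T, c * u t ≤ u' t) :
    ∀ t ∈ Ico 0 T, u 0 * Real.exp (c * t) ≤ u t := by
  intro t ht
  have h := le_mul_exp_of_deriv_le (u := fun t => -u t) (u' := fun t => -u' t) (c := -c)
    hu.neg (fun t ht => (hd t ht).neg) (fun t ht => by have := hle t ht; linarith) t ht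
  simp only [neg_mul, neg_neg] at h
  linarith

theorem IsSolutionOn.hasDerivAt {X : E → E} {x : ℝ → E} {T : ℝ} (h : IsSolutionOn X x (Ico 0 T))
    {t : ℝ} (ht : t ∈ Ioo 0 T) : HasDerivAt x (X (x t)) t :=
  (h t (Ioo_subset_Ico_self ht)).hasDerivAt (Ico_mem_nhds ht.1 ht.2)

end Stability

/-! ### Inverting a uniformly monotone change of time -/

section InverseFunction

/-- A function on `ℝ` whose derivative is bounded away from zero, with constant sign, is
bijective with differentiable inverse. -/
theorem exists_inverse_of_deriv_ge {θ θ' : ℝ → ℝ} {c s : ℝ} (hc : 0 < c)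
    (hθ : ∀ t, HasDerivAt θ (θ' t) t) (hs : ∀ t, c ≤ s * θ' t) :
    ∃ τ : ℝ → ℝ, (∀ φ, θ (τ φ) = φ) ∧ (∀ t, τ (θ t) = t) ∧
      ∀ φ, HasDerivAt τ (θ' (τ φ))⁻¹ φ := by
  have hs0 : s ≠ 0 := by
    rintro rfl
    have := hs 0
    simp at this; linarith
  have hd : ∀ t, HasDerivAt (fun t => s * θ t) (s * θ' t) t := fun t => (hθ t).const_mul s
  have hmono : StrictMono fun t => s * θ t :=
    strictMono_of_hasDerivAt_pos hd fun t => hc.trans_le (hs t)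
  -- Monotonicity after subtracting `c t` forces at least linear growth in both directions, hence
  -- surjectivity. The factor `s`, later `ω` itself, carries the sense of rotation.
  have hmon2 : Monotone fun t => s * θ t - c * t := by
    refine monotone_of_hasDerivAt_nonneg (f' := fun t => s * θ' t - c) (fun t => ?_) fun t => ?_
    · have h := (hd t).sub ((hasDerivAt_id t).const_mul c)
      rwa [mul_one] at h
    · simpa using hs t
  have hcont : Continuous fun t => s * θ t :=
    continuous_iff_continuousAt.2 fun t => (hd t).continuousAt
  have htop : Tendsto (fun t => s * θ t) atTop atTop := by
    refine tendsto_atTop_mono' _ ?_ (tendsto_atTop_add_const_left _ (s * θ 0)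
      (tendsto_id.const_mul_atTop hc))
    filter_upwards [eventually_ge_atTop 0] with t ht
    have := hmon2 ht
    simp at this ⊢; linarith
  have hbot : Tendsto (fun t => s * θ t) atBot atBot := by
    refine tendsto_atBot_mono' _ ?_ (tendsto_atBot_add_const_left _ (s * θ 0)
      (tendsto_id.const_mul_atBot hc))
    filter_upwards [eventually_le_atBot 0] with t ht
    have := hmon2 ht
    simp at this ⊢; linarith
  let e : ℝ ≃o ℝ := StrictMono.orderIsoOfSurjective _ hmono (hcont.surjective htop hbot)
  have he : ∀ t, e t = s * θ t := fun t => rfl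
  have h1 : ∀ φ, θ (e.symm (s * φ)) = φ := by
    intro φ
    have : s * θ (e.symm (s * φ)) = s * φ := by rw [← he]; exact e.apply_symm_apply _
    exact mul_left_cancel₀ hs0 this
  refine ⟨fun φ => e.symm (s * φ), h1, fun t => ?_, fun φ => ?_⟩
  · change e.symm (s * θ t) = t
    rw [← he]; exact e.symm_apply_apply t
  · refine HasDerivAt.of_local_left_inverse (f := θ) ?_ (hθ _) ?_ (Eventually.of_forall h1)
    · exact (e.symm.continuous.comp (continuous_const.mul continuous_id)).continuousAt
    · intro h
      have := hs (e.symm (s * φ))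
      rw [h] at this
      simp at this; linarith

end InverseFunction

/-! ### Polar coordinates along planar curves -/

section PolarLift

theorem radius_pos {z : ℝ × ℝ} (hz : z ≠ 0) : 0 < radius z := by
  refine Real.sqrt_pos.2 ?_
  rcases z with ⟨v, w⟩
  by_contra! h
  have hv : v = 0 := by nlinarith [sq_nonneg v, sq_nonneg w]
  have hw : w = 0 := by nlinarith [sq_nonneg v, sq_nonneg w]
  exact hz (by rw [hv, hw]; rfl)

theorem radius_sq (z : ℝ × ℝ) : radius z ^ 2 = z.1 ^ 2 + z.2 ^ 2 :=
  Real.sq_sqrt (by positivity)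

theorem radius_nonneg (z : ℝ × ℝ) : 0 ≤ radius z := Real.sqrt_nonneg _

theorem continuous_radius : Continuous radius := by
  unfold radius; fun_prop

theorem radius_polar {r : ℝ} (hr : 0 ≤ r) (φ : ℝ) :
    radius (r * Real.cos φ, r * Real.sin φ) = r := by
  have : (r * Real.cos φ) ^ 2 + (r * Real.sin φ) ^ 2 = r ^ 2 := by
    linear_combination r ^ 2 * Real.cos_sq_add_sin_sq φ
  simp only [radius, this, Real.sqrt_sq hr]

theorem hasDerivWithinAt_fst {x : ℝ → ℝ × ℝ} {x' : ℝ × ℝ} {I : Set ℝ} {t : ℝ}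
    (h : HasDerivWithinAt x x' I t) : HasDerivWithinAt (fun t => (x t).1) x'.1 I t :=
  (hasFDerivAt_fst (𝕜 := ℝ) (p := x t)).comp_hasDerivWithinAt t h

theorem hasDerivWithinAt_snd {x : ℝ → ℝ × ℝ} {x' : ℝ × ℝ} {I : Set ℝ} {t : ℝ}
    (h : HasDerivWithinAt x x' I t) : HasDerivWithinAt (fun t => (x t).2) x'.2 I t :=
  (hasFDerivAt_snd (𝕜 := ℝ) (p := x t)).comp_hasDerivWithinAt t h

theorem hasDerivWithinAt_radius {x : ℝ → ℝ × ℝ} {x' : ℝ × ℝ} {I : Set ℝ} {t : ℝ}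
    (h : HasDerivWithinAt x x' I t) (h0 : x t ≠ 0) :
    HasDerivWithinAt (fun t => radius (x t))
      (((x t).1 * x'.1 + (x t).2 * x'.2) / radius (x t)) I t := by
  have hr := radius_pos h0
  have hne : (x t).1 ^ 2 + (x t).2 ^ 2 ≠ 0 := by rw [← radius_sq]; positivity
  have := (((hasDerivWithinAt_fst h).pow 2).add ((hasDerivWithinAt_snd h).pow 2)).sqrt hne
  refine this.congr_deriv ?_
  change _ / (2 * radius (x t)) = _
  field_simp
  push_cast
  ring

theorem eq_of_hasDerivWithinAt_zero {I : Set ℝ} (hI : Convex ℝ I) {f : ℝ → ℝ}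
    (hf : ∀ t ∈ I, HasDerivWithinAt f 0 I t) {s t : ℝ} (hs : s ∈ I) (ht : t ∈ I) : f t = f s := by
  have := hI.norm_image_sub_le_of_norm_hasDerivWithin_le (C := 0) hf (by simp) hs ht
  simpa [sub_eq_zero] using this

/-- Polar angle along a differentiable planar curve that avoids the origin. -/
theorem exists_polar_lift {I : Set ℝ} (hI : Convex ℝ I) (h0 : 0 ∈ I) {x x' : ℝ → ℝ × ℝ}
    (hx : ∀ t ∈ I, HasDerivWithinAt x (x' t) I t) (hne : ∀ t ∈ I, x t ≠ 0) {ψ : ℝ → ℝ}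
    (hψ : Continuous ψ)
    (hψx : ∀ t ∈ I, ψ t * radius (x t) ^ 2 = (x t).1 * (x' t).2 - (x t).2 * (x' t).1) {θ₀ : ℝ}
    (hθ₀ : x 0 = (radius (x 0) * Real.cos θ₀, radius (x 0) * Real.sin θ₀)) :
    ∃ θ : ℝ → ℝ, θ 0 = θ₀ ∧ (∀ t, HasDerivAt θ (ψ t) t) ∧
      ∀ t ∈ I, x t = (radius (x t) * Real.cos (θ t), radius (x t) * Real.sin (θ t)) := by
  let θ : ℝ → ℝ := fun t => θ₀ + ∫ s in (0 : ℝ)..t, ψ s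
  have hθ : ∀ t, HasDerivAt θ (ψ t) t := fun t =>
    (hψ.integral_hasStrictDerivAt 0 t).hasDerivAt.const_add θ₀
  have hθ0 : θ 0 = θ₀ := by simp [θ]
  refine ⟨θ, hθ0, hθ, ?_⟩
  have hc : ∀ t ∈ I, HasDerivWithinAt (fun t => Real.cos (θ t)) (-Real.sin (θ t) * ψ t) I t :=
    fun t _ => (hθ t).cos.hasDerivWithinAt
  have hs : ∀ t ∈ I, HasDerivWithinAt (fun t => Real.sin (θ t)) (Real.cos (θ t) * ψ t) I t :=
    fun t _ => (hθ t).sin.hasDerivWithinAt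
  -- This quotient and the next one are the cosine and sine of the angle between `x t` and the
  -- direction `θ t`. Both have derivative zero because `ψ` is the angular velocity of `x`, so they
  -- keep their initial values `1` and `0`.
  have hda : ∀ t ∈ I, HasDerivWithinAt (fun t => ((x t).1 * Real.cos (θ t)
      + (x t).2 * Real.sin (θ t)) / radius (x t)) 0 I t := by
    intro t ht
    have hr := radius_pos (hne t ht)
    have := ((((hasDerivWithinAt_fst (hx t ht)).mul (hc t ht)).add
      ((hasDerivWithinAt_snd (hx t ht)).mul (hs t ht))).div
      (hasDerivWithinAt_radius (hx t ht) (hne t ht)) hr.ne')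
    refine this.congr_deriv ?_
    rw [div_eq_zero_iff]; left
    have h1 := hψx t ht
    have h2 := radius_sq (x t)
    have h3 := Real.cos_sq_add_sin_sq (θ t)
    simp only [Pi.add_apply, Pi.mul_apply]
    field_simp
    rw [h2] at h1 ⊢
    linear_combination (-(x t).1 * Real.sin (θ t) + (x t).2 * Real.cos (θ t)) * h1
  have hdb : ∀ t ∈ I, HasDerivWithinAt (fun t => ((x t).2 * Real.cos (θ t)
      - (x t).1 * Real.sin (θ t)) / radius (x t)) 0 I t := by
    intro t ht
    have hr := radius_pos (hne t ht)
    have := ((((hasDerivWithinAt_snd (hx t ht)).mul (hc t ht)).sub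
      ((hasDerivWithinAt_fst (hx t ht)).mul (hs t ht))).div
      (hasDerivWithinAt_radius (hx t ht) (hne t ht)) hr.ne')
    refine this.congr_deriv ?_
    rw [div_eq_zero_iff]; left
    have h1 := hψx t ht
    have h2 := radius_sq (x t)
    simp only [Pi.sub_apply, Pi.mul_apply]
    field_simp
    rw [h2] at h1 ⊢
    linear_combination (-((x t).1 * Real.cos (θ t) + (x t).2 * Real.sin (θ t))) * h1
  intro t ht
  have ha := eq_of_hasDerivWithinAt_zero hI hda h0 ht
  have hb := eq_of_hasDerivWithinAt_zero hI hdb h0 ht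
  have hr0 := radius_pos (hne 0 h0)
  have hr := radius_pos (hne t ht)
  have e1 : (x 0).1 = radius (x 0) * Real.cos θ₀ := congrArg Prod.fst hθ₀
  have e2 : (x 0).2 = radius (x 0) * Real.sin θ₀ := congrArg Prod.snd hθ₀
  have h3 := Real.cos_sq_add_sin_sq θ₀
  have h4 := Real.cos_sq_add_sin_sq (θ t)
  rw [hθ0, div_eq_div_iff hr.ne' hr0.ne'] at ha hb
  have ha' : (x t).1 * Real.cos (θ t) + (x t).2 * Real.sin (θ t) = radius (x t) := by
    have : (x 0).1 * Real.cos θ₀ + (x 0).2 * Real.sin θ₀ = radius (x 0) := by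
      rw [e1, e2]; linear_combination radius (x 0) * h3
    rw [this] at ha
    exact mul_right_cancel₀ hr0.ne' (by linarith)
  have hb' : (x t).2 * Real.cos (θ t) - (x t).1 * Real.sin (θ t) = 0 := by
    have : (x 0).2 * Real.cos θ₀ - (x 0).1 * Real.sin θ₀ = 0 := by
      rw [e1, e2]; ring
    rw [this, zero_mul] at hb
    exact (mul_eq_zero.1 hb).resolve_right hr0.ne'
  refine Prod.ext ?_ ?_
  · simp only
    linear_combination (-(x t).1) * h4 + Real.cos (θ t) * ha' - Real.sin (θ t) * hb'
  · simp only
    linear_combination (-(x t).2) * h4 + Real.sin (θ t) * ha' + Real.cos (θ t) * hb'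

end PolarLift

/-! ### The radial equation in polar coordinates -/

section PolarCoefficients

/-- The second order part of `nonlinV`. -/
def quadV (p : Coeffs) (v w : ℝ) : ℝ :=
  (p.a11 * v * |v| + p.a12 * v * |w| + p.a21 * w * |v| + p.a22 * w * |w|)
    + (p.a1 * v ^ 2 + p.a2 * v * w + p.a3 * w ^ 2)

/-- The second order part of `nonlinW`. -/
def quadW (p : Coeffs) (v w : ℝ) : ℝ :=
  (p.b11 * v * |v| + p.b12 * v * |w| + p.b21 * w * |v| + p.b22 * w * |w|)
    + (p.b1 * v ^ 2 + p.b2 * v * w + p.b3 * w ^ 2)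

/-- The third order part of `nonlinV`. -/
def cubV (p : Coeffs) (v w : ℝ) : ℝ :=
  p.ca1 * v ^ 3 + p.ca2 * v * w ^ 2 + p.ca3 * v ^ 2 * w + p.ca4 * w ^ 3

/-- The third order part of `nonlinW`. -/
def cubW (p : Coeffs) (v w : ℝ) : ℝ :=
  p.cb1 * v ^ 3 + p.cb2 * v * w ^ 2 + p.cb3 * v ^ 2 * w + p.cb4 * w ^ 3

/-- Coefficient of `r ^ 2` in the radial velocity. -/
def radialQuad (p : Coeffs) (φ : ℝ) : ℝ :=
  Real.cos φ * quadV p (Real.cos φ) (Real.sin φ) + Real.sin φ * quadW p (Real.cos φ) (Real.sin φ)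

/-- Coefficient of `r ^ 3` in the radial velocity. -/
def radialCub (p : Coeffs) (φ : ℝ) : ℝ :=
  Real.cos φ * cubV p (Real.cos φ) (Real.sin φ) + Real.sin φ * cubW p (Real.cos φ) (Real.sin φ)

/-- Coefficient of `r` in the angular velocity. -/
def angularQuad (p : Coeffs) (φ : ℝ) : ℝ :=
  Real.cos φ * quadW p (Real.cos φ) (Real.sin φ) - Real.sin φ * quadV p (Real.cos φ) (Real.sin φ)

/-- Coefficient of `r ^ 2` in the angular velocity. -/
def angularCub (p : Coeffs) (φ : ℝ) : ℝ :=
  Real.cos φ * cubW p (Real.cos φ) (Real.sin φ) - Real.sin φ * cubV p (Real.cos φ) (Real.sin φ)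

/-- Positive homogeneity of the absolute value turns the modulus terms into genuine second order
terms. For negative `r` their sign would be wrong. -/
theorem nonlinV_smul (p : Coeffs) {r : ℝ} (hr : 0 ≤ r) (v w : ℝ) :
    nonlinV p (r * v) (r * w) = r ^ 2 * quadV p v w + r ^ 3 * cubV p v w := by
  simp only [nonlinV, quadV, cubV, abs_mul, abs_of_nonneg hr]; ring

theorem nonlinW_smul (p : Coeffs) {r : ℝ} (hr : 0 ≤ r) (v w : ℝ) :
    nonlinW p (r * v) (r * w) = r ^ 2 * quadW p v w + r ^ 3 * cubW p v w := by
  simp only [nonlinW, quadW, cubW, abs_mul, abs_of_nonneg hr]; ring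

theorem radialSpeed_eq (p : Coeffs) (μ : ℝ) {r : ℝ} (hr : 0 ≤ r) (φ : ℝ) :
    radialSpeed p μ r φ = r * (μ + r * radialQuad p φ + r ^ 2 * radialCub p φ) := by
  simp only [radialSpeed, field, nonlinV_smul p hr, nonlinW_smul p hr, radialQuad, radialCub]
  linear_combination r * μ * Real.cos_sq_add_sin_sq φ

theorem angularSpeed_eq (p : Coeffs) (μ : ℝ) {r : ℝ} (hr : 0 < r) (φ : ℝ) :
    angularSpeed p μ r φ = p.ω + r * angularQuad p φ + r ^ 2 * angularCub p φ := by
  simp only [angularSpeed, field, nonlinV_smul p hr.le, nonlinW_smul p hr.le, angularQuad,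
    angularCub]
  rw [div_eq_iff hr.ne']
  linear_combination r * p.ω * Real.cos_sq_add_sin_sq φ

theorem continuous_radialQuad (p : Coeffs) : Continuous (radialQuad p) := by
  unfold radialQuad quadV quadW; fun_prop

theorem continuous_radialCub (p : Coeffs) : Continuous (radialCub p) := by
  unfold radialCub cubV cubW; fun_prop

theorem continuous_angularQuad (p : Coeffs) : Continuous (angularQuad p) := by
  unfold angularQuad quadV quadW; fun_prop

theorem continuous_angularCub (p : Coeffs) : Continuous (angularCub p) := by
  unfold angularCub cubV cubW; fun_prop

theorem periodic_radialQuad (p : Coeffs) : Function.Periodic (radialQuad p) (2 * Real.pi) := by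
  intro φ; simp only [radialQuad, Real.cos_add_two_pi, Real.sin_add_two_pi]

theorem periodic_radialCub (p : Coeffs) : Function.Periodic (radialCub p) (2 * Real.pi) := by
  intro φ; simp only [radialCub, Real.cos_add_two_pi, Real.sin_add_two_pi]

theorem periodic_angularQuad (p : Coeffs) : Function.Periodic (angularQuad p) (2 * Real.pi) := by
  intro φ; simp only [angularQuad, Real.cos_add_two_pi, Real.sin_add_two_pi]

theorem periodic_angularCub (p : Coeffs) : Function.Periodic (angularCub p) (2 * Real.pi) := by
  intro φ; simp only [angularCub, Real.cos_add_two_pi, Real.sin_add_two_pi]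

/-- The coefficient of `r ^ 3` in the radial equation `dr/dφ` at `μ = 0`. -/
def rateCub (p : Coeffs) (φ : ℝ) : ℝ :=
  radialCub p φ / p.ω - radialQuad p φ * angularQuad p φ / p.ω ^ 2

theorem continuous_rateCub (p : Coeffs) : Continuous (rateCub p) :=
  ((continuous_radialCub p).div_const _).sub
    (((continuous_radialQuad p).mul (continuous_angularQuad p)).div_const _)

theorem periodic_rateCub (p : Coeffs) : Function.Periodic (rateCub p) (2 * Real.pi) := by
  intro φ
  simp only [rateCub, periodic_radialCub p φ, periodic_radialQuad p φ, periodic_angularQuad p φ]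

/-- The averaged coefficient of `r ^ 2`. -/
def avgQuad (p : Coeffs) : ℝ := 2 / (3 * Real.pi * p.ω) * sigmaSharp p

/-- The averaged coefficient of `r ^ 3`. -/
def avgCub (p : Coeffs) : ℝ :=
  Sq p / (8 * p.ω ^ 2) + Sc p / (8 * p.ω) - sigma2 p / (2 * Real.pi * p.ω ^ 2)

theorem normalFormCubic_eq (p : Coeffs) (μ r : ℝ) :
    normalFormCubic p μ r = μ / p.ω * r + avgQuad p * r ^ 2 + avgCub p * r ^ 3 := rfl

end PolarCoefficients

/-! ### The averaged coefficients, quadrant by quadrant -/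

section Averages

/-- Shifting every quadrant back to `[0, π/2]`, where `cos` and `sin` are nonnegative, lets the
absolute values be removed. -/
theorem integral_two_pi_eq_quadrants {g : ℝ → ℝ} (hg : Continuous g) :
    ∫ φ in (0 : ℝ)..2 * Real.pi, g φ =
      (∫ φ in (0 : ℝ)..Real.pi / 2, g φ) + (∫ φ in (0 : ℝ)..Real.pi / 2, g (φ + Real.pi / 2))
      + (∫ φ in (0 : ℝ)..Real.pi / 2, g (φ + Real.pi))
      + ∫ φ in (0 : ℝ)..Real.pi / 2, g (φ + Real.pi + Real.pi / 2) := by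
  have hi : ∀ a b, IntervalIntegrable g MeasureTheory.volume a b :=
    fun a b => hg.intervalIntegrable a b
  have h3 : ∫ φ in (0 : ℝ)..Real.pi / 2, g (φ + Real.pi + Real.pi / 2)
      = ∫ φ in (0 : ℝ)..Real.pi / 2, g (φ + (Real.pi + Real.pi / 2)) := by
    simp only [add_assoc]
  rw [h3, intervalIntegral.integral_comp_add_right, intervalIntegral.integral_comp_add_right,
    intervalIntegral.integral_comp_add_right]
  rw [← intervalIntegral.integral_add_adjacent_intervals (hi 0 (Real.pi / 2)) (hi _ _),
    ← intervalIntegral.integral_add_adjacent_intervals (hi (Real.pi / 2) Real.pi) (hi _ _),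
    ← intervalIntegral.integral_add_adjacent_intervals (hi Real.pi (Real.pi + Real.pi / 2))
      (hi _ _)]
  ring_nf

/-- `c ⬝ Q(c, s) + s ⬝ Q'(c, s)` for two binary quadratic forms. -/
def radialForm (V0 V1 V2 W0 W1 W2 c s : ℝ) : ℝ :=
  c * (V0 * c ^ 2 + V1 * c * s + V2 * s ^ 2) + s * (W0 * c ^ 2 + W1 * c * s + W2 * s ^ 2)

/-- `c ⬝ C(c, s) + s ⬝ C'(c, s)` for two binary cubic forms. -/
def radialForm₃ (V0 V1 V2 V3 W0 W1 W2 W3 c s : ℝ) : ℝ :=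
  c * (V0 * c ^ 3 + V1 * c * s ^ 2 + V2 * c ^ 2 * s + V3 * s ^ 3)
    + s * (W0 * c ^ 3 + W1 * c * s ^ 2 + W2 * c ^ 2 * s + W3 * s ^ 3)

theorem integral_radialForm (V0 V1 V2 W0 W1 W2 : ℝ) :
    ∫ φ in (0 : ℝ)..Real.pi / 2, radialForm V0 V1 V2 W0 W1 W2 (Real.cos φ) (Real.sin φ)
      = 2 / 3 * V0 + 1 / 3 * (V1 + W0) + 1 / 3 * (V2 + W1) + 2 / 3 * W2 := by
  have hd : ∀ φ : ℝ, HasDerivAt (fun φ => V0 * (Real.sin φ - Real.sin φ ^ 3 / 3)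
      - (V1 + W0) * (Real.cos φ ^ 3 / 3) + (V2 + W1) * (Real.sin φ ^ 3 / 3)
      + W2 * (Real.cos φ ^ 3 / 3 - Real.cos φ))
      (radialForm V0 V1 V2 W0 W1 W2 (Real.cos φ) (Real.sin φ)) φ := by
    intro φ
    have hs := Real.hasDerivAt_sin φ
    have hc := Real.hasDerivAt_cos φ
    have := ((((hs.sub ((hs.pow 3).div_const 3)).const_mul V0).sub
      (((hc.pow 3).div_const 3).const_mul (V1 + W0))).add
      (((hs.pow 3).div_const 3).const_mul (V2 + W1))).add
      ((((hc.pow 3).div_const 3).sub hc).const_mul W2)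
    refine this.congr_deriv ?_
    have h := Real.cos_sq_add_sin_sq φ
    unfold radialForm
    push_cast
    linear_combination (-V0 * Real.cos φ - W2 * Real.sin φ) * h
  rw [intervalIntegral.integral_eq_sub_of_hasDerivAt (fun φ _ => hd φ)
    (by apply Continuous.intervalIntegrable; unfold radialForm; fun_prop)]
  simp
  ring

/-- The integrand is `rateCub` on one quadrant: the form with coefficients `W, -V` is the angular
coefficient that belongs to the radial one. The integral follows from an explicit antiderivative of
a sextic form in `cos` and `sin`. -/
theorem integral_rateForm (ω V0 V1 V2 W0 W1 W2 C0 C1 C2 C3 D0 D1 D2 D3 : ℝ) :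
    ∫ φ in (0 : ℝ)..Real.pi / 2,
      (radialForm₃ C0 C1 C2 C3 D0 D1 D2 D3 (Real.cos φ) (Real.sin φ) / ω
        - radialForm V0 V1 V2 W0 W1 W2 (Real.cos φ) (Real.sin φ)
          * radialForm W0 W1 W2 (-V0) (-V1) (-V2) (Real.cos φ) (Real.sin φ) / ω ^ 2)
      = (3 * Real.pi / 16 * (C0 + D3) + 1 / 4 * (C2 + D0) + Real.pi / 16 * (C1 + D2)
          + 1 / 4 * (C3 + D1)) / ω
        - (5 * Real.pi / 32 * (V0 * W0 - W2 * V2)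
          + 1 / 6 * (V0 * (W1 - V0) + (V1 + W0) * W0)
          + Real.pi / 32 * (V0 * (W2 - V1) + (V1 + W0) * (W1 - V0) + (V2 + W1) * W0)
          + 1 / 12 * (-V0 * V2 + (V1 + W0) * (W2 - V1) + (V2 + W1) * (W1 - V0) + W2 * W0)
          + Real.pi / 32 * (-(V1 + W0) * V2 + (V2 + W1) * (W2 - V1) + W2 * (W1 - V0))
          + 1 / 6 * (-(V2 + W1) * V2 + W2 * (W2 - V1))) / ω ^ 2 := by
  set Q0 := (C0 / ω) - (V0 * W0) / ω ^ 2 with hQ0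
  set Q1 := (C2 + D0) / ω - (V0 * (W1 - V0) + (V1 + W0) * W0) / ω ^ 2 with hQ1
  set Q2 := (C0 + C1 + D2) / ω
    - (V0 * (W2 - V1) + (V1 + W0) * (W1 - V0) + (V2 + W1) * W0) / ω ^ 2 with hQ2
  set Q3 := (C2 + D0 + C3 + D1) / ω
    - (-V0 * V2 + (V1 + W0) * (W2 - V1) + (V2 + W1) * (W1 - V0) + W2 * W0) / ω ^ 2 with hQ3
  set Q4 := (C1 + D2 + D3) / ω
    - (-(V1 + W0) * V2 + (V2 + W1) * (W2 - V1) + W2 * (W1 - V0)) / ω ^ 2 with hQ4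
  set Q5 := (C3 + D1) / ω - (-(V2 + W1) * V2 + W2 * (W2 - V1)) / ω ^ 2 with hQ5
  set Q6 := D3 / ω - (-(W2 * V2)) / ω ^ 2 with hQ6
  have hpoly : ∀ φ : ℝ, (radialForm₃ C0 C1 C2 C3 D0 D1 D2 D3 (Real.cos φ) (Real.sin φ) / ω
        - radialForm V0 V1 V2 W0 W1 W2 (Real.cos φ) (Real.sin φ)
          * radialForm W0 W1 W2 (-V0) (-V1) (-V2) (Real.cos φ) (Real.sin φ) / ω ^ 2)
      = Q0 * Real.cos φ ^ 6 + Q1 * (Real.cos φ ^ 5 * Real.sin φ)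
        + Q2 * (Real.cos φ ^ 4 * Real.sin φ ^ 2) + Q3 * (Real.cos φ ^ 3 * Real.sin φ ^ 3)
        + Q4 * (Real.cos φ ^ 2 * Real.sin φ ^ 4) + Q5 * (Real.cos φ * Real.sin φ ^ 5)
        + Q6 * Real.sin φ ^ 6 := by
    intro φ
    have h := Real.cos_sq_add_sin_sq φ
    -- The quartic part is multiplied by `cos² + sin² = 1`, so that the whole integrand is
    -- homogeneous of degree six with coefficients `Q0, …, Q6`.
    have h4 : radialForm₃ C0 C1 C2 C3 D0 D1 D2 D3 (Real.cos φ) (Real.sin φ)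
        = radialForm₃ C0 C1 C2 C3 D0 D1 D2 D3 (Real.cos φ) (Real.sin φ)
          * (Real.cos φ ^ 2 + Real.sin φ ^ 2) := by rw [h, mul_one]
    rw [h4, hQ0, hQ1, hQ2, hQ3, hQ4, hQ5, hQ6]
    simp only [radialForm, radialForm₃]
    ring
  simp only [hpoly]
  have hd : ∀ φ : ℝ, HasDerivAt (fun φ =>
      Q0 * (5 / 16 * φ + 5 / 16 * (Real.sin φ * Real.cos φ)
        + 5 / 24 * (Real.sin φ * Real.cos φ ^ 3) + 1 / 6 * (Real.sin φ * Real.cos φ ^ 5))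
      - Q1 * (1 / 6 * Real.cos φ ^ 6)
      + Q2 * (1 / 16 * φ + 1 / 16 * (Real.sin φ * Real.cos φ)
        + 1 / 24 * (Real.sin φ * Real.cos φ ^ 3) - 1 / 6 * (Real.sin φ * Real.cos φ ^ 5))
      + Q3 * (1 / 4 * Real.sin φ ^ 4 - 1 / 6 * Real.sin φ ^ 6)
      + Q4 * (1 / 16 * φ - 1 / 16 * (Real.cos φ * Real.sin φ)
        - 1 / 24 * (Real.cos φ * Real.sin φ ^ 3) + 1 / 6 * (Real.cos φ * Real.sin φ ^ 5))
      + Q5 * (1 / 6 * Real.sin φ ^ 6)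
      + Q6 * (5 / 16 * φ - 5 / 16 * (Real.cos φ * Real.sin φ)
        - 5 / 24 * (Real.cos φ * Real.sin φ ^ 3) - 1 / 6 * (Real.cos φ * Real.sin φ ^ 5)))
      (Q0 * Real.cos φ ^ 6 + Q1 * (Real.cos φ ^ 5 * Real.sin φ)
        + Q2 * (Real.cos φ ^ 4 * Real.sin φ ^ 2) + Q3 * (Real.cos φ ^ 3 * Real.sin φ ^ 3)
        + Q4 * (Real.cos φ ^ 2 * Real.sin φ ^ 4) + Q5 * (Real.cos φ * Real.sin φ ^ 5)
        + Q6 * Real.sin φ ^ 6) φ := by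
    intro φ
    have hs := Real.hasDerivAt_sin φ
    have hc := Real.hasDerivAt_cos φ
    have hi := hasDerivAt_id' φ
    have := (((((((((hi.const_mul (5 / 16)).add ((hs.mul hc).const_mul (5 / 16))).add
        ((hs.mul (hc.pow 3)).const_mul (5 / 24))).add
        ((hs.mul (hc.pow 5)).const_mul (1 / 6))).const_mul Q0).sub
      (((hc.pow 6).const_mul (1 / 6)).const_mul Q1)).add
      (((((hi.const_mul (1 / 16)).add ((hs.mul hc).const_mul (1 / 16))).add
        ((hs.mul (hc.pow 3)).const_mul (1 / 24))).sub
        ((hs.mul (hc.pow 5)).const_mul (1 / 6))).const_mul Q2)).add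
      ((((hs.pow 4).const_mul (1 / 4)).sub ((hs.pow 6).const_mul (1 / 6))).const_mul Q3)).add
      (((((hi.const_mul (1 / 16)).sub ((hc.mul hs).const_mul (1 / 16))).sub
        ((hc.mul (hs.pow 3)).const_mul (1 / 24))).add
        ((hc.mul (hs.pow 5)).const_mul (1 / 6))).const_mul Q4)).add
      (((hs.pow 6).const_mul (1 / 6)).const_mul Q5) |>.add
      (((((hi.const_mul (5 / 16)).sub ((hc.mul hs).const_mul (5 / 16))).sub
        ((hc.mul (hs.pow 3)).const_mul (5 / 24))).sub
        ((hc.mul (hs.pow 5)).const_mul (1 / 6))).const_mul Q6)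
    refine this.congr_deriv ?_
    have h := Real.cos_sq_add_sin_sq φ
    have h' : Real.sin φ ^ 2 = 1 - Real.cos φ ^ 2 := by linarith
    have e4 : Real.sin φ ^ 4 = (1 - Real.cos φ ^ 2) ^ 2 := by rw [← h']; ring
    have e6 : Real.sin φ ^ 6 = (1 - Real.cos φ ^ 2) ^ 3 := by rw [← h']; ring
    have e3 : Real.sin φ ^ 3 = (1 - Real.cos φ ^ 2) * Real.sin φ := by rw [← h']; ring
    have e5 : Real.sin φ ^ 5 = (1 - Real.cos φ ^ 2) ^ 2 * Real.sin φ := by rw [← h']; ring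
    have e1 : Real.sin φ * Real.sin φ = 1 - Real.cos φ ^ 2 := by rw [← h']; ring
    simp only [Pi.pow_apply]
    push_cast
    ring_nf
    simp only [h', e4, e6, e3, e5]
    ring_nf
  rw [intervalIntegral.integral_eq_sub_of_hasDerivAt (fun φ _ => hd φ)
    (by apply Continuous.intervalIntegrable; fun_prop)]
  simp only [Real.sin_pi_div_two, Real.cos_pi_div_two, Real.sin_zero, Real.cos_zero]
  rw [hQ0, hQ1, hQ2, hQ3, hQ4, hQ5, hQ6]
  ring


theorem cos_nonneg_sin_nonneg {φ : ℝ} (h : φ ∈ uIcc 0 (Real.pi / 2)) :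
    0 ≤ Real.cos φ ∧ 0 ≤ Real.sin φ := by
  rw [uIcc_of_le (by positivity)] at h
  exact ⟨Real.cos_nonneg_of_mem_Icc ⟨by linarith [h.1, Real.pi_pos], h.2⟩,
    Real.sin_nonneg_of_mem_Icc ⟨h.1, by linarith [h.2, Real.pi_pos]⟩⟩

/-- The coefficients in the four quadrants, seen from the rotated frame: in every quadrant the
polar coefficients are polynomials in `cos` and `sin`. -/
theorem polar_coefficients_quadrants (p : Coeffs) {φ : ℝ} (h : φ ∈ uIcc 0 (Real.pi / 2)) :
    let c := Real.cos φ
    let s := Real.sin φ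
    (radialQuad p φ = radialForm (p.a11 + p.a1) (p.a12 + p.a21 + p.a2) (p.a22 + p.a3)
        (p.b11 + p.b1) (p.b12 + p.b21 + p.b2) (p.b22 + p.b3) c s ∧
      angularQuad p φ = radialForm (p.b11 + p.b1) (p.b12 + p.b21 + p.b2) (p.b22 + p.b3)
        (-(p.a11 + p.a1)) (-(p.a12 + p.a21 + p.a2)) (-(p.a22 + p.a3)) c s ∧
      radialCub p φ = radialForm₃ p.ca1 p.ca2 p.ca3 p.ca4 p.cb1 p.cb2 p.cb3 p.cb4 c s) ∧
    (radialQuad p (φ + Real.pi / 2) =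
        radialForm (p.b22 + p.b3) (p.b21 - p.b12 - p.b2) (p.b1 - p.b11)
        (-(p.a22 + p.a3)) (-(p.a21 - p.a12 - p.a2)) (-(p.a1 - p.a11)) c s ∧
      angularQuad p (φ + Real.pi / 2) =
        radialForm (-(p.a22 + p.a3)) (-(p.a21 - p.a12 - p.a2)) (-(p.a1 - p.a11))
        (-(p.b22 + p.b3)) (-(p.b21 - p.b12 - p.b2)) (-(p.b1 - p.b11)) c s ∧
      radialCub p (φ + Real.pi / 2) =
        radialForm₃ p.cb4 p.cb3 (-p.cb2) (-p.cb1) (-p.ca4) (-p.ca3) p.ca2 p.ca1 c s) ∧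
    (radialQuad p (φ + Real.pi) =
        radialForm (p.a11 - p.a1) (p.a12 + p.a21 - p.a2) (p.a22 - p.a3)
        (p.b11 - p.b1) (p.b12 + p.b21 - p.b2) (p.b22 - p.b3) c s ∧
      angularQuad p (φ + Real.pi) =
        radialForm (p.b11 - p.b1) (p.b12 + p.b21 - p.b2) (p.b22 - p.b3)
        (-(p.a11 - p.a1)) (-(p.a12 + p.a21 - p.a2)) (-(p.a22 - p.a3)) c s ∧
      radialCub p (φ + Real.pi) =
        radialForm₃ p.ca1 p.ca2 p.ca3 p.ca4 p.cb1 p.cb2 p.cb3 p.cb4 c s) ∧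
    (radialQuad p (φ + Real.pi + Real.pi / 2) =
        radialForm (p.b22 - p.b3) (p.b21 - p.b12 + p.b2) (-p.b11 - p.b1)
        (-(p.a22 - p.a3)) (-(p.a21 - p.a12 + p.a2)) (-(-p.a11 - p.a1)) c s ∧
      angularQuad p (φ + Real.pi + Real.pi / 2) =
        radialForm (-(p.a22 - p.a3)) (-(p.a21 - p.a12 + p.a2)) (-(-p.a11 - p.a1))
        (-(p.b22 - p.b3)) (-(p.b21 - p.b12 + p.b2)) (-(-p.b11 - p.b1)) c s ∧
      radialCub p (φ + Real.pi + Real.pi / 2) =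
        radialForm₃ p.cb4 p.cb3 (-p.cb2) (-p.cb1) (-p.ca4) (-p.ca3) p.ca2 p.ca1 c s) := by
  obtain ⟨hc, hs⟩ := cos_nonneg_sin_nonneg h
  intro c s
  simp only [radialQuad, angularQuad, radialCub, quadV, quadW, cubV, cubW, radialForm,
    radialForm₃, Real.cos_add_pi_div_two, Real.sin_add_pi_div_two, Real.cos_add_pi,
    Real.sin_add_pi, abs_neg, abs_of_nonneg hc, abs_of_nonneg hs, c, s]
  refine ⟨⟨?_, ?_, ?_⟩, ⟨?_, ?_, ?_⟩, ⟨?_, ?_, ?_⟩, ⟨?_, ?_, ?_⟩⟩ <;> first | trivial | ring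

theorem integral_radialQuad (p : Coeffs) :
    ∫ φ in (0 : ℝ)..2 * Real.pi, radialQuad p φ = 4 / 3 * sigmaSharp p := by
  rw [integral_two_pi_eq_quadrants (continuous_radialQuad p),
    intervalIntegral.integral_congr fun φ h => (polar_coefficients_quadrants p h).1.1,
    intervalIntegral.integral_congr fun φ h => (polar_coefficients_quadrants p h).2.1.1,
    intervalIntegral.integral_congr fun φ h => (polar_coefficients_quadrants p h).2.2.1.1,
    intervalIntegral.integral_congr fun φ h => (polar_coefficients_quadrants p h).2.2.2.1]
  simp only [integral_radialForm, sigmaSharp]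
  ring

/-- In the sum over the quadrants the products of a modulus coefficient with a quadratic coefficient
cancel by sign. What survives separates into `σ₂`, `S_q` and `S_c`. -/
theorem integral_rateCub (p : Coeffs) :
    ∫ φ in (0 : ℝ)..2 * Real.pi, rateCub p φ = 2 * Real.pi * avgCub p := by
  have hcongr : ∀ {a b : ℝ → ℝ}, (∀ φ ∈ uIcc (0 : ℝ) (Real.pi / 2), a φ = b φ) →
      ∫ φ in (0 : ℝ)..Real.pi / 2, a φ = ∫ φ in (0 : ℝ)..Real.pi / 2, b φ :=
    fun h => intervalIntegral.integral_congr h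
  rw [integral_two_pi_eq_quadrants (continuous_rateCub p)]
  have h1 := hcongr (a := fun φ => rateCub p φ) fun φ h => by
    obtain ⟨e1, e2, e3⟩ := (polar_coefficients_quadrants p h).1
    simp only [rateCub]
    rw [e1, e2, e3]
  have h2 := hcongr (a := fun φ => rateCub p (φ + Real.pi / 2)) fun φ h => by
    obtain ⟨e1, e2, e3⟩ := (polar_coefficients_quadrants p h).2.1
    simp only [rateCub]
    rw [e1, e2, e3]
  have h3 := hcongr (a := fun φ => rateCub p (φ + Real.pi)) fun φ h => by
    obtain ⟨e1, e2, e3⟩ := (polar_coefficients_quadrants p h).2.2.1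
    simp only [rateCub]
    rw [e1, e2, e3]
  have h4 := hcongr (a := fun φ => rateCub p (φ + Real.pi + Real.pi / 2)) fun φ h => by
    obtain ⟨e1, e2, e3⟩ := (polar_coefficients_quadrants p h).2.2.2
    simp only [rateCub]
    rw [e1, e2, e3]
  rw [h1, h2, h3, h4]
  rw [integral_rateForm, integral_rateForm, integral_rateForm, integral_rateForm]
  have hpi : (2 * Real.pi) * avgCub p = 2 * Real.pi * (Sq p / 8 / p.ω ^ 2 + Sc p / 8 / p.ω)
      - sigma2 p / p.ω ^ 2 := by
    have := Real.pi_ne_zero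
    simp only [avgCub, ← div_div]
    field_simp
  rw [hpi]
  simp only [Sq, Sc, sigma2]
  ring

end Averages

/-! ### The growth rate as a rational function, with bounds uniform in the angle -/

section Rate

/-- The angular velocity as a polynomial in `s`, also for `s ≤ 0`. -/
def angularPoly (p : Coeffs) (φ s : ℝ) : ℝ := p.ω + s * angularQuad p φ + s ^ 2 * angularCub p φ

/-- The logarithmic radial growth rate `(dr/dφ) / r`, as a rational function of `s`. -/
def rate (p : Coeffs) (μ φ s : ℝ) : ℝ :=
  (μ + s * radialQuad p φ + s ^ 2 * radialCub p φ) / angularPoly p φ s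

/-- The `s`-derivative of `rate`. -/
def rateDeriv (p : Coeffs) (μ φ s : ℝ) : ℝ :=
  ((radialQuad p φ + 2 * s * radialCub p φ) * angularPoly p φ s
    - (μ + s * radialQuad p φ + s ^ 2 * radialCub p φ)
      * (angularQuad p φ + 2 * s * angularCub p φ)) / angularPoly p φ s ^ 2

/-- Uniform bounds for `rate` and `rateDeriv` for `|μ|, |s| ≤ ρ`. -/
structure RateBounds (p : Coeffs) (ρ M : ℝ) : Prop where
  ne : p.ω ≠ 0
  ρ_pos : 0 < ρ
  ρ_le : ρ ≤ 1
  one_le : 1 ≤ M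
  small : 64 * Real.pi * M * ρ ≤ 1
  bound_radialQuad : ∀ φ, |radialQuad p φ| ≤ M
  bound_radialCub : ∀ φ, |radialCub p φ| ≤ M
  bound_div : ∀ φ, |radialQuad p φ / p.ω| ≤ M
  bound_rateCub : ∀ φ, |rateCub p φ| ≤ M
  angular : ∀ φ s, |s| ≤ ρ → |angularPoly p φ s - p.ω| ≤ |p.ω| / 2
  rate_lip : ∀ φ μ μ' s s', |μ| ≤ ρ → |μ'| ≤ ρ → |s| ≤ ρ → |s'| ≤ ρ →
    |rate p μ φ s - rate p μ' φ s'| ≤ M * (|μ - μ'| + |s - s'|)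
  rateDeriv_lip : ∀ φ μ μ' s s', |μ| ≤ ρ → |μ'| ≤ ρ → |s| ≤ ρ → |s'| ≤ ρ →
    |rateDeriv p μ φ s - rateDeriv p μ' φ s'| ≤ M * (|μ - μ'| + |s - s'|)
  rate_expand : ∀ φ μ s, |μ| ≤ ρ → |s| ≤ ρ →
    |rate p μ φ s - (μ / p.ω + s * (radialQuad p φ / p.ω) + s ^ 2 * rateCub p φ)|
      ≤ M * (|s| ^ 3 + |μ| * |s|)
  rateDeriv_expand : ∀ φ μ s, |μ| ≤ ρ → |s| ≤ ρ →
    |rateDeriv p μ φ s - (radialQuad p φ / p.ω + 2 * s * rateCub p φ)| ≤ M * (s ^ 2 + |μ|)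

theorem exists_abs_le_of_periodic {g : ℝ → ℝ} (hg : Continuous g)
    (hp : Function.Periodic g (2 * Real.pi)) : ∃ B, 0 < B ∧ ∀ φ, |g φ| ≤ B := by
  have hb : Bornology.IsBounded (range g) :=
    Function.Periodic.isBounded_of_continuous hp (by positivity) hg
  obtain ⟨B, hB⟩ := hb.exists_norm_le
  refine ⟨max B 1, by positivity, fun φ => ?_⟩
  exact (hB _ ⟨φ, rfl⟩).trans (le_max_left _ _)

/-- The compact box in which the parameters of `rate` range. -/
def paramBox (ρ B : ℝ) : Set (ℝ × ℝ × ℝ × ℝ × ℝ × ℝ) :=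
  Icc (-1) 1 ×ˢ Icc (-ρ) ρ ×ˢ Icc (-B) B ×ˢ Icc (-B) B ×ˢ Icc (-B) B ×ˢ Icc (-B) B

theorem isCompact_paramBox (ρ B : ℝ) : IsCompact (paramBox ρ B) :=
  isCompact_Icc.prod (isCompact_Icc.prod (isCompact_Icc.prod (isCompact_Icc.prod
    (isCompact_Icc.prod isCompact_Icc))))

theorem mem_paramBox {ρ B μ s a b k l : ℝ} (hμ : |μ| ≤ 1) (hs : |s| ≤ ρ) (ha : |a| ≤ B)
    (hb : |b| ≤ B) (hk : |k| ≤ B) (hl : |l| ≤ B) : (μ, s, a, b, k, l) ∈ paramBox ρ B :=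
  ⟨abs_le.1 hμ, abs_le.1 hs, abs_le.1 ha, abs_le.1 hb, abs_le.1 hk, abs_le.1 hl⟩

theorem exists_bound_on_paramBox {ρ B : ℝ} {f : ℝ × ℝ × ℝ × ℝ × ℝ × ℝ → ℝ}
    (hf : ContinuousOn f (paramBox ρ B)) : ∃ M, 0 ≤ M ∧ ∀ q ∈ paramBox ρ B, |f q| ≤ M := by
  obtain ⟨M, hM⟩ := (isCompact_paramBox ρ B).exists_bound_of_continuousOn hf
  exact ⟨max M 0, le_max_right _ _, fun q hq => (hM q hq).trans (le_max_left _ _)⟩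

/-- A `C¹` function is locally Lipschitz, and compactness of the box makes the constant uniform. The
four coefficient slots are held fixed, since only `μ` and `s` are compared. -/
theorem exists_lip_on_paramBox {ρ B : ℝ} {f : ℝ × ℝ × ℝ × ℝ × ℝ × ℝ → ℝ}
    (hf : ∀ q ∈ paramBox ρ B, ContDiffAt ℝ 1 f q) :
    ∃ M : ℝ, 0 ≤ M ∧ ∀ μ μ' s s' a b k l : ℝ, (μ, s, a, b, k, l) ∈ paramBox ρ B →
      (μ', s', a, b, k, l) ∈ paramBox ρ B →
      |f (μ, s, a, b, k, l) - f (μ', s', a, b, k, l)| ≤ M * (|μ - μ'| + |s - s'|) := by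
  have hl : LocallyLipschitzOn (paramBox ρ B) f := by
    intro q hq
    obtain ⟨K, t, ht, h⟩ := (hf q hq).exists_lipschitzOnWith
    exact ⟨K, t, mem_nhdsWithin_of_mem_nhds ht, h⟩
  obtain ⟨K, hK⟩ := hl.exists_lipschitzOnWith_of_compact (isCompact_paramBox ρ B)
  refine ⟨K, K.2, fun μ μ' s s' a b k l h h' => ?_⟩
  have := hK.dist_le_mul _ h _ h'
  rw [Real.dist_eq] at this
  refine this.trans (mul_le_mul_of_nonneg_left ?_ K.2)
  simp only [Prod.dist_eq, Real.dist_eq, dist_self]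
  have h1 := abs_nonneg (μ - μ')
  have h2 := abs_nonneg (s - s')
  exact max_le (by linarith) (max_le (by linarith) (by linarith))

/-- The periodic coefficients are bounded, so they can be replaced by free parameters `a, b, k, l`
in a compact box. Every estimate for functions on the box is then uniform in `φ`, and no regularity
in `φ` is needed. -/
theorem exists_rateBounds (p : Coeffs) (hω : p.ω ≠ 0) : ∃ ρ M, RateBounds p ρ M := by
  obtain ⟨B1, hB1, h1⟩ := exists_abs_le_of_periodic (continuous_radialQuad p)
    (periodic_radialQuad p)
  obtain ⟨B2, hB2, h2⟩ := exists_abs_le_of_periodic (continuous_radialCub p)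
    (periodic_radialCub p)
  obtain ⟨B3, hB3, h3⟩ := exists_abs_le_of_periodic (continuous_angularQuad p)
    (periodic_angularQuad p)
  obtain ⟨B4, hB4, h4⟩ := exists_abs_le_of_periodic (continuous_angularCub p)
    (periodic_angularCub p)
  obtain ⟨B5, hB5, h5⟩ := exists_abs_le_of_periodic (continuous_rateCub p)
    (periodic_rateCub p)
  set B := B1 + B2 + B3 + B4 with hB
  have hBpos : 0 < B := by positivity
  replace h1 : ∀ φ, |radialQuad p φ| ≤ B := fun φ => (h1 φ).trans (by linarith)
  replace h2 : ∀ φ, |radialCub p φ| ≤ B := fun φ => (h2 φ).trans (by linarith)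
  replace h3 : ∀ φ, |angularQuad p φ| ≤ B := fun φ => (h3 φ).trans (by linarith)
  replace h4 : ∀ φ, |angularCub p φ| ≤ B := fun φ => (h4 φ).trans (by linarith)
  have hω' : 0 < |p.ω| := abs_pos.2 hω
  -- With `ρ₀ ≤ 1` the two correction terms of the denominator are each at most `ρ₀ B ≤ |ω| / 4`, so
  -- the denominator stays within `|ω| / 2` of `ω`.
  set ρ₀ := min 1 (|p.ω| / (4 * B)) with hρ₀
  have hρ₀pos : 0 < ρ₀ := by positivity
  have hρ₀1 : ρ₀ ≤ 1 := min_le_left _ _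
  have hρ₀2 : ρ₀ * (4 * B) ≤ |p.ω| := by
    rw [← le_div_iff₀ (by positivity)]; exact min_le_right _ _
  have hden : ∀ s k l, |s| ≤ ρ₀ → |k| ≤ B → |l| ≤ B → |p.ω + s * k + s ^ 2 * l - p.ω| ≤ |p.ω| / 2 := by
    intro s k l hs hk hl
    have e1 : |s * k| ≤ ρ₀ * B := by
      rw [abs_mul]; exact mul_le_mul hs hk (abs_nonneg _) hρ₀pos.le
    have e2 : |s ^ 2 * l| ≤ ρ₀ * B := by
      rw [abs_mul, abs_pow]
      refine mul_le_mul ?_ hl (abs_nonneg _) hρ₀pos.le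
      nlinarith [abs_nonneg s]
    have e3 : p.ω + s * k + s ^ 2 * l - p.ω = s * k + s ^ 2 * l := by ring
    rw [e3]
    refine (abs_add_le _ _).trans ?_
    linarith
  have hden0 : ∀ q ∈ paramBox ρ₀ B,
      p.ω + q.2.1 * q.2.2.2.2.1 + q.2.1 ^ 2 * q.2.2.2.2.2 ≠ 0 := by
    rintro ⟨μ, s, a, b, k, l⟩ ⟨-, hs, -, -, hk, hl⟩
    intro h0
    have := hden s k l (abs_le.2 hs) (abs_le.2 hk) (abs_le.2 hl)
    simp only at h0
    rw [h0] at this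
    simp at this
    linarith
  obtain ⟨M1, hM1, hb1⟩ := exists_lip_on_paramBox (ρ := ρ₀) (B := B)
    (f := fun q => (q.1 + q.2.1 * q.2.2.1 + q.2.1 ^ 2 * q.2.2.2.1)
      / (p.ω + q.2.1 * q.2.2.2.2.1 + q.2.1 ^ 2 * q.2.2.2.2.2))
    (fun q hq => by
      apply ContDiffAt.div
      · fun_prop
      · fun_prop
      · exact hden0 q hq)
  obtain ⟨M2, hM2, hb2⟩ := exists_lip_on_paramBox (ρ := ρ₀) (B := B)
    (f := fun q => ((q.2.2.1 + 2 * q.2.1 * q.2.2.2.1)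
        * (p.ω + q.2.1 * q.2.2.2.2.1 + q.2.1 ^ 2 * q.2.2.2.2.2)
      - (q.1 + q.2.1 * q.2.2.1 + q.2.1 ^ 2 * q.2.2.2.1)
        * (q.2.2.2.2.1 + 2 * q.2.1 * q.2.2.2.2.2))
      / (p.ω + q.2.1 * q.2.2.2.2.1 + q.2.1 ^ 2 * q.2.2.2.2.2) ^ 2)
    (fun q hq => by
      apply ContDiffAt.div
      · fun_prop
      · fun_prop
      · exact pow_ne_zero 2 (hden0 q hq))
  have hbd : ∀ P : ℝ × ℝ × ℝ × ℝ × ℝ × ℝ → ℝ, Continuous P → ∀ n : ℕ,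
      ∃ M, 0 ≤ M ∧ ∀ q ∈ paramBox ρ₀ B, |P q / (p.ω ^ 2
        * (p.ω + q.2.1 * q.2.2.2.2.1 + q.2.1 ^ 2 * q.2.2.2.2.2) ^ n)| ≤ M := by
    intro P hP n
    refine exists_bound_on_paramBox (hP.continuousOn.div (by fun_prop) fun q hq => ?_)
    exact mul_ne_zero (pow_ne_zero 2 hω) (pow_ne_zero n (hden0 q hq))
  -- `M3` and `M4` bound the quotients multiplying `s³` and `μ s` in the exact Taylor remainder of
  -- `rate`. `M5` and `M6` do the same for `s²` and `μ` in that of `rateDeriv`.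
  obtain ⟨M3, hM3, hb3⟩ := hbd (fun q => -(((q.2.2.2.1 * p.ω - q.2.2.1 * q.2.2.2.2.1) * q.2.2.2.2.1
    + q.2.2.1 * p.ω * q.2.2.2.2.2)
    + q.2.1 * ((q.2.2.2.1 * p.ω - q.2.2.1 * q.2.2.2.2.1) * q.2.2.2.2.2))) (by fun_prop) 1
  obtain ⟨M4, hM4, hb4⟩ := hbd (fun q => -p.ω * (q.2.2.2.2.1 + q.2.1 * q.2.2.2.2.2))
    (by fun_prop) 1
  -- `e` is `ω²` times the coefficient `rateCub`.
  let e : ℝ × ℝ × ℝ × ℝ × ℝ × ℝ → ℝ := fun q => q.2.2.2.1 * p.ω - q.2.2.1 * q.2.2.2.2.1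
  have he : Continuous e := by fun_prop
  obtain ⟨M5, hM5, hb5⟩ := hbd (fun q =>
    p.ω ^ 2 * (q.2.2.2.1 * q.2.2.2.2.1 - q.2.2.1 * q.2.2.2.2.2)
    - (q.2.2.1 * p.ω * (q.2.2.2.2.1 ^ 2 + 2 * p.ω * q.2.2.2.2.2) + 4 * e q * p.ω * q.2.2.2.2.1)
    - q.2.1 * (2 * q.2.2.1 * p.ω * q.2.2.2.2.1 * q.2.2.2.2.2
      + 2 * e q * (q.2.2.2.2.1 ^ 2 + 2 * p.ω * q.2.2.2.2.2))
    - q.2.1 ^ 2 * (q.2.2.1 * p.ω * q.2.2.2.2.2 ^ 2 + 4 * e q * q.2.2.2.2.1 * q.2.2.2.2.2)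
    - q.2.1 ^ 3 * (2 * e q * q.2.2.2.2.2 ^ 2)) (by fun_prop) 2
  obtain ⟨M6, hM6, hb6⟩ := hbd (fun q => -p.ω ^ 2 * (q.2.2.2.2.1 + 2 * q.2.1 * q.2.2.2.2.2))
    (by fun_prop) 2
  set M := 1 + B + B / |p.ω| + B5 + M1 + M2 + M3 + M4 + M5 + M6 with hM
  have hBω : 0 < B / |p.ω| := by positivity
  have hMpos : 0 < M := by positivity
  -- The second bound makes the growth over one turn small: trajectories at most double, and the
  -- exponents in the linearised flow stay below `1`.
  refine ⟨min ρ₀ (1 / (64 * Real.pi * M)), M, ?_⟩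
  have hle : min ρ₀ (1 / (64 * Real.pi * M)) ≤ ρ₀ := min_le_left _ _
  have hmem : ∀ φ μ s, |μ| ≤ min ρ₀ (1 / (64 * Real.pi * M)) →
      |s| ≤ min ρ₀ (1 / (64 * Real.pi * M)) →
      (μ, s, radialQuad p φ, radialCub p φ, angularQuad p φ, angularCub p φ) ∈ paramBox ρ₀ B :=
    fun φ μ s hμ hs => mem_paramBox ((hμ.trans hle).trans hρ₀1) (hs.trans hle) (h1 φ) (h2 φ)
      (h3 φ) (h4 φ)
  refine ⟨hω, lt_min hρ₀pos (by have := Real.pi_pos; positivity), hle.trans hρ₀1, by linarith, ?_,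
    fun φ => (h1 φ).trans (by linarith), fun φ => (h2 φ).trans (by linarith), fun φ => ?_,
    fun φ => (h5 φ).trans (by linarith),
    fun φ s hs => hden s _ _ (hs.trans hle) (h3 φ) (h4 φ), ?_, ?_, ?_, ?_⟩
  · have hpos : 0 < 64 * Real.pi * M := by have := Real.pi_pos; positivity
    have := min_le_right ρ₀ (1 / (64 * Real.pi * M))
    rw [le_div_iff₀ hpos] at this
    linarith
  · rw [abs_div]
    refine (div_le_div_of_nonneg_right (h1 φ) hω'.le).trans (by linarith)
  · intro φ μ μ' s s' hμ hμ' hs hs'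
    refine (hb1 _ _ _ _ _ _ _ _ (hmem φ μ s hμ hs) (hmem φ μ' s' hμ' hs')).trans ?_
    exact mul_le_mul_of_nonneg_right (by linarith) (by positivity)
  · intro φ μ μ' s s' hμ hμ' hs hs'
    refine (hb2 _ _ _ _ _ _ _ _ (hmem φ μ s hμ hs) (hmem φ μ' s' hμ' hs')).trans ?_
    exact mul_le_mul_of_nonneg_right (by linarith) (by positivity)
  · intro φ μ s hμ hs
    have hm := hmem φ μ s hμ hs
    have hd := hden0 _ hm
    have e3 := hb3 _ hm
    have e4 := hb4 _ hm
    simp only [pow_one] at e3 e4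
    have hkey : rate p μ φ s - (μ / p.ω + s * (radialQuad p φ / p.ω) + s ^ 2 * rateCub p φ)
      = s ^ 3 * (-(((radialCub p φ * p.ω - radialQuad p φ * angularQuad p φ) * angularQuad p φ
          + radialQuad p φ * p.ω * angularCub p φ)
          + s * ((radialCub p φ * p.ω - radialQuad p φ * angularQuad p φ) * angularCub p φ))
          / (p.ω ^ 2 * (p.ω + s * angularQuad p φ + s ^ 2 * angularCub p φ)))
        + μ * s * (-p.ω * (angularQuad p φ + s * angularCub p φ)
          / (p.ω ^ 2 * (p.ω + s * angularQuad p φ + s ^ 2 * angularCub p φ))) := by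
      simp only at hd
      simp only [rate, rateCub, angularPoly]
      field_simp
      ring
    rw [hkey]
    refine (abs_add_le _ _).trans ?_
    rw [abs_mul, abs_mul (μ * s), abs_mul μ, abs_pow]
    have g1 : |s| ^ 3 * _ ≤ |s| ^ 3 * M3 := mul_le_mul_of_nonneg_left e3 (by positivity)
    have g2 : |μ| * |s| * _ ≤ |μ| * |s| * M4 := mul_le_mul_of_nonneg_left e4 (by positivity)
    have g3 : |s| ^ 3 * M3 ≤ |s| ^ 3 * M := mul_le_mul_of_nonneg_left (by linarith) (by positivity)
    have g4 : |μ| * |s| * M4 ≤ |μ| * |s| * M :=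
      mul_le_mul_of_nonneg_left (by linarith) (by positivity)
    linarith
  · intro φ μ s hμ hs
    have hm := hmem φ μ s hμ hs
    have hd := hden0 _ hm
    have e3 := hb5 _ hm
    have e4 := hb6 _ hm
    simp only [e] at e3 e4
    have hkey : rateDeriv p μ φ s - (radialQuad p φ / p.ω + 2 * s * rateCub p φ)
      = s ^ 2 * ((p.ω ^ 2 * (radialCub p φ * angularQuad p φ - radialQuad p φ * angularCub p φ)
        - (radialQuad p φ * p.ω * (angularQuad p φ ^ 2 + 2 * p.ω * angularCub p φ)
          + 4 * (radialCub p φ * p.ω - radialQuad p φ * angularQuad p φ) * p.ω * angularQuad p φ)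
        - s * (2 * radialQuad p φ * p.ω * angularQuad p φ * angularCub p φ
          + 2 * (radialCub p φ * p.ω - radialQuad p φ * angularQuad p φ)
            * (angularQuad p φ ^ 2 + 2 * p.ω * angularCub p φ))
        - s ^ 2 * (radialQuad p φ * p.ω * angularCub p φ ^ 2
          + 4 * (radialCub p φ * p.ω - radialQuad p φ * angularQuad p φ) * angularQuad p φ
            * angularCub p φ)
        - s ^ 3 * (2 * (radialCub p φ * p.ω - radialQuad p φ * angularQuad p φ)
            * angularCub p φ ^ 2))
          / (p.ω ^ 2 * (p.ω + s * angularQuad p φ + s ^ 2 * angularCub p φ) ^ 2))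
        + μ * (-p.ω ^ 2 * (angularQuad p φ + 2 * s * angularCub p φ)
          / (p.ω ^ 2 * (p.ω + s * angularQuad p φ + s ^ 2 * angularCub p φ) ^ 2)) := by
      simp only at hd
      simp only [rateDeriv, rateCub, angularPoly]
      field_simp
      ring
    rw [hkey]
    refine (abs_add_le _ _).trans ?_
    rw [abs_mul, abs_mul μ, abs_of_nonneg (sq_nonneg s)]
    have g1 : s ^ 2 * _ ≤ s ^ 2 * M5 := mul_le_mul_of_nonneg_left e3 (by positivity)
    have g2 : |μ| * _ ≤ |μ| * M6 := mul_le_mul_of_nonneg_left e4 (by positivity)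
    have g3 : s ^ 2 * M5 ≤ s ^ 2 * M := mul_le_mul_of_nonneg_left (by linarith) (by positivity)
    have g4 : |μ| * M6 ≤ |μ| * M := mul_le_mul_of_nonneg_left (by linarith) (by positivity)
    linarith

end Rate

/-! ### Retraction onto an interval -/

section Clamp

/-- The retraction of `ℝ` onto `[-ρ, ρ]`. -/
def clamp (ρ s : ℝ) : ℝ := max (-ρ) (min s ρ)

theorem abs_clamp_le {ρ : ℝ} (hρ : 0 ≤ ρ) (s : ℝ) : |clamp ρ s| ≤ ρ := by
  unfold clamp; rw [abs_le]; exact ⟨le_max_left _ _, max_le (by linarith) (min_le_right _ _)⟩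

theorem clamp_of_abs_le {ρ s : ℝ} (h : |s| ≤ ρ) : clamp ρ s = s := by
  rw [abs_le] at h
  rw [clamp, min_eq_left h.2, max_eq_right h.1]

theorem continuous_clamp (ρ : ℝ) : Continuous (clamp ρ) := by
  unfold clamp; fun_prop

theorem abs_clamp_sub_le (ρ s s' : ℝ) : |clamp ρ s - clamp ρ s'| ≤ |s - s'| := by
  unfold clamp
  refine (abs_max_sub_max_le_max _ _ _ _).trans ?_
  simp only [sub_self, abs_zero]
  refine max_le (abs_nonneg _) ((abs_min_sub_min_le_max _ _ _ _).trans ?_)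
  simp

theorem abs_clamp_le_abs {ρ : ℝ} (hρ : 0 ≤ ρ) (s : ℝ) : |clamp ρ s| ≤ |s| := by
  have := abs_clamp_sub_le ρ s 0
  rwa [clamp_of_abs_le (s := 0) (by simpa using hρ), sub_zero, sub_zero] at this

end Clamp

/-! ### Differentiability and Taylor estimates of the radial field -/

section Rate
variable {p : Coeffs} {ρ M : ℝ}

theorem periodic_angularPoly (p : Coeffs) (φ s : ℝ) :
    angularPoly p (φ + 2 * Real.pi) s = angularPoly p φ s := by
  simp only [angularPoly, periodic_angularQuad p φ, periodic_angularCub p φ]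

theorem rate_add_two_pi (p : Coeffs) (μ φ s : ℝ) :
    rate p μ (φ + 2 * Real.pi) s = rate p μ φ s := by
  simp only [rate, periodic_angularPoly, periodic_radialQuad p φ, periodic_radialCub p φ]

theorem rateDeriv_add_two_pi (p : Coeffs) (μ φ s : ℝ) :
    rateDeriv p μ (φ + 2 * Real.pi) s = rateDeriv p μ φ s := by
  simp only [rateDeriv, periodic_angularPoly, periodic_radialQuad p φ, periodic_radialCub p φ,
    periodic_angularQuad p φ, periodic_angularCub p φ]

theorem rate_zero_right (p : Coeffs) (μ φ : ℝ) : rate p μ φ 0 = μ / p.ω := by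
  simp [rate, angularPoly]

/-- The angular velocity differs from `ω` by at most `|ω| / 2`. Hence it has the sign of `ω` and is
bounded away from zero. -/
theorem RateBounds.le_mul_angularPoly (H : RateBounds p ρ M) {s : ℝ} (hs : |s| ≤ ρ) (φ : ℝ) :
    p.ω ^ 2 / 2 ≤ p.ω * angularPoly p φ s := by
  have h := H.angular φ s hs
  have h1 : |p.ω * (angularPoly p φ s - p.ω)| ≤ p.ω ^ 2 / 2 := by
    rw [abs_mul, ← sq_abs p.ω]
    nlinarith [abs_nonneg p.ω]
  have := (abs_le.1 h1).1
  nlinarith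

theorem RateBounds.angularPoly_ne (H : RateBounds p ρ M) {s : ℝ} (hs : |s| ≤ ρ) (φ : ℝ) :
    angularPoly p φ s ≠ 0 := by
  intro h
  have := H.le_mul_angularPoly hs φ
  rw [h, mul_zero] at this
  have h2 := sq_pos_of_ne_zero H.ne
  linarith

theorem RateBounds.hasDerivAt_rate (H : RateBounds p ρ M) {s : ℝ} (hs : |s| ≤ ρ) (μ φ : ℝ) :
    HasDerivAt (rate p μ φ) (rateDeriv p μ φ s) s := by
  have hi := hasDerivAt_id' s
  have hn : HasDerivAt (fun s => μ + s * radialQuad p φ + s ^ 2 * radialCub p φ)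
      (radialQuad p φ + 2 * s * radialCub p φ) s := by
    refine (((hi.mul_const _).const_add μ).add ((hi.pow 2).mul_const _)).congr_deriv ?_
    push_cast; ring
  have hd : HasDerivAt (fun s => angularPoly p φ s)
      (angularQuad p φ + 2 * s * angularCub p φ) s := by
    refine (((hi.mul_const _).const_add p.ω).add ((hi.pow 2).mul_const _)).congr_deriv ?_
    push_cast; ring
  exact hn.div hd (H.angularPoly_ne hs φ)

theorem RateBounds.abs_rate_le (H : RateBounds p ρ M) {μ s : ℝ} (hμ : |μ| ≤ ρ) (hs : |s| ≤ ρ)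
    (φ : ℝ) : |rate p μ φ s| ≤ M * (|μ| + |s|) := by
  have h0 : |(0 : ℝ)| ≤ ρ := by simpa using H.ρ_pos.le
  have := H.rate_lip φ μ 0 s 0 hμ h0 hs h0
  rwa [rate_zero_right, zero_div, sub_zero, sub_zero, sub_zero] at this

theorem RateBounds.abs_rateDeriv_le (H : RateBounds p ρ M) {μ s : ℝ} (hμ : |μ| ≤ ρ)
    (hs : |s| ≤ ρ) (φ : ℝ) : |rateDeriv p μ φ s| ≤ 5 * M := by
  have h1 := H.rateDeriv_expand φ μ s hμ hs
  have h2 := H.bound_div φ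
  have h3 := H.bound_rateCub φ
  have hM := H.one_le
  have hρ := H.ρ_le
  have hs1 : |s| ≤ 1 := hs.trans hρ
  have h4 : |2 * s * rateCub p φ| ≤ 2 * M := by
    rw [abs_mul, abs_mul, abs_two]
    nlinarith [abs_nonneg s, abs_nonneg (rateCub p φ)]
  have h5 : M * (s ^ 2 + |μ|) ≤ 2 * M := by
    have : s ^ 2 ≤ 1 := by rw [← sq_abs]; nlinarith [abs_nonneg s]
    nlinarith [hμ.trans hρ]
  have h6 : rateDeriv p μ φ s = (rateDeriv p μ φ s - (radialQuad p φ / p.ω + 2 * s * rateCub p φ))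
    + (radialQuad p φ / p.ω + 2 * s * rateCub p φ) := by ring
  rw [h6]
  refine (abs_add_le _ _).trans ?_
  have := abs_add_le (radialQuad p φ / p.ω) (2 * s * rateCub p φ)
  linarith

/-- The `s`-derivative of `dr/dφ = s ⬝ rate`. -/
def speedDeriv (p : Coeffs) (μ φ s : ℝ) : ℝ := rate p μ φ s + s * rateDeriv p μ φ s

theorem RateBounds.hasDerivAt_speed (H : RateBounds p ρ M) {s : ℝ} (hs : |s| ≤ ρ) (μ φ : ℝ) :
    HasDerivAt (fun s => s * rate p μ φ s) (speedDeriv p μ φ s) s := by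
  exact ((hasDerivAt_id' s).mul (H.hasDerivAt_rate hs μ φ)).congr_deriv (by rw [one_mul]; rfl)

theorem RateBounds.speedDeriv_lip (H : RateBounds p ρ M) {μ s s' : ℝ} (hμ : |μ| ≤ ρ)
    (hs : |s| ≤ ρ) (hs' : |s'| ≤ ρ) (φ : ℝ) :
    |speedDeriv p μ φ s - speedDeriv p μ φ s'| ≤ 7 * M * |s - s'| := by
  have h1 := H.rate_lip φ μ μ s s' hμ hμ hs hs'
  have h2 := H.rateDeriv_lip φ μ μ s s' hμ hμ hs hs'
  have h3 := H.abs_rateDeriv_le hμ hs' φ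
  simp only [sub_self, abs_zero, zero_add] at h1 h2
  have hM := H.one_le
  have h4 : speedDeriv p μ φ s - speedDeriv p μ φ s' = (rate p μ φ s - rate p μ φ s')
    + s * (rateDeriv p μ φ s - rateDeriv p μ φ s') + (s - s') * rateDeriv p μ φ s' := by
    simp only [speedDeriv]; ring
  rw [h4]
  refine (abs_add_le _ _).trans ?_
  have h5 := abs_add_le (rate p μ φ s - rate p μ φ s')
    (s * (rateDeriv p μ φ s - rateDeriv p μ φ s'))
  rw [abs_mul] at h5
  rw [abs_mul (s - s')]
  have h6 : |s| * |rateDeriv p μ φ s - rateDeriv p μ φ s'| ≤ 1 * (M * |s - s'|) :=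
    mul_le_mul (hs.trans H.ρ_le) h2 (abs_nonneg _) zero_le_one
  have h7 : |s - s'| * |rateDeriv p μ φ s'| ≤ |s - s'| * (5 * M) :=
    mul_le_mul_of_nonneg_left h3 (abs_nonneg _)
  linarith

theorem RateBounds.abs_speedDeriv_le (H : RateBounds p ρ M) {μ s : ℝ} (hμ : |μ| ≤ ρ)
    (hs : |s| ≤ ρ) (φ : ℝ) : |speedDeriv p μ φ s| ≤ 7 * M * (|μ| + |s|) := by
  have h1 := H.abs_rate_le hμ hs φ
  have h2 := H.abs_rateDeriv_le hμ hs φ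
  unfold speedDeriv
  refine (abs_add_le _ _).trans ?_
  rw [abs_mul]
  have h3 : |s| * |rateDeriv p μ φ s| ≤ |s| * (5 * M) :=
    mul_le_mul_of_nonneg_left h2 (abs_nonneg _)
  have hM := H.one_le
  nlinarith [abs_nonneg μ, abs_nonneg s]

/-- First order Taylor estimate of `dr/dφ` in the radius. -/
theorem RateBounds.speed_taylor (H : RateBounds p ρ M) {μ x y : ℝ} (hμ : |μ| ≤ ρ)
    (hx : |x| ≤ ρ) (hy : |y| ≤ ρ) (φ : ℝ) :
    |x * rate p μ φ x - y * rate p μ φ y - speedDeriv p μ φ y * (x - y)|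
      ≤ 7 * M * |x - y| * |x - y| := by
  have hseg : ∀ s ∈ uIcc y x, |s| ≤ ρ ∧ |s - y| ≤ |x - y| := by
    intro s hs
    refine ⟨?_, abs_sub_left_of_mem_uIcc hs⟩
    rw [abs_le] at hx hy ⊢
    rcases mem_uIcc.1 hs with h | h <;> constructor <;> linarith [h.1, h.2]
  have := (convex_uIcc y x).norm_image_sub_le_of_norm_hasDerivWithin_le
    (f := fun s => s * rate p μ φ s - speedDeriv p μ φ y * s)
    (f' := fun s => speedDeriv p μ φ s - speedDeriv p μ φ y) (C := 7 * M * |x - y|)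
    (fun s hs => ?_) (fun s hs => ?_) left_mem_uIcc right_mem_uIcc
  · simp only [Real.norm_eq_abs] at this
    convert this using 2
    ring
  · have := (H.hasDerivAt_speed (hseg s hs).1 μ φ).sub
      ((hasDerivAt_id' s).const_mul (speedDeriv p μ φ y))
    rw [mul_one] at this
    exact this.hasDerivWithinAt
  · refine (H.speedDeriv_lip hμ (hseg s hs).1 hy φ).trans ?_
    have hM := H.one_le
    exact mul_le_mul_of_nonneg_left (hseg s hs).2 (by linarith)

theorem RateBounds.continuous_rate_comp₃ (H : RateBounds p ρ M) {T : Type*} [TopologicalSpace T]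
    {m φ x : T → ℝ} (hm : Continuous m) (hφ : Continuous φ) (hx : Continuous x)
    (hxρ : ∀ t, |x t| ≤ ρ) : Continuous fun t => rate p (m t) (φ t) (x t) := by
  have h1 := (continuous_radialQuad p).comp hφ
  have h2 := (continuous_radialCub p).comp hφ
  have h3 := (continuous_angularQuad p).comp hφ
  have h4 := (continuous_angularCub p).comp hφ
  refine Continuous.div ?_ ?_ fun t => H.angularPoly_ne (hxρ t) (φ t)
  · exact (hm.add (hx.mul h1)).add ((hx.pow 2).mul h2)
  · exact (continuous_const.add (hx.mul h3)).add ((hx.pow 2).mul h4)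

theorem RateBounds.continuous_rateDeriv_comp₃ (H : RateBounds p ρ M) {T : Type*}
    [TopologicalSpace T] {m φ x : T → ℝ} (hm : Continuous m) (hφ : Continuous φ)
    (hx : Continuous x) (hxρ : ∀ t, |x t| ≤ ρ) :
    Continuous fun t => rateDeriv p (m t) (φ t) (x t) := by
  have h1 := (continuous_radialQuad p).comp hφ
  have h2 := (continuous_radialCub p).comp hφ
  have h3 := (continuous_angularQuad p).comp hφ
  have h4 := (continuous_angularCub p).comp hφ
  have hd : Continuous fun t => angularPoly p (φ t) (x t) :=
    (continuous_const.add (hx.mul h3)).add ((hx.pow 2).mul h4)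
  refine Continuous.div ?_ (hd.pow 2) fun t => pow_ne_zero 2 (H.angularPoly_ne (hxρ t) (φ t))
  exact ((h1.add ((continuous_const.mul hx).mul h2)).mul hd).sub
    (((hm.add (hx.mul h1)).add ((hx.pow 2).mul h2)).mul (h3.add ((continuous_const.mul hx).mul h4)))

theorem RateBounds.continuous_rate_comp (H : RateBounds p ρ M) (μ : ℝ) {x : ℝ → ℝ}
    (hx : Continuous x) (hxρ : ∀ φ, |x φ| ≤ ρ) : Continuous fun φ => rate p μ φ (x φ) :=
  H.continuous_rate_comp₃ continuous_const continuous_id hx hxρ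

theorem RateBounds.continuous_rateDeriv_comp (H : RateBounds p ρ M) (μ : ℝ) {x : ℝ → ℝ}
    (hx : Continuous x) (hxρ : ∀ φ, |x φ| ≤ ρ) :
    Continuous fun φ => rateDeriv p μ φ (x φ) :=
  H.continuous_rateDeriv_comp₃ continuous_const continuous_id hx hxρ

theorem RateBounds.continuous_speedDeriv_comp (H : RateBounds p ρ M) (μ : ℝ) {x : ℝ → ℝ}
    (hx : Continuous x) (hxρ : ∀ φ, |x φ| ≤ ρ) :
    Continuous fun φ => speedDeriv p μ φ (x φ) :=
  (H.continuous_rate_comp μ hx hxρ).add (hx.mul (H.continuous_rateDeriv_comp μ hx hxρ))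

end Rate

/-! ### Flow of the truncated radial equation and its dependence on the initial radius -/

section Flow
variable {p : Coeffs} {ρ M : ℝ}

/-- The radial vector field `dr/dφ`, truncated at `|r| = ρ`. -/
def truncSpeed (p : Coeffs) (ρ μ φ s : ℝ) : ℝ := clamp ρ s * rate p μ φ (clamp ρ s)

theorem RateBounds.pi_mul_le (H : RateBounds p ρ M) : 8 * Real.pi * M * ρ ≤ 1 := by
  have h1 := H.small
  have h2 : 0 < Real.pi * M * ρ := by
    have := H.one_le; have := H.ρ_pos; positivity
  linarith

theorem RateBounds.mul_le (H : RateBounds p ρ M) : 8 * M * ρ ≤ 1 := by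
  have h1 := H.pi_mul_le
  have h2 : 0 < 8 * M * ρ := by have := H.one_le; have := H.ρ_pos; positivity
  nlinarith [Real.pi_gt_three]

/-- The product rule gives a constant of at most `3 M ρ`, and `8 M ρ ≤ 1`. The round value `1` is
enough for existence, uniqueness and Gronwall estimates. -/
theorem RateBounds.truncSpeed_lip (H : RateBounds p ρ M) {μ μ' : ℝ} (hμ : |μ| ≤ ρ)
    (hμ' : |μ'| ≤ ρ) (φ s s' : ℝ) :
    |truncSpeed p ρ μ φ s - truncSpeed p ρ μ' φ s'| ≤ |μ - μ'| + |s - s'| := by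
  have hρ := H.ρ_pos
  have hM := H.one_le
  have hc := abs_clamp_le hρ.le s
  have hc' := abs_clamp_le hρ.le s'
  have h1 := H.rate_lip φ μ μ' _ _ hμ hμ' hc hc'
  have h2 := H.abs_rate_le hμ' hc' φ
  have h3 := abs_clamp_sub_le ρ s s'
  have h4 : truncSpeed p ρ μ φ s - truncSpeed p ρ μ' φ s' =
    clamp ρ s * (rate p μ φ (clamp ρ s) - rate p μ' φ (clamp ρ s'))
    + (clamp ρ s - clamp ρ s') * rate p μ' φ (clamp ρ s') := by
    simp only [truncSpeed]; ring
  rw [h4]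
  refine (abs_add_le _ _).trans ?_
  rw [abs_mul, abs_mul]
  have h5 : |clamp ρ s| * |rate p μ φ (clamp ρ s) - rate p μ' φ (clamp ρ s')|
    ≤ ρ * (M * (|μ - μ'| + |s - s'|)) := by
    refine mul_le_mul hc (h1.trans ?_) (abs_nonneg _) hρ.le
    exact mul_le_mul_of_nonneg_left (by linarith) (by linarith)
  have h6 : |clamp ρ s - clamp ρ s'| * |rate p μ' φ (clamp ρ s')| ≤ |s - s'| * (M * (ρ + ρ)) := by
    refine mul_le_mul h3 (h2.trans ?_) (abs_nonneg _) (abs_nonneg _)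
    exact mul_le_mul_of_nonneg_left (by linarith) (by linarith)
  have h7 := H.mul_le
  have h8 := abs_nonneg (μ - μ')
  have h9 := abs_nonneg (s - s')
  have hMρ : M * ρ ≤ 1 / 8 := by linarith
  nlinarith

theorem RateBounds.lipschitzWith_truncSpeed (H : RateBounds p ρ M) {μ : ℝ} (hμ : |μ| ≤ ρ)
    (φ : ℝ) : LipschitzWith 1 (truncSpeed p ρ μ φ) := by
  refine LipschitzWith.of_dist_le_mul fun s s' => ?_
  simpa [Real.dist_eq] using H.truncSpeed_lip hμ hμ φ s s'

theorem RateBounds.abs_truncSpeed_le (H : RateBounds p ρ M) {μ : ℝ} (hμ : |μ| ≤ ρ)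
    (φ s : ℝ) : |truncSpeed p ρ μ φ s| ≤ 2 * M * ρ * |s| := by
  have hc := abs_clamp_le H.ρ_pos.le s
  have hM := H.one_le
  rw [truncSpeed, abs_mul, mul_comm]
  refine mul_le_mul ((H.abs_rate_le hμ hc φ).trans ?_) (abs_clamp_le_abs H.ρ_pos.le s)
    (abs_nonneg _) (by have := H.ρ_pos; positivity)
  nlinarith

theorem RateBounds.continuous_truncSpeed (H : RateBounds p ρ M) (μ s : ℝ) :
    Continuous fun φ => truncSpeed p ρ μ φ s :=
  continuous_const.mul (H.continuous_rate_comp μ (x := fun _ => clamp ρ s) continuous_const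
    fun _ => abs_clamp_le H.ρ_pos.le s)

/-- The solution of the truncated radial equation with value `r` at `φ = 0`. -/
def flow (p : Coeffs) (ρ μ r : ℝ) : ℝ → ℝ :=
  Classical.epsilon fun x : ℝ → ℝ => x 0 = r ∧ ∀ φ, HasDerivAt x (truncSpeed p ρ μ φ (x φ)) φ

theorem RateBounds.flow_spec (H : RateBounds p ρ M) {μ : ℝ} (hμ : |μ| ≤ ρ) (r : ℝ) :
    flow p ρ μ r 0 = r ∧
      ∀ φ, HasDerivAt (flow p ρ μ r) (truncSpeed p ρ μ φ (flow p ρ μ r φ)) φ := by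
  refine Classical.epsilon_spec (p := fun x : ℝ → ℝ => x 0 = r ∧
    ∀ φ, HasDerivAt x (truncSpeed p ρ μ φ (x φ)) φ) ?_
  refine exists_global_solution (K := 1) (L := 1) (fun φ => H.lipschitzWith_truncSpeed hμ φ)
    (fun s => H.continuous_truncSpeed μ s) (fun φ s => ?_) r
  have hc := abs_clamp_le H.ρ_pos.le s
  have hρ := H.ρ_pos
  have hM := H.one_le
  rw [truncSpeed, Real.norm_eq_abs, abs_mul]
  have h1 : |rate p μ φ (clamp ρ s)| ≤ M * (ρ + ρ) :=
    (H.abs_rate_le hμ hc φ).trans (mul_le_mul_of_nonneg_left (by linarith) (by linarith))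
  have h2 := H.mul_le
  have h3 := H.ρ_le
  refine (mul_le_mul hc h1 (abs_nonneg _) hρ.le).trans ?_
  simp only [NNReal.coe_one]
  nlinarith

theorem RateBounds.flow_zero (H : RateBounds p ρ M) {μ : ℝ} (hμ : |μ| ≤ ρ) (r : ℝ) :
    flow p ρ μ r 0 = r := (H.flow_spec hμ r).1

theorem RateBounds.hasDerivAt_flow (H : RateBounds p ρ M) {μ : ℝ} (hμ : |μ| ≤ ρ) (r φ : ℝ) :
    HasDerivAt (flow p ρ μ r) (truncSpeed p ρ μ φ (flow p ρ μ r φ)) φ := (H.flow_spec hμ r).2 φ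

theorem RateBounds.continuous_flow (H : RateBounds p ρ M) {μ : ℝ} (hμ : |μ| ≤ ρ) (r : ℝ) :
    Continuous (flow p ρ μ r) :=
  continuous_iff_continuousAt.2 fun φ => (H.hasDerivAt_flow hμ r φ).continuousAt

theorem RateBounds.solution_unique (H : RateBounds p ρ M) {μ : ℝ} (hμ : |μ| ≤ ρ) {x y : ℝ → ℝ}
    (hx : ∀ φ, HasDerivAt x (truncSpeed p ρ μ φ (x φ)) φ)
    (hy : ∀ φ, HasDerivAt y (truncSpeed p ρ μ φ (y φ)) φ) {φ₀ : ℝ} (h : x φ₀ = y φ₀) : x = y :=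
  global_solution_unique (fun φ => H.lipschitzWith_truncSpeed hμ φ) hx hy h

theorem RateBounds.flow_of_zero (H : RateBounds p ρ M) {μ : ℝ} (hμ : |μ| ≤ ρ) (φ : ℝ) :
    flow p ρ μ 0 φ = 0 := by
  have : flow p ρ μ 0 = fun _ => 0 := by
    refine H.solution_unique hμ (H.hasDerivAt_flow hμ 0) (fun φ => ?_) (φ₀ := 0)
      (H.flow_zero hμ 0)
    have : truncSpeed p ρ μ φ 0 = 0 := by
      rw [truncSpeed, clamp_of_abs_le (by simpa using H.ρ_pos.le), zero_mul]
    rw [this]; exact hasDerivAt_const _ _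
  rw [this]

theorem truncSpeed_add_two_pi (p : Coeffs) (ρ μ φ s : ℝ) :
    truncSpeed p ρ μ (φ + 2 * Real.pi) s = truncSpeed p ρ μ φ s := by
  simp only [truncSpeed, rate_add_two_pi]

/-- A trajectory that closes up after one turn is periodic. -/
theorem RateBounds.flow_periodic (H : RateBounds p ρ M) {μ : ℝ} (hμ : |μ| ≤ ρ) {r : ℝ}
    (h : flow p ρ μ r (2 * Real.pi) = r) : Function.Periodic (flow p ρ μ r) (2 * Real.pi) := by
  have : (fun φ => flow p ρ μ r (φ + 2 * Real.pi)) = flow p ρ μ r := by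
    refine H.solution_unique hμ (fun φ => ?_) (H.hasDerivAt_flow hμ r) (φ₀ := 0) ?_
    · have := (H.hasDerivAt_flow hμ r (φ + 2 * Real.pi)).comp_add_const φ (2 * Real.pi)
      rwa [truncSpeed_add_two_pi] at this
    · simp only [zero_add, h, H.flow_zero hμ]
  exact fun φ => congrFun this φ

theorem exp_half_le_two : Real.exp (1 / 2) ≤ 2 := by
  have h := Real.exp_one_lt_d9
  have h2 : Real.exp (1 / 2) * Real.exp (1 / 2) = Real.exp 1 := by
    rw [← Real.exp_add]; norm_num
  nlinarith [Real.exp_pos (1 / 2)]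

/-- Gronwall with rate `2 M ρ` over one turn gives an exponent of at most `1/2`, and `exp (1/2) ≤
2`. Hence for `|r| ≤ ρ / 2` the truncation is inactive during the first turn. -/
theorem RateBounds.abs_flow_le (H : RateBounds p ρ M) {μ : ℝ} (hμ : |μ| ≤ ρ) (r : ℝ) {φ : ℝ}
    (hφ : φ ∈ Icc 0 (2 * Real.pi)) : |flow p ρ μ r φ| ≤ 2 * |r| := by
  have := norm_le_gronwallBound_of_norm_deriv_right_le (f := flow p ρ μ r) (δ := |r|)
    (K := 2 * M * ρ) (ε := 0) (a := 0) (b := 2 * Real.pi)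
    (H.continuous_flow hμ r).continuousOn
    (fun φ _ => (H.hasDerivAt_flow hμ r φ).hasDerivWithinAt)
    (by rw [H.flow_zero hμ]; rfl)
    (fun φ _ => by rw [add_zero]; exact H.abs_truncSpeed_le hμ φ _) φ hφ
  rw [gronwallBound_ε0, sub_zero, Real.norm_eq_abs] at this
  refine this.trans ?_
  have hM := H.one_le
  have hρ := H.ρ_pos
  have h1 : 2 * M * ρ * φ ≤ 1 / 2 := by
    have : 2 * M * ρ * φ ≤ 2 * M * ρ * (2 * Real.pi) :=
      mul_le_mul_of_nonneg_left hφ.2 (by positivity)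
    have := H.pi_mul_le
    linarith
  have := (Real.exp_le_exp.2 h1).trans exp_half_le_two
  nlinarith [abs_nonneg r]

theorem RateBounds.abs_flow_le_rho (H : RateBounds p ρ M) {μ : ℝ} (hμ : |μ| ≤ ρ) {r : ℝ}
    (hr : |r| ≤ ρ / 2) {φ : ℝ} (hφ : φ ∈ Icc 0 (2 * Real.pi)) : |flow p ρ μ r φ| ≤ ρ :=
  (H.abs_flow_le hμ r hφ).trans (by linarith)

theorem RateBounds.clamp_flow (H : RateBounds p ρ M) {μ : ℝ} (hμ : |μ| ≤ ρ) {r : ℝ}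
    (hr : |r| ≤ ρ / 2) {φ : ℝ} (hφ : φ ∈ Icc 0 (2 * Real.pi)) :
    clamp ρ (flow p ρ μ r φ) = flow p ρ μ r φ :=
  clamp_of_abs_le (H.abs_flow_le_rho hμ hr hφ)

theorem RateBounds.abs_flow_sub_le (H : RateBounds p ρ M) {μ : ℝ} (hμ : |μ| ≤ ρ) {r : ℝ}
    (hr : |r| ≤ ρ / 2) {φ : ℝ} (hφ : φ ∈ Icc 0 (2 * Real.pi)) :
    |flow p ρ μ r φ - r| ≤ 8 * Real.pi * M * (|r| * (|μ| + |r|)) := by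
  have hM := H.one_le
  have := (convex_Icc (0 : ℝ) (2 * Real.pi)).norm_image_sub_le_of_norm_hasDerivWithin_le
    (f := flow p ρ μ r) (f' := fun φ => truncSpeed p ρ μ φ (flow p ρ μ r φ))
    (C := 4 * M * (|r| * (|μ| + |r|)))
    (fun φ _ => (H.hasDerivAt_flow hμ r φ).hasDerivWithinAt) (fun φ hφ => ?_)
    (x := 0) (y := φ) ⟨le_rfl, by positivity⟩ hφ
  · rw [H.flow_zero hμ, sub_zero, Real.norm_eq_abs, Real.norm_eq_abs, abs_of_nonneg hφ.1] at this
    refine this.trans ?_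
    have h0 : 0 ≤ 4 * M * (|r| * (|μ| + |r|)) := by positivity
    have := mul_le_mul_of_nonneg_left hφ.2 h0
    linarith
  · rw [truncSpeed, H.clamp_flow hμ hr hφ, Real.norm_eq_abs, abs_mul]
    have h1 := H.abs_flow_le hμ r hφ
    have h2 := H.abs_rate_le hμ (H.abs_flow_le_rho hμ hr hφ) φ
    have h3 : |rate p μ φ (flow p ρ μ r φ)| ≤ M * (2 * (|μ| + |r|)) := by
      refine h2.trans (mul_le_mul_of_nonneg_left ?_ (by linarith))
      linarith [abs_nonneg μ]
    refine (mul_le_mul h1 h3 (abs_nonneg _) (by positivity)).trans (le_of_eq ?_)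
    ring

theorem RateBounds.flow_lip (H : RateBounds p ρ M) {μ μ' : ℝ} (hμ : |μ| ≤ ρ) (hμ' : |μ'| ≤ ρ)
    (r r' : ℝ) {φ : ℝ} (hφ : φ ∈ Icc 0 (2 * Real.pi)) :
    |flow p ρ μ r φ - flow p ρ μ' r' φ| ≤ Real.exp (2 * Real.pi) * (|μ - μ'| + |r - r'|) := by
  have := dist_le_of_approx_trajectories_ODE (v := fun φ => truncSpeed p ρ μ φ) (K := 1)
    (f := flow p ρ μ r) (g := flow p ρ μ' r') (a := 0) (b := 2 * Real.pi)
    (f' := fun φ => truncSpeed p ρ μ φ (flow p ρ μ r φ))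
    (g' := fun φ => truncSpeed p ρ μ' φ (flow p ρ μ' r' φ)) (εf := 0) (εg := |μ - μ'|)
    (δ := |r - r'|)
    (fun φ => H.lipschitzWith_truncSpeed hμ φ) (H.continuous_flow hμ r).continuousOn
    (fun φ _ => (H.hasDerivAt_flow hμ r φ).hasDerivWithinAt) (fun φ _ => by simp)
    (H.continuous_flow hμ' r').continuousOn
    (fun φ _ => (H.hasDerivAt_flow hμ' r' φ).hasDerivWithinAt)
    (fun φ _ => by
      have := H.truncSpeed_lip hμ' hμ φ (flow p ρ μ' r' φ) (flow p ρ μ' r' φ)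
      rw [sub_self, abs_zero, add_zero, abs_sub_comm μ' μ] at this
      rwa [Real.dist_eq])
    (by rw [H.flow_zero hμ, H.flow_zero hμ', Real.dist_eq]) φ hφ
  rw [Real.dist_eq, gronwallBound_of_K_ne_0 (by simp)] at this
  refine this.trans ?_
  have h1 : Real.exp φ ≤ Real.exp (2 * Real.pi) := Real.exp_le_exp.2 hφ.2
  have h2 := abs_nonneg (r - r')
  have h3 := abs_nonneg (μ - μ')
  simp only [NNReal.coe_one, sub_zero, one_mul, zero_add, div_one]
  nlinarith [Real.exp_pos φ]

/-- The solution of a scalar linear equation. -/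
theorem eq_mul_exp_of_linear {y g : ℝ → ℝ} (hg : Continuous g) {T : ℝ}
    (hy : ∀ t ∈ Icc 0 T, HasDerivAt y (g t * y t) t) {t : ℝ} (ht : t ∈ Icc 0 T) :
    y t = y 0 * Real.exp (∫ s in (0 : ℝ)..t, g s) := by
  have hG : ∀ t, HasDerivAt (fun t => ∫ s in (0 : ℝ)..t, g s) (g t) t := fun t =>
    (hg.integral_hasStrictDerivAt 0 t).hasDerivAt
  have := eq_of_hasDerivWithinAt_zero (convex_Icc 0 T)
    (f := fun t => y t * Real.exp (-∫ s in (0 : ℝ)..t, g s)) (fun t ht => by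
      refine (((hy t ht).mul (hG t).neg.exp).congr_deriv ?_).hasDerivWithinAt
      ring) (s := 0) (t := t) ⟨le_rfl, ht.1.trans ht.2⟩ ht
  simp only [intervalIntegral.integral_same, neg_zero, Real.exp_zero, mul_one] at this
  rw [← this, mul_assoc, ← Real.exp_add, neg_add_cancel, Real.exp_zero, mul_one]

/-- The logarithm of the growth of the radius over one turn. -/
def logGrowth (p : Coeffs) (ρ μ r : ℝ) : ℝ :=
  ∫ φ in (0 : ℝ)..2 * Real.pi, rate p μ φ (clamp ρ (flow p ρ μ r φ))

theorem RateBounds.continuous_clamp_flow (H : RateBounds p ρ M) {μ : ℝ} (hμ : |μ| ≤ ρ) (r : ℝ) :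
    Continuous fun φ => clamp ρ (flow p ρ μ r φ) :=
  (continuous_clamp ρ).comp (H.continuous_flow hμ r)

/-- While the truncation is inactive, the trajectory solves the linear equation `x' = rate ⬝ x`,
with the rate evaluated along itself. -/
theorem RateBounds.flow_eq_exp (H : RateBounds p ρ M) {μ : ℝ} (hμ : |μ| ≤ ρ) {r : ℝ}
    (hr : |r| ≤ ρ / 2) {φ : ℝ} (hφ : φ ∈ Icc 0 (2 * Real.pi)) :
    flow p ρ μ r φ = r * Real.exp (∫ θ in (0 : ℝ)..φ, rate p μ θ (clamp ρ (flow p ρ μ r θ))) := by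
  have := eq_mul_exp_of_linear (y := flow p ρ μ r)
    (H.continuous_rate_comp μ (H.continuous_clamp_flow hμ r) fun φ => abs_clamp_le H.ρ_pos.le _)
    (T := 2 * Real.pi) (fun t ht => ?_) hφ
  · rwa [H.flow_zero hμ] at this
  · refine (H.hasDerivAt_flow hμ r t).congr_deriv ?_
    rw [truncSpeed, mul_comm]
    nth_rewrite 2 [H.clamp_flow hμ hr ht]
    rfl

theorem two_pi_mem : 2 * Real.pi ∈ Icc 0 (2 * Real.pi) := ⟨by positivity, le_rfl⟩

theorem RateBounds.flow_two_pi (H : RateBounds p ρ M) {μ : ℝ} (hμ : |μ| ≤ ρ) {r : ℝ}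
    (hr : |r| ≤ ρ / 2) : flow p ρ μ r (2 * Real.pi) = r * Real.exp (logGrowth p ρ μ r) :=
  H.flow_eq_exp hμ hr two_pi_mem

/-- The derivative of the flow with respect to the initial radius. -/
def flowDeriv (p : Coeffs) (ρ μ r φ : ℝ) : ℝ :=
  Real.exp (∫ θ in (0 : ℝ)..φ, speedDeriv p μ θ (clamp ρ (flow p ρ μ r θ)))

/-- In one dimension the difference of two trajectories solves a linear equation whose coefficient
is the difference quotient of the field. The quotient of the differences is thus the exponential of
an integral, and its exponent converges to that of the variational equation with error `O(|r' -
r|)`. -/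
theorem RateBounds.hasDerivAt_flow_initial (H : RateBounds p ρ M) {μ : ℝ} (hμ : |μ| ≤ ρ) {r : ℝ}
    (hr : |r| < ρ / 2) {φ : ℝ} (hφ : φ ∈ Icc 0 (2 * Real.pi)) :
    HasDerivAt (fun r => flow p ρ μ r φ) (flowDeriv p ρ μ r φ) r := by
  set X := flow p ρ μ r with hX
  have hM := H.one_le
  set Z : ℝ → ℝ := fun θ => speedDeriv p μ θ (clamp ρ (X θ)) with hZ
  have hZc : Continuous Z := H.continuous_speedDeriv_comp μ (H.continuous_clamp_flow hμ r)
    fun φ => abs_clamp_le H.ρ_pos.le _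
  have hkey : ∀ r', |r'| < ρ / 2 → r' ≠ r → ∃ I : ℝ,
      |I - ∫ θ in (0 : ℝ)..φ, Z θ|
        ≤ 7 * M * Real.exp (2 * Real.pi) * (2 * Real.pi) * |r' - r| ∧
      (flow p ρ μ r' φ - X φ) / (r' - r) = Real.exp I := by
    intro r' hr' hne
    set Y := flow p ρ μ r' with hY
    have hYX : ∀ θ, Y θ - X θ ≠ 0 := by
      intro θ h0
      have := H.solution_unique hμ (H.hasDerivAt_flow hμ r') (H.hasDerivAt_flow hμ r)
        (φ₀ := θ) (sub_eq_zero.1 h0)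
      have h1 := congrFun this 0
      rw [H.flow_zero hμ, H.flow_zero hμ] at h1
      exact hne h1
    -- Distinct trajectories never meet, so the difference quotient is defined and continuous at
    -- every angle.
    set g : ℝ → ℝ := fun θ => (truncSpeed p ρ μ θ (Y θ) - truncSpeed p ρ μ θ (X θ)) / (Y θ - X θ)
    have hcY : ∀ r, Continuous fun θ => truncSpeed p ρ μ θ (flow p ρ μ r θ) := fun r =>
      (H.continuous_clamp_flow hμ r).mul (H.continuous_rate_comp μ (H.continuous_clamp_flow hμ r)
        fun φ => abs_clamp_le H.ρ_pos.le _)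
    have hg : Continuous g := ((hcY r').sub (hcY r)).div
      ((H.continuous_flow hμ r').sub (H.continuous_flow hμ r)) hYX
    have hlin := eq_mul_exp_of_linear (y := fun θ => Y θ - X θ) hg (T := 2 * Real.pi)
      (fun t _ => by
        refine ((H.hasDerivAt_flow hμ r' t).sub (H.hasDerivAt_flow hμ r t)).congr_deriv ?_
        simp only [g]
        rw [div_mul_cancel₀ _ (hYX t)]) hφ
    refine ⟨∫ θ in (0 : ℝ)..φ, g θ, ?_, ?_⟩
    · rw [← intervalIntegral.integral_sub (hg.intervalIntegrable _ _)
        (hZc.intervalIntegrable _ _)]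
      have hb : ∀ θ ∈ uIoc 0 φ, ‖g θ - Z θ‖ ≤ 7 * M * Real.exp (2 * Real.pi) * |r' - r| := by
        intro θ hθ
        rw [uIoc_of_le hφ.1] at hθ
        have hθ' : θ ∈ Icc 0 (2 * Real.pi) := ⟨hθ.1.le, hθ.2.trans hφ.2⟩
        have h1 := H.speed_taylor hμ (H.abs_flow_le_rho hμ hr'.le hθ')
          (H.abs_flow_le_rho hμ hr.le hθ') θ
        have h2 : g θ - Z θ = (Y θ * rate p μ θ (Y θ) - X θ * rate p μ θ (X θ)
            - speedDeriv p μ θ (X θ) * (Y θ - X θ)) / (Y θ - X θ) := by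
          simp only [g, Z, truncSpeed, hX, hY, H.clamp_flow hμ hr'.le hθ',
            H.clamp_flow hμ hr.le hθ']
          have hd : flow p ρ μ r' θ - flow p ρ μ r θ ≠ 0 := hYX θ
          field_simp
        rw [h2, Real.norm_eq_abs, abs_div, div_le_iff₀ (abs_pos.2 (hYX θ))]
        refine h1.trans (mul_le_mul_of_nonneg_right ?_ (abs_nonneg _))
        have h3 := H.flow_lip hμ hμ r' r hθ'
        rw [sub_self, abs_zero, zero_add] at h3
        calc _ ≤ 7 * M * (Real.exp (2 * Real.pi) * |r' - r|) :=
              mul_le_mul_of_nonneg_left h3 (by linarith)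
          _ = _ := by ring
      have := intervalIntegral.norm_integral_le_of_norm_le_const hb
      rw [Real.norm_eq_abs, sub_zero, abs_of_nonneg hφ.1] at this
      refine this.trans ?_
      have h0 : 0 ≤ 7 * M * Real.exp (2 * Real.pi) * |r' - r| := by positivity
      have := mul_le_mul_of_nonneg_left hφ.2 h0
      linarith
    · rw [hlin, hY, hX, H.flow_zero hμ, H.flow_zero hμ, mul_div_cancel_left₀]
      exact sub_ne_zero.2 hne
  rw [hasDerivAt_iff_tendsto_slope]
  have hev : ∀ᶠ r' in 𝓝[≠] r, |r'| < ρ / 2 ∧ r' ≠ r :=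
    (((continuous_abs.tendsto r).eventually_lt_const hr).filter_mono nhdsWithin_le_nhds).and
      eventually_mem_nhdsWithin
  choose! I hI1 hI2 using fun r' (h : |r'| < ρ / 2 ∧ r' ≠ r) => hkey r' h.1 h.2
  have hIlim : Tendsto I (𝓝[≠] r) (𝓝 (∫ θ in (0 : ℝ)..φ, Z θ)) := by
    rw [tendsto_iff_norm_sub_tendsto_zero]
    have h0 : Tendsto (fun r' => 7 * M * Real.exp (2 * Real.pi) * (2 * Real.pi) * |r' - r|)
        (𝓝[≠] r) (𝓝 0) := by
      have : Continuous fun r' => 7 * M * Real.exp (2 * Real.pi) * (2 * Real.pi) * |r' - r| := by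
        fun_prop
      have h := this.tendsto r
      simp only [sub_self, abs_zero, mul_zero] at h
      exact h.mono_left nhdsWithin_le_nhds
    refine squeeze_zero' (Eventually.of_forall fun _ => norm_nonneg _) ?_ h0
    exact hev.mono fun r' h => hI1 r' h
  refine ((Real.continuous_exp.tendsto _).comp hIlim).congr' ?_
  filter_upwards [hev] with r' h
  rw [Function.comp_apply, ← hI2 r' h, slope_def_field]

end Flow

/-! ### The logarithmic growth over one turn -/

section LogGrowth
variable {p : Coeffs} {ρ M : ℝ}

theorem mem_of_mem_uIoc {φ : ℝ} (h : φ ∈ uIoc 0 (2 * Real.pi)) : φ ∈ Icc 0 (2 * Real.pi) := by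
  rw [uIoc_of_le (by positivity)] at h
  exact Ioc_subset_Icc_self h

theorem RateBounds.rate_flow_lip (H : RateBounds p ρ M) {μ μ' : ℝ} (hμ : |μ| ≤ ρ)
    (hμ' : |μ'| ≤ ρ) (r r' : ℝ) {φ : ℝ} (hφ : φ ∈ Icc 0 (2 * Real.pi)) :
    |rate p μ φ (clamp ρ (flow p ρ μ r φ)) - rate p μ' φ (clamp ρ (flow p ρ μ' r' φ))|
      ≤ 2 * M * Real.exp (2 * Real.pi) * (|μ - μ'| + |r - r'|) := by
  have hρ := H.ρ_pos.le
  have hM := H.one_le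
  refine (H.rate_lip φ μ μ' _ _ hμ hμ' (abs_clamp_le hρ _) (abs_clamp_le hρ _)).trans ?_
  have h1 := (abs_clamp_sub_le ρ _ _).trans (H.flow_lip hμ hμ' r r' hφ)
  have h2 : (1 : ℝ) ≤ Real.exp (2 * Real.pi) := Real.one_le_exp (by positivity)
  have h3 := abs_nonneg (μ - μ')
  have h4 := abs_nonneg (r - r')
  calc _ ≤ M * (|μ - μ'| + Real.exp (2 * Real.pi) * (|μ - μ'| + |r - r'|)) :=
        mul_le_mul_of_nonneg_left (by linarith) (by linarith)
    _ ≤ M * (2 * (Real.exp (2 * Real.pi) * (|μ - μ'| + |r - r'|))) :=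
        mul_le_mul_of_nonneg_left (by nlinarith) (by linarith)
    _ = _ := by ring

theorem RateBounds.continuous_flow_initial (H : RateBounds p ρ M) {μ : ℝ} (hμ : |μ| ≤ ρ) {φ : ℝ}
    (hφ : φ ∈ Icc 0 (2 * Real.pi)) : Continuous fun r => flow p ρ μ r φ := by
  have : LipschitzWith ⟨Real.exp (2 * Real.pi), (Real.exp_pos _).le⟩
      fun r => flow p ρ μ r φ := by
    refine LipschitzWith.of_dist_le_mul fun r r' => ?_
    have := H.flow_lip hμ hμ r r' hφ
    rwa [sub_self, abs_zero, zero_add] at this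
  exact this.continuous

theorem RateBounds.continuous_rate_flow (H : RateBounds p ρ M) {μ : ℝ} (hμ : |μ| ≤ ρ) (r : ℝ) :
    Continuous fun φ => rate p μ φ (clamp ρ (flow p ρ μ r φ)) :=
  H.continuous_rate_comp μ (H.continuous_clamp_flow hμ r) fun _ => abs_clamp_le H.ρ_pos.le _

theorem RateBounds.continuous_rateDeriv_flow (H : RateBounds p ρ M) {μ : ℝ} (hμ : |μ| ≤ ρ)
    (r : ℝ) : Continuous fun φ => rateDeriv p μ φ (clamp ρ (flow p ρ μ r φ)) :=
  H.continuous_rateDeriv_comp μ (H.continuous_clamp_flow hμ r) fun _ => abs_clamp_le H.ρ_pos.le _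

theorem RateBounds.continuous_speedDeriv_flow (H : RateBounds p ρ M) {μ : ℝ} (hμ : |μ| ≤ ρ)
    (r : ℝ) : Continuous fun φ => speedDeriv p μ φ (clamp ρ (flow p ρ μ r φ)) :=
  H.continuous_speedDeriv_comp μ (H.continuous_clamp_flow hμ r) fun _ => abs_clamp_le H.ρ_pos.le _

theorem RateBounds.continuous_flowDeriv (H : RateBounds p ρ M) {μ : ℝ} (hμ : |μ| ≤ ρ) (r : ℝ) :
    Continuous (flowDeriv p ρ μ r) := by
  have h := H.continuous_speedDeriv_flow hμ r
  exact Real.continuous_exp.comp (continuous_iff_continuousAt.2 fun φ =>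
    (h.integral_hasStrictDerivAt 0 φ).hasDerivAt.continuousAt)

/-- The derivative of `logGrowth` in the radius. -/
def logGrowthDeriv (p : Coeffs) (ρ μ r : ℝ) : ℝ :=
  ∫ φ in (0 : ℝ)..2 * Real.pi,
    rateDeriv p μ φ (clamp ρ (flow p ρ μ r φ)) * flowDeriv p ρ μ r φ

/-- Differentiation under the integral, dominated by the Lipschitz constant of the integrand in the
initial radius. The pointwise derivative is the chain rule through the flow. -/
theorem RateBounds.hasDerivAt_logGrowth (H : RateBounds p ρ M) {μ : ℝ} (hμ : |μ| ≤ ρ) {r : ℝ}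
    (hr : |r| < ρ / 2) : HasDerivAt (logGrowth p ρ μ) (logGrowthDeriv p ρ μ r) r := by
  have hM := H.one_le
  refine (intervalIntegral.hasDerivAt_integral_of_dominated_loc_of_lip (s := univ)
    (bound := fun _ => 2 * M * Real.exp (2 * Real.pi)) univ_mem
    (Eventually.of_forall fun r => (H.continuous_rate_flow hμ r).aestronglyMeasurable)
    ((H.continuous_rate_flow hμ r).intervalIntegrable _ _)
    ((H.continuous_rateDeriv_flow hμ r).mul (H.continuous_flowDeriv hμ r)).aestronglyMeasurable
    (Eventually.of_forall fun φ hφ => ?_) intervalIntegrable_const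
    (Eventually.of_forall fun φ hφ => ?_)).2
  · refine LipschitzOnWith.of_dist_le_mul fun r _ r' _ => ?_
    have := H.rate_flow_lip hμ hμ r r' (mem_of_mem_uIoc hφ)
    rw [sub_self, abs_zero, zero_add] at this
    rw [Real.dist_eq, Real.dist_eq, Real.coe_nnabs,
      abs_of_nonneg (by positivity : 0 ≤ 2 * M * Real.exp (2 * Real.pi))]
    exact this
  · have hφ' := mem_of_mem_uIoc hφ
    have h1 := (H.hasDerivAt_rate (H.abs_flow_le_rho hμ hr.le hφ') μ φ).comp r
      (H.hasDerivAt_flow_initial hμ hr hφ')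
    change HasDerivAt _ (rateDeriv p μ φ (clamp ρ (flow p ρ μ r φ)) * flowDeriv p ρ μ r φ) r
    rw [H.clamp_flow hμ hr.le hφ']
    refine h1.congr_of_eventuallyEq ?_
    filter_upwards [(continuous_abs.tendsto r).eventually_lt_const hr] with r' hr'
    rw [H.clamp_flow hμ hr'.le hφ', Function.comp_apply]

theorem RateBounds.abs_speedDeriv_flow_le (H : RateBounds p ρ M) {μ : ℝ} (hμ : |μ| ≤ ρ)
    (r φ : ℝ) : |speedDeriv p μ φ (clamp ρ (flow p ρ μ r φ))| ≤ 14 * M * ρ := by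
  have hc := abs_clamp_le H.ρ_pos.le (flow p ρ μ r φ)
  have hM := H.one_le
  refine (H.abs_speedDeriv_le hμ hc φ).trans ?_
  nlinarith

/-- The integrand is at most `14 M ρ`, so the integral over a turn is at most `28 π M ρ < 1`. This
is the range of the quadratic bound for `exp u - 1 - u`. -/
theorem RateBounds.abs_integral_speedDeriv_le (H : RateBounds p ρ M) {μ : ℝ} (hμ : |μ| ≤ ρ)
    (r : ℝ) {φ : ℝ} (hφ : φ ∈ Icc 0 (2 * Real.pi)) :
    |∫ θ in (0 : ℝ)..φ, speedDeriv p μ θ (clamp ρ (flow p ρ μ r θ))| ≤ 1 := by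
  have := intervalIntegral.norm_integral_le_of_norm_le_const (a := 0) (b := φ)
    (f := fun θ => speedDeriv p μ θ (clamp ρ (flow p ρ μ r θ)))
    fun θ _ => H.abs_speedDeriv_flow_le hμ r θ
  rw [Real.norm_eq_abs, sub_zero, abs_of_nonneg hφ.1] at this
  refine this.trans ?_
  have h1 := H.small
  have hM := H.one_le
  have hρ := H.ρ_pos
  have h2 : 14 * M * ρ * φ ≤ 14 * M * ρ * (2 * Real.pi) :=
    mul_le_mul_of_nonneg_left hφ.2 (by positivity)
  have h3 : 0 < Real.pi * M * ρ := by positivity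
  linarith

theorem RateBounds.flowDeriv_le (H : RateBounds p ρ M) {μ : ℝ} (hμ : |μ| ≤ ρ) (r : ℝ) {φ : ℝ}
    (hφ : φ ∈ Icc 0 (2 * Real.pi)) : flowDeriv p ρ μ r φ ≤ 3 :=
  (Real.exp_le_exp.2 ((le_abs_self _).trans (H.abs_integral_speedDeriv_le hμ r hφ))).trans
    (Real.exp_one_lt_d9.le.trans (by norm_num))

theorem RateBounds.continuous_logGrowthDeriv (H : RateBounds p ρ M) {μ : ℝ} (hμ : |μ| ≤ ρ) :
    Continuous (logGrowthDeriv p ρ μ) := by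
  have hM := H.one_le
  have hρ := H.ρ_pos.le
  have hcl : ∀ φ ∈ Icc 0 (2 * Real.pi), Continuous fun r => clamp ρ (flow p ρ μ r φ) :=
    fun φ hφ => (continuous_clamp ρ).comp (H.continuous_flow_initial hμ hφ)
  have hrD : ∀ φ ∈ Icc 0 (2 * Real.pi), Continuous fun r =>
      rateDeriv p μ φ (clamp ρ (flow p ρ μ r φ)) := fun φ hφ =>
    H.continuous_rateDeriv_comp₃ continuous_const continuous_const (hcl φ hφ)
      fun _ => abs_clamp_le hρ _
  have hr : ∀ φ ∈ Icc 0 (2 * Real.pi), Continuous fun r =>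
      rate p μ φ (clamp ρ (flow p ρ μ r φ)) := fun φ hφ =>
    H.continuous_rate_comp₃ continuous_const continuous_const (hcl φ hφ)
      fun _ => abs_clamp_le hρ _
  refine intervalIntegral.continuous_of_dominated_interval (bound := fun _ => 5 * M * 3)
    (fun r => ((H.continuous_rateDeriv_flow hμ r).mul
      (H.continuous_flowDeriv hμ r)).aestronglyMeasurable)
    (fun r => Eventually.of_forall fun φ hφ => ?_) intervalIntegrable_const
    (Eventually.of_forall fun φ hφ => ?_)
  · rw [norm_mul]
    refine mul_le_mul (H.abs_rateDeriv_le hμ (abs_clamp_le hρ _) φ) ?_ (norm_nonneg _)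
      (by positivity)
    rw [Real.norm_eq_abs, flowDeriv, Real.abs_exp]
    exact H.flowDeriv_le hμ r (mem_of_mem_uIoc hφ)
  · have hφ' := mem_of_mem_uIoc hφ
    refine (hrD φ hφ').mul (Real.continuous_exp.comp ?_)
    refine intervalIntegral.continuous_of_dominated_interval (bound := fun _ => 14 * M * ρ)
      (fun r => (H.continuous_speedDeriv_flow hμ r).aestronglyMeasurable)
      (fun r => Eventually.of_forall fun θ _ => H.abs_speedDeriv_flow_le hμ r θ)
      intervalIntegrable_const (Eventually.of_forall fun θ hθ => ?_)
    rw [uIoc_of_le hφ'.1] at hθ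
    have hθ' : θ ∈ Icc 0 (2 * Real.pi) := ⟨hθ.1.le, hθ.2.trans hφ'.2⟩
    exact (hr θ hθ').add ((hcl θ hθ').mul (hrD θ hθ'))

/-- Joint dependence on `μ` and `r`. It provides continuity of the averaged field in both variables,
and a bound of `|μ|` by `r` on closed trajectories. -/
theorem RateBounds.logGrowth_lip (H : RateBounds p ρ M) {μ μ' : ℝ} (hμ : |μ| ≤ ρ)
    (hμ' : |μ'| ≤ ρ) (r r' : ℝ) :
    |logGrowth p ρ μ r - logGrowth p ρ μ' r'|
      ≤ 2 * M * Real.exp (2 * Real.pi) * (|μ - μ'| + |r - r'|) * (2 * Real.pi) := by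
  rw [logGrowth, logGrowth, ← intervalIntegral.integral_sub
    ((H.continuous_rate_flow hμ r).intervalIntegrable _ _)
    ((H.continuous_rate_flow hμ' r').intervalIntegrable _ _)]
  have := intervalIntegral.norm_integral_le_of_norm_le_const (a := 0) (b := 2 * Real.pi)
    (f := fun φ => rate p μ φ (clamp ρ (flow p ρ μ r φ))
      - rate p μ' φ (clamp ρ (flow p ρ μ' r' φ)))
    fun φ hφ => H.rate_flow_lip hμ hμ' r r' (mem_of_mem_uIoc hφ)
  rwa [Real.norm_eq_abs, sub_zero, abs_of_nonneg (by positivity : 0 ≤ 2 * Real.pi)] at this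

theorem RateBounds.logGrowth_zero (H : RateBounds p ρ M) {μ : ℝ} (hμ : |μ| ≤ ρ) :
    logGrowth p ρ μ 0 = 2 * Real.pi * (μ / p.ω) := by
  have h0 : clamp ρ 0 = 0 := clamp_of_abs_le (by simpa using H.ρ_pos.le)
  simp only [logGrowth, H.flow_of_zero hμ, h0, rate_zero_right]
  simp [mul_div_assoc]

end LogGrowth

/-! ### Expansion of the growth derivative in radius and parameter -/

section Expansion
variable {p : Coeffs} {ρ M : ℝ}

/-- Replacing the trajectory by its initial value costs `O(r (|μ| + r))`, which is of the order of
the admitted error. The leading coefficient does not depend on the radius and needs no correction.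
-/
theorem RateBounds.exists_rateDeriv_flow_expand (H : RateBounds p ρ M) :
    ∃ C, 0 ≤ C ∧ ∀ μ r φ, |μ| ≤ ρ → |r| ≤ ρ / 2 → φ ∈ Icc 0 (2 * Real.pi) →
      |rateDeriv p μ φ (clamp ρ (flow p ρ μ r φ))
        - (radialQuad p φ / p.ω + 2 * r * rateCub p φ)| ≤ C * (r ^ 2 + |μ|) := by
  have hM := H.one_le
  refine ⟨4 * M + 2 * M * (8 * Real.pi * M), by positivity, fun μ r φ hμ hr hφ => ?_⟩
  rw [H.clamp_flow hμ hr hφ]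
  have h1 := H.rateDeriv_expand φ μ _ hμ (H.abs_flow_le_rho hμ hr hφ)
  have h2 := H.abs_flow_le hμ r hφ
  have h3 := H.abs_flow_sub_le hμ hr hφ
  have h4 := H.bound_rateCub φ
  set X := flow p ρ μ r φ
  have h5 : X ^ 2 ≤ 4 * r ^ 2 := by
    rw [← sq_abs X, ← sq_abs r]; nlinarith [abs_nonneg X, abs_nonneg r]
  have hr1 : |r| ≤ 1 := by linarith [H.ρ_le, abs_nonneg r]
  have h6 : |r| * (|μ| + |r|) ≤ r ^ 2 + |μ| := by
    rw [← sq_abs r]; nlinarith [abs_nonneg μ, abs_nonneg r]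
  have h7 : rateDeriv p μ φ X - (radialQuad p φ / p.ω + 2 * r * rateCub p φ)
      = (rateDeriv p μ φ X - (radialQuad p φ / p.ω + 2 * X * rateCub p φ))
        + 2 * (X - r) * rateCub p φ := by ring
  rw [h7]
  refine (abs_add_le _ _).trans ?_
  have h8 : |2 * (X - r) * rateCub p φ| ≤ 2 * (8 * Real.pi * M * (r ^ 2 + |μ|)) * M := by
    rw [abs_mul, abs_mul, abs_two]
    refine mul_le_mul (mul_le_mul_of_nonneg_left (h3.trans ?_) two_pos.le) h4 (abs_nonneg _)
      (by positivity)
    exact mul_le_mul_of_nonneg_left h6 (by positivity)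
  have h9 : M * (X ^ 2 + |μ|) ≤ M * (4 * (r ^ 2 + |μ|)) :=
    mul_le_mul_of_nonneg_left (by linarith [abs_nonneg μ]) (by linarith)
  linarith

/-- The derivative of the radial field is `μ/ω + 2 s a + 3 s² b` to leading orders. Modulo `O(r² +
|μ|)` only `2 r a` remains. -/
theorem RateBounds.exists_speedDeriv_flow_expand (H : RateBounds p ρ M) :
    ∃ C, 0 ≤ C ∧ ∀ μ r φ, |μ| ≤ ρ → |r| ≤ ρ / 2 → φ ∈ Icc 0 (2 * Real.pi) →
      |speedDeriv p μ φ (clamp ρ (flow p ρ μ r φ)) - 2 * r * (radialQuad p φ / p.ω)|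
        ≤ C * (r ^ 2 + |μ|) := by
  have hM := H.one_le
  have hω := H.ne
  refine ⟨1 / |p.ω| + 50 * M + 2 * M * (8 * Real.pi * M), by positivity, fun μ r φ hμ hr hφ => ?_⟩
  rw [H.clamp_flow hμ hr hφ]
  have hXρ := H.abs_flow_le_rho hμ hr hφ
  have h1 := H.rateDeriv_expand φ μ _ hμ hXρ
  have h1' := H.rate_expand φ μ _ hμ hXρ
  have h2 := H.abs_flow_le hμ r hφ
  have h3 := H.abs_flow_sub_le hμ hr hφ
  have h4 := H.bound_rateCub φ
  have h4' := H.bound_div φ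
  set X := flow p ρ μ r φ
  have hX1 : |X| ≤ 1 := hXρ.trans H.ρ_le
  have hμ1 := hμ.trans H.ρ_le
  have h5 : X ^ 2 ≤ 4 * r ^ 2 := by
    rw [← sq_abs X, ← sq_abs r]; nlinarith [abs_nonneg X, abs_nonneg r]
  have hr1 : |r| ≤ 1 := by linarith [H.ρ_le, abs_nonneg r]
  have h6 : |r| * (|μ| + |r|) ≤ r ^ 2 + |μ| := by
    rw [← sq_abs r]; nlinarith [abs_nonneg μ, abs_nonneg r]
  have h7 : speedDeriv p μ φ X - 2 * r * (radialQuad p φ / p.ω)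
      = (rate p μ φ X - (μ / p.ω + X * (radialQuad p φ / p.ω) + X ^ 2 * rateCub p φ))
        + X * (rateDeriv p μ φ X - (radialQuad p φ / p.ω + 2 * X * rateCub p φ))
        + μ / p.ω + 3 * X ^ 2 * rateCub p φ + 2 * (X - r) * (radialQuad p φ / p.ω) := by
    simp only [speedDeriv]; ring
  have e1 : M * (|X| ^ 3 + |μ| * |X|) ≤ M * (4 * (r ^ 2 + |μ|)) := by
    refine mul_le_mul_of_nonneg_left ?_ (by linarith)
    have a1 : |X| ^ 3 ≤ X ^ 2 := by
      rw [← sq_abs X]; exact pow_le_pow_of_le_one (abs_nonneg _) hX1 (by norm_num)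
    have a2 : |μ| * |X| ≤ |μ| := mul_le_of_le_one_right (abs_nonneg _) hX1
    linarith [abs_nonneg μ]
  have e2 : |X * (rateDeriv p μ φ X - (radialQuad p φ / p.ω + 2 * X * rateCub p φ))|
      ≤ M * (4 * (r ^ 2 + |μ|)) := by
    rw [abs_mul]
    refine (mul_le_of_le_one_left (abs_nonneg _) hX1).trans (h1.trans ?_)
    exact mul_le_mul_of_nonneg_left (by linarith [abs_nonneg μ]) (by linarith)
  have e3 : |μ / p.ω| ≤ 1 / |p.ω| * (r ^ 2 + |μ|) := by
    rw [abs_div, div_eq_inv_mul, one_div]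
    exact mul_le_mul_of_nonneg_left (by linarith [sq_nonneg r]) (by positivity)
  have e4 : |3 * X ^ 2 * rateCub p φ| ≤ 12 * (r ^ 2 + |μ|) * M := by
    rw [abs_mul, abs_of_nonneg (by positivity : 0 ≤ 3 * X ^ 2)]
    exact mul_le_mul (by linarith [abs_nonneg μ]) h4 (abs_nonneg _) (by positivity)
  have e5 : |2 * (X - r) * (radialQuad p φ / p.ω)| ≤ 2 * (8 * Real.pi * M * (r ^ 2 + |μ|)) * M := by
    rw [abs_mul, abs_mul, abs_two]
    refine mul_le_mul (mul_le_mul_of_nonneg_left (h3.trans ?_) two_pos.le) h4' (abs_nonneg _)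
      (by positivity)
    exact mul_le_mul_of_nonneg_left h6 (by positivity)
  rw [h7]
  have e6 : 0 ≤ M * (r ^ 2 + |μ|) := by positivity
  refine (abs_add_le _ _).trans ?_
  refine (add_le_add_left ((abs_add_le _ _).trans (add_le_add_left ((abs_add_le _ _).trans
    (add_le_add_left (abs_add_le _ _) _)) _)) _).trans ?_
  linarith

/-- `∫₀^φ radialQuad / ω`. -/
def quadPrimitive (p : Coeffs) (φ : ℝ) : ℝ := ∫ θ in (0 : ℝ)..φ, radialQuad p θ / p.ω

theorem hasDerivAt_quadPrimitive (p : Coeffs) (φ : ℝ) :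
    HasDerivAt (quadPrimitive p) (radialQuad p φ / p.ω) φ :=
  (((continuous_radialQuad p).div_const p.ω).integral_hasStrictDerivAt 0 φ).hasDerivAt

theorem continuous_quadPrimitive (p : Coeffs) : Continuous (quadPrimitive p) :=
  continuous_iff_continuousAt.2 fun φ => (hasDerivAt_quadPrimitive p φ).continuousAt

theorem quadPrimitive_two_pi (p : Coeffs) :
    quadPrimitive p (2 * Real.pi) = 2 * Real.pi * avgQuad p := by
  rw [quadPrimitive, intervalIntegral.integral_div, integral_radialQuad, avgQuad]
  have := Real.pi_ne_zero
  rcases eq_or_ne p.ω 0 with h | h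
  · simp [h]
  · field_simp
    ring

theorem RateBounds.abs_quadPrimitive_le (H : RateBounds p ρ M) {φ : ℝ}
    (hφ : φ ∈ Icc 0 (2 * Real.pi)) : |quadPrimitive p φ| ≤ 2 * Real.pi * M := by
  have := intervalIntegral.norm_integral_le_of_norm_le_const (a := 0) (b := φ)
    (f := fun θ => radialQuad p θ / p.ω) fun θ _ => H.bound_div θ
  rw [Real.norm_eq_abs, sub_zero, abs_of_nonneg hφ.1] at this
  refine this.trans ?_
  have := mul_le_mul_of_nonneg_left hφ.2 (by linarith [H.one_le] : 0 ≤ M)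
  linarith

/-- The exponent of the linearised flow is `2 r ∫ a` up to the admitted error, and the exponential
is linearised. -/
theorem RateBounds.exists_flowDeriv_expand (H : RateBounds p ρ M) :
    ∃ C, 0 ≤ C ∧ ∀ μ r φ, |μ| ≤ ρ → |r| ≤ ρ / 2 → φ ∈ Icc 0 (2 * Real.pi) →
      |flowDeriv p ρ μ r φ - (1 + 2 * r * quadPrimitive p φ)| ≤ C * (r ^ 2 + |μ|) := by
  obtain ⟨C, hC, h⟩ := H.exists_speedDeriv_flow_expand
  have hM := H.one_le
  refine ⟨C * (2 * Real.pi) + 2 * ((4 * Real.pi * M) ^ 2 + (C * (2 * Real.pi)) ^ 2 * 2),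
    by positivity, fun μ r φ hμ hr hφ => ?_⟩
  set u := ∫ θ in (0 : ℝ)..φ, speedDeriv p μ θ (clamp ρ (flow p ρ μ r θ)) with hu
  have hu1 : |u| ≤ 1 := H.abs_integral_speedDeriv_le hμ r hφ
  have hcs := H.continuous_speedDeriv_flow hμ r
  have hcq := (continuous_radialQuad p).div_const p.ω
  have hI : u - 2 * r * quadPrimitive p φ = ∫ θ in (0 : ℝ)..φ,
      (speedDeriv p μ θ (clamp ρ (flow p ρ μ r θ)) - 2 * r * (radialQuad p θ / p.ω)) := by
    rw [intervalIntegral.integral_sub (hcs.intervalIntegrable _ _)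
      (Continuous.intervalIntegrable (by fun_prop) _ _), intervalIntegral.integral_const_mul]
    rfl
  have h1 : |u - 2 * r * quadPrimitive p φ| ≤ C * (2 * Real.pi) * (r ^ 2 + |μ|) := by
    rw [hI]
    have := intervalIntegral.norm_integral_le_of_norm_le_const (a := 0) (b := φ)
      (f := fun θ => speedDeriv p μ θ (clamp ρ (flow p ρ μ r θ)) - 2 * r * (radialQuad p θ / p.ω))
      (C := C * (r ^ 2 + |μ|)) fun θ hθ => by
        rw [uIoc_of_le hφ.1] at hθ
        exact h μ r θ hμ hr ⟨hθ.1.le, hθ.2.trans hφ.2⟩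
    rw [Real.norm_eq_abs, sub_zero, abs_of_nonneg hφ.1] at this
    refine this.trans ?_
    have := mul_le_mul_of_nonneg_left hφ.2 (by positivity : 0 ≤ C * (r ^ 2 + |μ|))
    linarith
  -- The square of the exponent is itself `O(r² + |μ|)`, since `u = O(r) + O(r² + |μ|)` with bounded
  -- `r` and `μ`.
  have h2 : |Real.exp u - 1 - u| ≤ u ^ 2 := Real.abs_exp_sub_one_sub_id_le hu1
  have hQ := H.abs_quadPrimitive_le hφ
  have h3 : u ^ 2 ≤ 2 * ((4 * Real.pi * M) ^ 2 + (C * (2 * Real.pi)) ^ 2 * 2) * (r ^ 2 + |μ|) := by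
    have e1 : u = 2 * r * quadPrimitive p φ + (u - 2 * r * quadPrimitive p φ) := by ring
    have e2 : u ^ 2 ≤ 2 * (2 * r * quadPrimitive p φ) ^ 2
        + 2 * (u - 2 * r * quadPrimitive p φ) ^ 2 := by
      nlinarith [sq_nonneg (2 * r * quadPrimitive p φ - (u - 2 * r * quadPrimitive p φ))]
    have e3 : (2 * r * quadPrimitive p φ) ^ 2 ≤ (4 * Real.pi * M) ^ 2 * (r ^ 2 + |μ|) := by
      have : quadPrimitive p φ ^ 2 ≤ (2 * Real.pi * M) ^ 2 := by
        rw [← sq_abs]; exact pow_le_pow_left₀ (abs_nonneg _) hQ 2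
      calc (2 * r * quadPrimitive p φ) ^ 2 = 4 * r ^ 2 * quadPrimitive p φ ^ 2 := by ring
        _ ≤ 4 * r ^ 2 * (2 * Real.pi * M) ^ 2 := mul_le_mul_of_nonneg_left this (by positivity)
        _ = (4 * Real.pi * M) ^ 2 * r ^ 2 := by ring
        _ ≤ _ := mul_le_mul_of_nonneg_left (by linarith [abs_nonneg μ]) (by positivity)
    have hr1 : |r| ≤ 1 := by linarith [H.ρ_le, abs_nonneg r]
    have hμ1 := hμ.trans H.ρ_le
    have e4 : r ^ 2 + |μ| ≤ 2 := by
      rw [← sq_abs r]; nlinarith [abs_nonneg r]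
    have e5 : (u - 2 * r * quadPrimitive p φ) ^ 2 ≤ (C * (2 * Real.pi)) ^ 2 * 2 * (r ^ 2 + |μ|) := by
      rw [← sq_abs]
      calc _ ≤ (C * (2 * Real.pi) * (r ^ 2 + |μ|)) ^ 2 := pow_le_pow_left₀ (abs_nonneg _) h1 2
        _ = (C * (2 * Real.pi)) ^ 2 * (r ^ 2 + |μ|) * (r ^ 2 + |μ|) := by ring
        _ ≤ (C * (2 * Real.pi)) ^ 2 * (r ^ 2 + |μ|) * 2 :=
            mul_le_mul_of_nonneg_left e4 (by positivity)
        _ = _ := by ring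
    linarith
  have h4 : flowDeriv p ρ μ r φ - (1 + 2 * r * quadPrimitive p φ)
      = (Real.exp u - 1 - u) + (u - 2 * r * quadPrimitive p φ) := by
    simp only [flowDeriv, ← hu]; ring
  rw [h4]
  refine (abs_add_le _ _).trans ?_
  linarith

/-- The integrand is the derivative of the square of the primitive. This is the source of the extra
term `(2π c)²` in the growth, which `avgField` later compensates. -/
theorem integral_quad_mul_primitive (p : Coeffs) :
    ∫ φ in (0 : ℝ)..2 * Real.pi, 2 * (radialQuad p φ / p.ω * quadPrimitive p φ)
      = (2 * Real.pi * avgQuad p) ^ 2 := by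
  have hd : ∀ φ, HasDerivAt (fun φ => quadPrimitive p φ ^ 2)
      (2 * (radialQuad p φ / p.ω * quadPrimitive p φ)) φ := fun φ => by
    refine ((hasDerivAt_quadPrimitive p φ).pow 2).congr_deriv ?_
    push_cast; ring
  have hc : Continuous fun φ => 2 * (radialQuad p φ / p.ω * quadPrimitive p φ) :=
    continuous_const.mul (((continuous_radialQuad p).div_const _).mul (continuous_quadPrimitive p))
  rw [intervalIntegral.integral_eq_sub_of_hasDerivAt (fun φ _ => hd φ)
    (hc.intervalIntegrable _ _), quadPrimitive_two_pi]
  simp [quadPrimitive]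

/-- The integrand is `(a + 2 r b)(1 + 2 r ∫ a)` up to the admitted error. Its constant part
integrates to `2π c`, and its `r`-part to `4π d` plus the square term of
`integral_quad_mul_primitive`. -/
theorem RateBounds.exists_logGrowthDeriv_expand (H : RateBounds p ρ M) :
    ∃ C, 0 ≤ C ∧ ∀ μ r, |μ| ≤ ρ → |r| ≤ ρ / 2 →
      |logGrowthDeriv p ρ μ r - (2 * Real.pi * avgQuad p
        + r * (4 * Real.pi * avgCub p + (2 * Real.pi * avgQuad p) ^ 2))| ≤ C * (r ^ 2 + |μ|) := by
  obtain ⟨C₁, hC₁, h₁⟩ := H.exists_rateDeriv_flow_expand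
  obtain ⟨C₂, hC₂, h₂⟩ := H.exists_flowDeriv_expand
  have hM := H.one_le
  refine ⟨(C₁ * 3 + 3 * M * C₂ + 4 * M * (2 * Real.pi * M)) * (2 * Real.pi), by positivity,
    fun μ r hμ hr => ?_⟩
  have hcq := (continuous_radialQuad p).div_const p.ω
  have hcc := continuous_rateCub p
  have hcp := continuous_quadPrimitive p
  have hint : 2 * Real.pi * avgQuad p + r * (4 * Real.pi * avgCub p + (2 * Real.pi * avgQuad p) ^ 2)
      = ∫ φ in (0 : ℝ)..2 * Real.pi, (radialQuad p φ / p.ω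
        + r * (2 * rateCub p φ + 2 * (radialQuad p φ / p.ω * quadPrimitive p φ))) := by
    rw [intervalIntegral.integral_add (hcq.intervalIntegrable _ _)
      (Continuous.intervalIntegrable (by fun_prop) _ _), intervalIntegral.integral_const_mul,
      intervalIntegral.integral_add (Continuous.intervalIntegrable (by fun_prop) _ _)
      (Continuous.intervalIntegrable (by fun_prop) _ _), integral_quad_mul_primitive,
      intervalIntegral.integral_const_mul, integral_rateCub]
    have := quadPrimitive_two_pi p
    rw [quadPrimitive] at this
    rw [this]; ring
  have hcl : Continuous fun φ => rateDeriv p μ φ (clamp ρ (flow p ρ μ r φ)) * flowDeriv p ρ μ r φ :=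
    (H.continuous_rateDeriv_flow hμ r).mul (H.continuous_flowDeriv hμ r)
  rw [hint, logGrowthDeriv, ← intervalIntegral.integral_sub (hcl.intervalIntegrable _ _)
    (Continuous.intervalIntegrable (by fun_prop) _ _)]
  have := intervalIntegral.norm_integral_le_of_norm_le_const (a := 0) (b := 2 * Real.pi)
    (f := fun φ => rateDeriv p μ φ (clamp ρ (flow p ρ μ r φ)) * flowDeriv p ρ μ r φ
      - (radialQuad p φ / p.ω
        + r * (2 * rateCub p φ + 2 * (radialQuad p φ / p.ω * quadPrimitive p φ))))
    (C := (C₁ * 3 + 3 * M * C₂ + 4 * M * (2 * Real.pi * M)) * (r ^ 2 + |μ|)) fun φ hφ => ?_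
  · rw [Real.norm_eq_abs, sub_zero, abs_of_nonneg (by positivity : 0 ≤ 2 * Real.pi)] at this
    refine this.trans (le_of_eq ?_)
    ring
  · have hφ' := mem_of_mem_uIoc hφ
    have a1 := h₁ μ r φ hμ hr hφ'
    have a2 := h₂ μ r φ hμ hr hφ'
    have a3 := H.flowDeriv_le hμ r hφ'
    have a4 := H.abs_quadPrimitive_le hφ'
    have a5 := H.bound_rateCub φ
    have a6 := H.bound_div φ
    have a7 : 0 < flowDeriv p ρ μ r φ := Real.exp_pos _
    set D := flowDeriv p ρ μ r φ
    set R := rateDeriv p μ φ (clamp ρ (flow p ρ μ r φ))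
    set a := radialQuad p φ / p.ω
    set b := rateCub p φ
    set I := quadPrimitive p φ
    have hid : R * D - (a + r * (2 * b + 2 * (a * I))) = (R - (a + 2 * r * b)) * D
        + (a + 2 * r * b) * (D - (1 + 2 * r * I)) + 4 * r ^ 2 * (b * I) := by ring
    have hr1 : |r| ≤ 1 := by linarith [H.ρ_le, abs_nonneg r]
    have b1 : |(R - (a + 2 * r * b)) * D| ≤ C₁ * (r ^ 2 + |μ|) * 3 := by
      rw [abs_mul, abs_of_pos a7]
      exact mul_le_mul a1 a3 a7.le (by positivity)
    have b2 : |(a + 2 * r * b) * (D - (1 + 2 * r * I))| ≤ 3 * M * (C₂ * (r ^ 2 + |μ|)) := by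
      rw [abs_mul]
      refine mul_le_mul ?_ a2 (abs_nonneg _) (by positivity)
      refine (abs_add_le _ _).trans ?_
      have : |2 * r * b| ≤ 2 * 1 * M := by
        rw [abs_mul, abs_mul, abs_two]
        exact mul_le_mul (by linarith) a5 (abs_nonneg _) (by norm_num)
      linarith
    have b3 : |4 * r ^ 2 * (b * I)| ≤ 4 * (r ^ 2 + |μ|) * (M * (2 * Real.pi * M)) := by
      rw [abs_mul, abs_mul b, abs_of_nonneg (by positivity : 0 ≤ 4 * r ^ 2)]
      refine mul_le_mul (by linarith [abs_nonneg μ]) ?_ (by positivity) (by positivity)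
      exact mul_le_mul a5 a4 (abs_nonneg _) (by positivity)
    rw [Real.norm_eq_abs, hid]
    refine (abs_add_le _ _).trans ((add_le_add_left (abs_add_le _ _) _).trans ?_)
    linarith

end Expansion

/-! ### The averaged field and its normal form expansion -/

section AveragedField
variable {p : Coeffs} {ρ M : ℝ}

/-- Integrating a derivative bound of order `r ^ n + |μ| r ^ m` from `0` to `r`. -/
theorem abs_sub_le_of_deriv_bound {f f' : ℝ → ℝ} {r B : ℝ} (hr : 0 ≤ r)
    (hf : ∀ s ∈ Icc 0 r, HasDerivAt f (f' s) s) (hb : ∀ s ∈ Icc 0 r, |f' s| ≤ B) :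
    |f r - f 0| ≤ B * r := by
  have := (convex_Icc 0 r).norm_image_sub_le_of_norm_hasDerivWithin_le (f := f) (f' := f')
    (C := B) (fun s hs => (hf s hs).hasDerivWithinAt) hb ⟨le_rfl, hr⟩ ⟨hr, le_rfl⟩
  rwa [Real.norm_eq_abs, Real.norm_eq_abs, sub_zero, abs_of_nonneg hr] at this

/-- Integration of the expansion of the derivative, starting from the exact value `2π μ/ω` at `r =
0`. -/
theorem RateBounds.exists_logGrowth_expand (H : RateBounds p ρ M) :
    ∃ C, 0 ≤ C ∧ ∀ μ r, |μ| ≤ ρ → 0 ≤ r → r < ρ / 2 →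
      |logGrowth p ρ μ r - (2 * Real.pi * (μ / p.ω) + 2 * Real.pi * avgQuad p * r
        + (2 * Real.pi * avgCub p + (2 * Real.pi * avgQuad p) ^ 2 / 2) * r ^ 2)|
        ≤ C * (r ^ 3 + |μ| * r) := by
  obtain ⟨C, hC, h⟩ := H.exists_logGrowthDeriv_expand
  refine ⟨C, hC, fun μ r hμ hr0 hr => ?_⟩
  have habs : ∀ s ∈ Icc 0 r, |s| < ρ / 2 := fun s hs => by
    rw [abs_of_nonneg hs.1]; exact hs.2.trans_lt hr
  have := abs_sub_le_of_deriv_bound (f := fun r => logGrowth p ρ μ r - (2 * Real.pi * avgQuad p * r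
        + (2 * Real.pi * avgCub p + (2 * Real.pi * avgQuad p) ^ 2 / 2) * r ^ 2))
    (f' := fun r => logGrowthDeriv p ρ μ r - (2 * Real.pi * avgQuad p
        + r * (4 * Real.pi * avgCub p + (2 * Real.pi * avgQuad p) ^ 2)))
    (B := C * (r ^ 2 + |μ|)) hr0 (fun s hs => ?_) (fun s hs => ?_)
  · simp only [H.logGrowth_zero hμ] at this
    convert this using 1
    · congr 1; ring
    · ring
  · refine (H.hasDerivAt_logGrowth hμ (habs s hs)).sub ?_
    refine (((hasDerivAt_id' s).const_mul _).add (((hasDerivAt_id' s).pow 2).const_mul _)).congr_deriv ?_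
    push_cast; ring
  · refine (h μ s hμ (habs s hs).le).trans (mul_le_mul_of_nonneg_left ?_ hC)
    have : s ^ 2 ≤ r ^ 2 := pow_le_pow_left₀ hs.1 hs.2 2
    linarith

/-- The averaged radial field. Its equilibria are the fixed points of the return map. -/
def avgField (p : Coeffs) (ρ μ r : ℝ) : ℝ :=
  r * (1 - Real.pi * avgQuad p * r) * (logGrowth p ρ μ r / (2 * Real.pi))

/-- The derivative of `avgField` in the radius. -/
def avgFieldDeriv (p : Coeffs) (ρ μ r : ℝ) : ℝ :=
  (1 - 2 * Real.pi * avgQuad p * r) * (logGrowth p ρ μ r / (2 * Real.pi))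
    + r * (1 - Real.pi * avgQuad p * r) * (logGrowthDeriv p ρ μ r / (2 * Real.pi))

theorem RateBounds.hasDerivAt_avgField (H : RateBounds p ρ M) {μ : ℝ} (hμ : |μ| ≤ ρ) {r : ℝ}
    (hr : |r| < ρ / 2) : HasDerivAt (avgField p ρ μ) (avgFieldDeriv p ρ μ r) r := by
  have hi := hasDerivAt_id' r
  have := (hi.mul ((hi.const_mul (Real.pi * avgQuad p)).const_sub 1)).mul
    ((H.hasDerivAt_logGrowth hμ hr).div_const (2 * Real.pi))
  refine this.congr_deriv ?_
  simp only [avgFieldDeriv, Pi.mul_apply]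
  ring

/-- In `(1 - π c r)(μ/ω + c r + (d + π c²) r²)` the terms `π c² r²` cancel, leaving `d` as second
order coefficient. The remaining products are `O(r³)` or `O(|μ| r)`. Working with the derivative
gives the `C¹` bound on the remainder directly. -/
theorem RateBounds.exists_avgFieldDeriv_expand (H : RateBounds p ρ M) :
    ∃ C, 0 ≤ C ∧ ∀ μ r, |μ| ≤ ρ → 0 ≤ r → r < ρ / 2 →
      |avgFieldDeriv p ρ μ r - (μ / p.ω + 2 * avgQuad p * r + 3 * avgCub p * r ^ 2)|
        ≤ C * (r ^ 3 + |μ| * r) := by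
  obtain ⟨C₁, hC₁, h₁⟩ := H.exists_logGrowth_expand
  obtain ⟨C₂, hC₂, h₂⟩ := H.exists_logGrowthDeriv_expand
  have hπ := Real.pi_pos
  set c := avgQuad p with hc
  set d := avgCub p with hd
  refine ⟨(1 + 2 * Real.pi * |c|) * C₁ + (1 + Real.pi * |c|) * C₂ + 2 * Real.pi * |c| / |p.ω|
    + (Real.pi * |c| * |2 * d + 2 * Real.pi * c ^ 2|
      + 2 * Real.pi * |c| * |d + Real.pi * c ^ 2|), by positivity, fun μ r hμ hr0 hr => ?_⟩
  have a1 := h₁ μ r hμ hr0 hr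
  have a2 := h₂ μ r hμ (by rw [abs_of_nonneg hr0]; exact hr.le)
  have hr1 : r ≤ 1 := by linarith [H.ρ_le]
  set K := logGrowth p ρ μ r
  set K' := logGrowthDeriv p ρ μ r
  set e₁ := K - (2 * Real.pi * (μ / p.ω) + 2 * Real.pi * c * r
        + (2 * Real.pi * d + (2 * Real.pi * c) ^ 2 / 2) * r ^ 2) with he₁
  set e₂ := K' - (2 * Real.pi * c + r * (4 * Real.pi * d + (2 * Real.pi * c) ^ 2)) with he₂
  have hK : K / (2 * Real.pi) = μ / p.ω + c * r + (d + Real.pi * c ^ 2) * r ^ 2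
      + e₁ / (2 * Real.pi) := by
    rw [he₁]; field_simp; ring
  have hK' : K' / (2 * Real.pi) = c + r * (2 * d + 2 * Real.pi * c ^ 2) + e₂ / (2 * Real.pi) := by
    rw [he₂]; field_simp; ring
  have hid : avgFieldDeriv p ρ μ r - (μ / p.ω + 2 * c * r + 3 * d * r ^ 2)
      = (1 - 2 * Real.pi * c * r) * (e₁ / (2 * Real.pi))
        + r * (1 - Real.pi * c * r) * (e₂ / (2 * Real.pi))
        + (-(2 * Real.pi * c * (μ / p.ω)) * r)
        + r ^ 3 * (-(Real.pi * c * (2 * d + 2 * Real.pi * c ^ 2)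
          + 2 * Real.pi * c * (d + Real.pi * c ^ 2))) := by
    change (1 - 2 * Real.pi * c * r) * (K / (2 * Real.pi))
      + r * (1 - Real.pi * c * r) * (K' / (2 * Real.pi)) - _ = _
    rw [hK, hK']
    ring
  have hdiv : ∀ e : ℝ, |e / (2 * Real.pi)| ≤ |e| := fun e => by
    rw [abs_div, abs_of_pos (by positivity : 0 < 2 * Real.pi)]
    exact div_le_self (abs_nonneg _) (by linarith [Real.pi_gt_three])
  have hE : 0 ≤ r ^ 3 + |μ| * r := by positivity
  have b1 : |(1 - 2 * Real.pi * c * r) * (e₁ / (2 * Real.pi))|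
      ≤ (1 + 2 * Real.pi * |c|) * (C₁ * (r ^ 3 + |μ| * r)) := by
    rw [abs_mul]
    refine mul_le_mul ?_ ((hdiv _).trans a1) (abs_nonneg _) (by positivity)
    refine (abs_sub _ _).trans ?_
    rw [abs_one, abs_mul, abs_mul, abs_of_pos (by positivity : 0 < 2 * Real.pi),
      abs_of_nonneg hr0]
    have : 2 * Real.pi * |c| * r ≤ 2 * Real.pi * |c| := mul_le_of_le_one_right (by positivity) hr1
    linarith
  have b2 : |r * (1 - Real.pi * c * r) * (e₂ / (2 * Real.pi))|
      ≤ (1 + Real.pi * |c|) * (C₂ * (r ^ 3 + |μ| * r)) := by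
    rw [abs_mul, abs_mul, abs_of_nonneg hr0]
    have s1 : |1 - Real.pi * c * r| ≤ 1 + Real.pi * |c| := by
      refine (abs_sub _ _).trans ?_
      rw [abs_one, abs_mul, abs_mul, abs_of_pos hπ, abs_of_nonneg hr0]
      have : Real.pi * |c| * r ≤ Real.pi * |c| := mul_le_of_le_one_right (by positivity) hr1
      linarith
    have s2 : r * |e₂ / (2 * Real.pi)| ≤ C₂ * (r ^ 3 + |μ| * r) := by
      have := mul_le_mul_of_nonneg_left ((hdiv _).trans a2) hr0
      refine this.trans (le_of_eq ?_)
      ring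
    calc _ = |1 - Real.pi * c * r| * (r * |e₂ / (2 * Real.pi)|) := by ring
      _ ≤ _ := mul_le_mul s1 s2 (by positivity) (by positivity)
  have b3 : |-(2 * Real.pi * c * (μ / p.ω)) * r|
      ≤ 2 * Real.pi * |c| / |p.ω| * (r ^ 3 + |μ| * r) := by
    rw [abs_mul, abs_neg, abs_mul, abs_mul, abs_of_pos (by positivity : 0 < 2 * Real.pi),
      abs_of_nonneg hr0, abs_div]
    calc 2 * Real.pi * |c| * (|μ| / |p.ω|) * r = 2 * Real.pi * |c| / |p.ω| * (|μ| * r) := by ring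
      _ ≤ _ := mul_le_mul_of_nonneg_left (by linarith [pow_nonneg hr0 3]) (by positivity)
  have b4 : |r ^ 3 * (-(Real.pi * c * (2 * d + 2 * Real.pi * c ^ 2)
          + 2 * Real.pi * c * (d + Real.pi * c ^ 2)))|
      ≤ (Real.pi * |c| * |2 * d + 2 * Real.pi * c ^ 2|
      + 2 * Real.pi * |c| * |d + Real.pi * c ^ 2|) * (r ^ 3 + |μ| * r) := by
    rw [abs_mul, abs_neg, abs_of_nonneg (pow_nonneg hr0 3), mul_comm]
    refine mul_le_mul ?_ (by linarith [mul_nonneg (abs_nonneg μ) hr0]) (pow_nonneg hr0 3)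
      (by positivity)
    refine (abs_add_le _ _).trans (le_of_eq ?_)
    rw [abs_mul, abs_mul, abs_mul, abs_mul, abs_of_pos hπ, abs_of_pos (by positivity : 0 < 2 * Real.pi)]
  rw [hid]
  refine (abs_add_le _ _).trans ((add_le_add_left ((abs_add_le _ _).trans
    (add_le_add_left (abs_add_le _ _) _)) _).trans ?_)
  linarith

theorem RateBounds.exists_avgField_expand (H : RateBounds p ρ M) :
    ∃ C, 0 ≤ C ∧ ∀ μ r, |μ| ≤ ρ → 0 ≤ r → r < ρ / 2 →
      |avgField p ρ μ r - normalFormCubic p μ r| ≤ C * (r ^ 4 + |μ| * r ^ 2) := by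
  obtain ⟨C, hC, h⟩ := H.exists_avgFieldDeriv_expand
  refine ⟨C, hC, fun μ r hμ hr0 hr => ?_⟩
  have habs : ∀ s ∈ Icc 0 r, |s| < ρ / 2 := fun s hs => by
    rw [abs_of_nonneg hs.1]; exact hs.2.trans_lt hr
  have := abs_sub_le_of_deriv_bound (f := fun r => avgField p ρ μ r - normalFormCubic p μ r)
    (f' := fun r => avgFieldDeriv p ρ μ r
      - (μ / p.ω + 2 * avgQuad p * r + 3 * avgCub p * r ^ 2))
    (B := C * (r ^ 3 + |μ| * r)) hr0 (fun s hs => ?_) (fun s hs => ?_)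
  · convert this using 1
    · simp [avgField, normalFormCubic]
    · ring
  · refine (H.hasDerivAt_avgField hμ (habs s hs)).sub ?_
    have hi := hasDerivAt_id' s
    refine (((hi.const_mul (μ / p.ω)).add ((hi.pow 2).const_mul (avgQuad p))).add
      ((hi.pow 3).const_mul (avgCub p))).congr_deriv ?_
    push_cast; ring
  · refine (h μ s hμ hs.1 (hs.2.trans_lt hr)).trans (mul_le_mul_of_nonneg_left ?_ hC)
    have : s ^ 3 ≤ r ^ 3 := pow_le_pow_left₀ hs.1 hs.2 3
    have := mul_le_mul_of_nonneg_left hs.2 (abs_nonneg μ)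
    linarith

theorem RateBounds.hasNormalFormExpansion (H : RateBounds p ρ M) {μ₀ δ : ℝ} (hμ₀ : μ₀ ≤ ρ)
    (hδ0 : 0 < δ) (hδ : δ ≤ ρ / 2) : HasNormalFormExpansion p μ₀ δ (avgField p ρ) := by
  have hμρ : ∀ μ, |μ| < μ₀ → |μ| ≤ ρ := fun μ h => h.le.trans hμ₀
  have habs : ∀ r ∈ Ico 0 δ, |r| < ρ / 2 := fun r hr => by
    rw [abs_of_nonneg hr.1]; exact hr.2.trans_le hδ
  refine ⟨?_, ?_, ?_⟩
  -- Joint continuity follows from the joint Lipschitz estimate.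
  · have hc : ContinuousOn (fun q : ℝ × ℝ => logGrowth p ρ q.1 q.2) (Ioo (-μ₀) μ₀ ×ˢ Ico 0 δ) := by
      have hM := H.one_le
      have hl : LipschitzOnWith (Real.toNNReal (2 * M * Real.exp (2 * Real.pi) * 2 * (2 * Real.pi)))
          (fun q : ℝ × ℝ => logGrowth p ρ q.1 q.2) (Ioo (-μ₀) μ₀ ×ˢ Ico 0 δ) := by
        refine LipschitzOnWith.of_dist_le_mul fun q hq q' hq' => ?_
        have h1 := H.logGrowth_lip (hμρ _ (abs_lt.2 hq.1)) (hμρ _ (abs_lt.2 hq'.1)) q.2 q'.2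
        rw [Real.coe_toNNReal _ (by positivity), Real.dist_eq]
        refine h1.trans ?_
        have h2 : |q.1 - q'.1| ≤ dist q q' := by rw [← Real.dist_eq]; exact le_max_left _ _
        have h3 : |q.2 - q'.2| ≤ dist q q' := by rw [← Real.dist_eq]; exact le_max_right _ _
        calc _ ≤ 2 * M * Real.exp (2 * Real.pi) * (2 * dist q q') * (2 * Real.pi) := by gcongr; linarith
          _ = _ := by ring
      exact hl.continuousOn
    unfold avgField
    exact ContinuousOn.mul (by fun_prop) (hc.div_const _)
  · intro μ hμ
    have hd : ∀ r ∈ Ioo (-δ) δ, HasDerivAt (avgField p ρ μ) (avgFieldDeriv p ρ μ r) r :=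
      fun r hr => H.hasDerivAt_avgField (hμρ μ hμ) ((abs_lt.2 hr).trans_le hδ)
    -- The truncated flow also makes sense for negative radii, so regularity is proved on an open
    -- interval around `0`, which avoids one-sided derivatives at the end point.
    have : ContDiffOn ℝ 1 (avgField p ρ μ) (Ioo (-δ) δ) := by
      rw [show (1 : WithTop ℕ∞) = 0 + 1 from rfl, contDiffOn_succ_iff_deriv_of_isOpen isOpen_Ioo]
      refine ⟨fun r hr => (hd r hr).differentiableAt.differentiableWithinAt, by simp, ?_⟩
      rw [contDiffOn_zero]
      have hcont : ContinuousOn (avgFieldDeriv p ρ μ) (Ioo (-δ) δ) := by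
        have h1 : ContinuousOn (logGrowth p ρ μ) (Ioo (-δ) δ) := fun r hr =>
          (H.hasDerivAt_logGrowth (hμρ μ hμ)
            ((abs_lt.2 hr).trans_le hδ)).continuousAt.continuousWithinAt
        have h2 := H.continuous_logGrowthDeriv (hμρ μ hμ)
        unfold avgFieldDeriv
        exact (ContinuousOn.mul (by fun_prop) (h1.div_const _)).add (by fun_prop)
      exact hcont.congr fun r hr => (hd r hr).deriv
    exact this.mono fun r hr => ⟨by linarith [hr.1], hr.2⟩
  · obtain ⟨C₁, hC₁, h₁⟩ := H.exists_avgField_expand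
    obtain ⟨C₂, hC₂, h₂⟩ := H.exists_avgFieldDeriv_expand
    refine ⟨max C₁ C₂, fun μ hμ r hr => ⟨?_, ?_⟩⟩
    · refine (h₁ μ r (hμρ μ hμ) hr.1 (hr.2.trans_le hδ)).trans
        (mul_le_mul_of_nonneg_right (le_max_left _ _) ?_)
      positivity
    · have hi := hasDerivAt_id' r
      have hn : HasDerivAt (normalFormCubic p μ)
          (μ / p.ω + 2 * avgQuad p * r + 3 * avgCub p * r ^ 2) r := by
        refine (((hi.const_mul (μ / p.ω)).add ((hi.pow 2).const_mul (avgQuad p))).add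
          ((hi.pow 3).const_mul (avgCub p))).congr_deriv ?_
        push_cast; ring
      have hd := ((H.hasDerivAt_avgField (hμρ μ hμ) (habs r hr)).sub hn).hasDerivWithinAt
        (s := Ico 0 δ)
      have hu : UniqueDiffWithinAt ℝ (Ico 0 δ) r := uniqueDiffOn_Ico 0 δ r hr
      have he := hd.derivWithin hu
      have he' : derivWithin (fun s => avgField p ρ μ s - normalFormCubic p μ s) (Ico 0 δ) r
        = avgFieldDeriv p ρ μ r - (μ / p.ω + 2 * avgQuad p * r + 3 * avgCub p * r ^ 2) := he
      rw [he']
      refine (h₂ μ r (hμρ μ hμ) hr.1 (hr.2.trans_le hδ)).trans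
        (mul_le_mul_of_nonneg_right (le_max_right _ _) ?_)
      have := hr.1
      positivity

end AveragedField

/-! ### The near-identity change of the radius -/

section Averaging
variable {p : Coeffs} {ρ M : ℝ}

/-- At `s = 0` both sides vanish, whatever value division by zero gives to the angular speed. -/
theorem radialRHS_eq_mul_rate (p : Coeffs) (μ : ℝ) {s : ℝ} (hs0 : 0 ≤ s) (φ : ℝ) :
    radialRHS p μ s φ = s * rate p μ φ s := by
  rcases hs0.eq_or_lt with h | h
  · rw [← h, radialRHS, radialSpeed_eq p μ le_rfl]; simp
  · rw [radialRHS, radialSpeed_eq p μ h.le, angularSpeed_eq p μ h, rate, angularPoly, mul_div_assoc]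

/-- The primitive of `g - c`. -/
def oscPrimitive (g : ℝ → ℝ) (c φ : ℝ) : ℝ := (∫ θ in (0 : ℝ)..φ, g θ) - c * φ

theorem hasDerivAt_oscPrimitive {g : ℝ → ℝ} (hg : Continuous g) (c φ : ℝ) :
    HasDerivAt (oscPrimitive g c) (g φ - c) φ := by
  have := (hg.integral_hasStrictDerivAt 0 φ).hasDerivAt.sub ((hasDerivAt_id' φ).const_mul c)
  rwa [mul_one] at this

theorem periodic_oscPrimitive {g : ℝ → ℝ} (hg : Continuous g)
    (hp : Function.Periodic g (2 * Real.pi)) {c : ℝ}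
    (hc : ∫ θ in (0 : ℝ)..2 * Real.pi, g θ = 2 * Real.pi * c) :
    Function.Periodic (oscPrimitive g c) (2 * Real.pi) := by
  intro φ
  have h1 := intervalIntegral.integral_add_adjacent_intervals
    (hg.intervalIntegrable (μ := MeasureTheory.volume) 0 φ)
    (hg.intervalIntegrable φ (φ + 2 * Real.pi))
  have h2 := hp.intervalIntegral_add_eq φ 0
  rw [zero_add, hc] at h2
  simp only [oscPrimitive, ← h1, h2]
  ring

theorem continuous_oscPrimitive {g : ℝ → ℝ} (hg : Continuous g) (c : ℝ) :
    Continuous (oscPrimitive g c) :=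
  continuous_iff_continuousAt.2 fun φ => (hasDerivAt_oscPrimitive hg c φ).continuousAt

theorem contDiff_one_of_hasDerivAt {f f' : ℝ → ℝ} (hf : ∀ t, HasDerivAt f (f' t) t)
    (hc : Continuous f') : ContDiff ℝ 1 f := by
  rw [contDiff_one_iff_deriv]
  refine ⟨fun t => (hf t).differentiableAt, ?_⟩
  rwa [show deriv f = f' from funext fun t => (hf t).deriv]

/-- The second order coefficient of the near-identity change of the radius. -/
def changeQuad (p : Coeffs) : ℝ → ℝ := oscPrimitive (fun φ => radialQuad p φ / p.ω) (avgQuad p)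

/-- The third order coefficient of the near-identity change of the radius. -/
def changeCub (p : Coeffs) (φ : ℝ) : ℝ :=
  oscPrimitive (rateCub p) (avgCub p) φ + changeQuad p φ ^ 2

theorem continuous_changeQuad (p : Coeffs) : Continuous (changeQuad p) :=
  continuous_oscPrimitive ((continuous_radialQuad p).div_const _) _

theorem continuous_changeCub (p : Coeffs) : Continuous (changeCub p) :=
  (continuous_oscPrimitive (continuous_rateCub p) _).add ((continuous_changeQuad p).pow 2)

theorem hasDerivAt_changeQuad (p : Coeffs) (φ : ℝ) :
    HasDerivAt (changeQuad p) (radialQuad p φ / p.ω - avgQuad p) φ :=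
  hasDerivAt_oscPrimitive ((continuous_radialQuad p).div_const _) _ φ

theorem hasDerivAt_changeCub (p : Coeffs) (φ : ℝ) :
    HasDerivAt (changeCub p) (rateCub p φ - avgCub p
      + 2 * changeQuad p φ * (radialQuad p φ / p.ω - avgQuad p)) φ := by
  refine ((hasDerivAt_oscPrimitive (continuous_rateCub p) (avgCub p) φ).add
    ((hasDerivAt_changeQuad p φ).pow 2)).congr_deriv ?_
  push_cast; ring

theorem periodic_changeQuad (p : Coeffs) : Function.Periodic (changeQuad p) (2 * Real.pi) := by
  refine periodic_oscPrimitive ((continuous_radialQuad p).div_const _) (fun φ => ?_)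
    (quadPrimitive_two_pi p)
  simp only [periodic_radialQuad p φ]

theorem periodic_changeCub (p : Coeffs) : Function.Periodic (changeCub p) (2 * Real.pi) := by
  intro φ
  simp only [changeCub, periodic_changeQuad p φ, periodic_oscPrimitive (continuous_rateCub p)
    (periodic_rateCub p) (integral_rateCub p) φ]

/-- The near-identity change of the radius. -/
def radiusChange (p : Coeffs) (φ r : ℝ) : ℝ := r + changeQuad p φ * r ^ 2 + changeCub p φ * r ^ 3

theorem contDiff_radiusChange (p : Coeffs) :
    ContDiff ℝ 1 fun q : ℝ × ℝ => radiusChange p q.1 q.2 := by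
  have h1 : ContDiff ℝ 1 (changeQuad p) := contDiff_one_of_hasDerivAt (hasDerivAt_changeQuad p)
    (((continuous_radialQuad p).div_const _).sub continuous_const)
  have h2 : ContDiff ℝ 1 (changeCub p) := contDiff_one_of_hasDerivAt (hasDerivAt_changeCub p)
    (((continuous_rateCub p).sub continuous_const).add
      ((continuous_const.mul (continuous_changeQuad p)).mul
        (((continuous_radialQuad p).div_const _).sub continuous_const)))
  exact (contDiff_snd.add ((h1.comp contDiff_fst).mul (contDiff_snd.pow 2))).add
    ((h2.comp contDiff_fst).mul (contDiff_snd.pow 3))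

theorem deriv_radiusChange (p : Coeffs) (φ r : ℝ) :
    deriv (fun s => radiusChange p φ s) r
      = 1 + 2 * changeQuad p φ * r + 3 * changeCub p φ * r ^ 2 := by
  have hi := hasDerivAt_id' r
  have : HasDerivAt (fun s => radiusChange p φ s)
      (1 + 2 * changeQuad p φ * r + 3 * changeCub p φ * r ^ 2) r := by
    refine ((hi.add ((hi.pow 2).const_mul _)).add ((hi.pow 3).const_mul _)).congr_deriv ?_
    push_cast; ring
  exact this.deriv

theorem deriv_radiusChange_angle (p : Coeffs) (φ r : ℝ) :
    deriv (fun θ => radiusChange p θ r) φ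
      = (radialQuad p φ / p.ω - avgQuad p) * r ^ 2 + (rateCub p φ - avgCub p
      + 2 * changeQuad p φ * (radialQuad p φ / p.ω - avgQuad p)) * r ^ 3 := by
  have : HasDerivAt (fun θ => radiusChange p θ r)
      ((radialQuad p φ / p.ω - avgQuad p) * r ^ 2 + (rateCub p φ - avgCub p
      + 2 * changeQuad p φ * (radialQuad p φ / p.ω - avgQuad p)) * r ^ 3) φ :=
    (((hasDerivAt_changeQuad p φ).mul_const _).const_add r).add
      ((hasDerivAt_changeCub p φ).mul_const _)
  exact this.deriv

/-- Here `a, b` are the oscillating coefficients, `c, d` their means, `A, B` the coefficients of the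
change, and `G` the growth rate at the new radius `s`. With `A' = a - c` and `B' = b - d + 2 A (a -
c)` all terms of orders `r, r², r³` at `μ = 0` cancel identically. Only the Taylor remainder of `G`,
an `r⁴` polynomial and a `μ r²` term are left. -/
theorem averaging_remainder {s r A B a b c d μ ω G M N C₁ : ℝ}
    (hs : s = r + A * r ^ 2 + B * r ^ 3) (hr0 : 0 ≤ r) (hr1 : r ≤ 1) (hs0 : 0 ≤ s)
    (hs2 : s ≤ 2 * r) (hA : |A| ≤ N) (hB : |B| ≤ N) (hM : 0 ≤ M)
    (hG : |G - (μ / ω + s * a + s ^ 2 * b)| ≤ M * (|s| ^ 3 + |μ| * |s|))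
    (hQ : |a * (A ^ 2 + 2 * B + 2 * A * B * r + B ^ 2 * r ^ 2)
      + b * ((A + B * r) * (3 + 3 * (r * (A + B * r)) + (r * (A + B * r)) ^ 2))
      - (2 * A * d + 3 * B * c + 3 * B * d * r)| ≤ C₁) :
    |s * G - ((a - c) * r ^ 2 + (b - d + 2 * A * (a - c)) * r ^ 3)
      - (1 + 2 * A * r + 3 * B * r ^ 2) * (μ / ω * r + c * r ^ 2 + d * r ^ 3)|
      ≤ (16 * M + C₁ + 3 * N / |ω|) * (r ^ 4 + |μ| * r ^ 2) := by
  have hN : 0 ≤ N := (abs_nonneg A).trans hA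
  have hid : s * G - ((a - c) * r ^ 2 + (b - d + 2 * A * (a - c)) * r ^ 3)
      - (1 + 2 * A * r + 3 * B * r ^ 2) * (μ / ω * r + c * r ^ 2 + d * r ^ 3)
      = s * (G - (μ / ω + s * a + s ^ 2 * b))
      + r ^ 4 * (a * (A ^ 2 + 2 * B + 2 * A * B * r + B ^ 2 * r ^ 2)
        + b * ((A + B * r) * (3 + 3 * (r * (A + B * r)) + (r * (A + B * r)) ^ 2))
        - (2 * A * d + 3 * B * c + 3 * B * d * r))
      + μ / ω * (-(A + 2 * B * r)) * r ^ 2 := by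
    rw [hs]; ring
  have b1 : |s * (G - (μ / ω + s * a + s ^ 2 * b))| ≤ 16 * M * (r ^ 4 + |μ| * r ^ 2) := by
    rw [abs_mul, abs_of_nonneg hs0]
    rw [abs_of_nonneg hs0] at hG
    calc s * _ ≤ s * (M * (s ^ 3 + |μ| * s)) := mul_le_mul_of_nonneg_left hG hs0
      _ = M * (s ^ 4 + |μ| * s ^ 2) := by ring
      _ ≤ M * ((2 * r) ^ 4 + |μ| * (2 * r) ^ 2) := by gcongr
      _ = 16 * M * r ^ 4 + 4 * (M * (|μ| * r ^ 2)) := by ring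
      _ ≤ 16 * M * r ^ 4 + 16 * (M * (|μ| * r ^ 2)) := by
        have : 0 ≤ M * (|μ| * r ^ 2) := by positivity
        linarith
      _ = _ := by ring
  have b3 : |μ / ω * (-(A + 2 * B * r)) * r ^ 2| ≤ 3 * N / |ω| * (r ^ 4 + |μ| * r ^ 2) := by
    rw [abs_mul, abs_mul, abs_neg, abs_div, abs_of_nonneg (sq_nonneg r)]
    have : |A + 2 * B * r| ≤ 3 * N := by
      refine (abs_add_le _ _).trans ?_
      rw [abs_mul, abs_mul, abs_of_nonneg hr0, abs_two]
      nlinarith [abs_nonneg B]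
    calc |μ| / |ω| * |A + 2 * B * r| * r ^ 2 ≤ |μ| / |ω| * (3 * N) * r ^ 2 := by gcongr
      _ = 3 * N / |ω| * (|μ| * r ^ 2) := by ring
      _ ≤ _ := mul_le_mul_of_nonneg_left (by linarith [pow_nonneg hr0 4]) (by positivity)
  rw [hid]
  refine (abs_add_le _ _).trans ((add_le_add_left (abs_add_le _ _) _).trans ?_)
  rw [abs_mul (r ^ 4), abs_of_nonneg (pow_nonneg hr0 4)]
  have b4 := mul_le_mul_of_nonneg_left hQ (pow_nonneg hr0 4)
  have b5 : r ^ 4 * C₁ ≤ C₁ * (r ^ 4 + |μ| * r ^ 2) := by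
    have : 0 ≤ C₁ * (|μ| * r ^ 2) := mul_nonneg ((abs_nonneg _).trans hQ) (by positivity)
    linarith
  linarith

/-- The averaged equation is obtained from the radial equation by a near-identity change of the
radius. -/
theorem RateBounds.exists_isObtainedByAveraging (H : RateBounds p ρ M) :
    ∃ δ₁ > 0, ∀ μ₀ δ, μ₀ ≤ ρ → δ ≤ δ₁ → IsObtainedByAveraging p μ₀ δ (avgField p ρ) := by
  obtain ⟨N₁, hN₁, hA⟩ := exists_abs_le_of_periodic (continuous_changeQuad p)
    (periodic_changeQuad p)
  obtain ⟨N₂, hN₂, hB⟩ := exists_abs_le_of_periodic (continuous_changeCub p)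
    (periodic_changeCub p)
  obtain ⟨C₀, hC₀, hF⟩ := H.exists_avgField_expand
  have hM := H.one_le
  have hρ := H.ρ_pos
  have hρ1 := H.ρ_le
  have hω' : 0 < |p.ω| := abs_pos.2 H.ne
  set N := N₁ + N₂ with hN
  have hNpos : 0 < N := by positivity
  replace hA : ∀ φ, |changeQuad p φ| ≤ N := fun φ => (hA φ).trans (by linarith)
  replace hB : ∀ φ, |changeCub p φ| ≤ N := fun φ => (hB φ).trans (by linarith)
  obtain ⟨C₁, hC₁, hQ⟩ := exists_bound_on_paramBox (ρ := 1) (B := M + N)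
    (f := fun q => q.2.2.1 * (q.2.2.2.2.1 ^ 2 + 2 * q.2.2.2.2.2 + 2 * q.2.2.2.2.1 * q.2.2.2.2.2 * q.2.1
        + q.2.2.2.2.2 ^ 2 * q.2.1 ^ 2)
      + q.2.2.2.1 * ((q.2.2.2.2.1 + q.2.2.2.2.2 * q.2.1)
        * (3 + 3 * (q.2.1 * (q.2.2.2.2.1 + q.2.2.2.2.2 * q.2.1))
          + (q.2.1 * (q.2.2.2.2.1 + q.2.2.2.2.2 * q.2.1)) ^ 2))
      - (2 * q.2.2.2.2.1 * avgCub p + 3 * q.2.2.2.2.2 * avgQuad p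
        + 3 * q.2.2.2.2.2 * avgCub p * q.2.1)) (by fun_prop)
  set C := 5 * N + C₀ + 2 * (16 * M + C₁ + 3 * N / |p.ω|) with hC
  -- For `r < 1 / (10 N)` the derivative of the change is within `5 N r < 1/2` of `1`, and the new
  -- radius lies between `3r/4` and `2r`.
  refine ⟨min (ρ / 2) (1 / (10 * N)), by positivity, fun μ₀ δ hμ₀ hδ => ?_⟩
  -- The error `E` is obtained by solving the transformed equation for it. The equation then holds
  -- by definition, and only the size of `E` has to be estimated.
  refine ⟨fun _ φ r => radiusChange p φ r, fun μ φ r =>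
    (radialRHS p μ (radiusChange p φ r) φ - deriv (fun θ => radiusChange p θ r) φ)
      / deriv (fun s => radiusChange p φ s) r - avgField p ρ μ r, C, fun μ hμ => ?_⟩
  refine ⟨contDiff_radiusChange p, fun r φ => ?_, fun φ r hr => ?_⟩
  · simp only [radiusChange, periodic_changeQuad p φ, periodic_changeCub p φ]
  have hμρ : |μ| ≤ ρ := hμ.le.trans hμ₀
  have hr0 : 0 ≤ r := hr.1
  have hrρ : r < ρ / 2 := hr.2.trans_le (hδ.trans (min_le_left _ _))
  have hrN : r * (10 * N) < 1 := by
    rw [← lt_div_iff₀ (by positivity)]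
    exact hr.2.trans_le (hδ.trans (min_le_right _ _))
  have hr1 : r ≤ 1 := by linarith
  set A := changeQuad p φ with hAdef
  set B := changeCub p φ with hBdef
  have hAφ : |A| ≤ N := hA φ
  have hBφ : |B| ≤ N := hB φ
  set a := radialQuad p φ / p.ω with ha
  set b := rateCub p φ with hb
  have hsr : |radiusChange p φ r - r| ≤ 2 * N * r ^ 2 := by
    have e : radiusChange p φ r - r = (A + B * r) * r ^ 2 := by
      simp only [radiusChange, ← hAdef, ← hBdef]; ring
    rw [e, abs_mul, abs_of_nonneg (sq_nonneg r)]
    refine mul_le_mul_of_nonneg_right ((abs_add_le _ _).trans ?_) (sq_nonneg r)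
    rw [abs_mul, abs_of_nonneg hr0]
    nlinarith [abs_nonneg B]
  have hsr' : 2 * N * r ^ 2 ≤ r / 4 := by nlinarith
  have hs_lo : 3 / 4 * r ≤ radiusChange p φ r := by linarith [(abs_le.1 (hsr.trans hsr')).1]
  have hs_hi : radiusChange p φ r ≤ 2 * r := by linarith [(abs_le.1 (hsr.trans hsr')).2]
  have hs0 : 0 ≤ radiusChange p φ r := by linarith
  have hsρ : |radiusChange p φ r| ≤ ρ := by rw [abs_of_nonneg hs0]; linarith
  have hd1 : |deriv (fun s => radiusChange p φ s) r - 1| ≤ 5 * N * r := by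
    rw [deriv_radiusChange]
    have e : 1 + 2 * changeQuad p φ * r + 3 * changeCub p φ * r ^ 2 - 1
      = (2 * A + 3 * B * r) * r := by simp only [← hAdef, ← hBdef]; ring
    rw [e, abs_mul, abs_of_nonneg hr0]
    refine mul_le_mul_of_nonneg_right ((abs_add_le _ _).trans ?_) hr0
    rw [abs_mul, abs_mul, abs_mul, abs_of_nonneg hr0, abs_two,
      abs_of_pos (by norm_num : (0 : ℝ) < 3)]
    nlinarith [abs_nonneg B]
  have hdlo : 1 / 2 ≤ deriv (fun s => radiusChange p φ s) r := by
    linarith [(abs_le.1 hd1).1]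
  refine ⟨?_, ?_, by linarith, fun hrpos => ⟨by linarith, ?_⟩, ?_, ?_⟩
  · refine hsr.trans (mul_le_mul_of_nonneg_right ?_ (sq_nonneg r))
    have : 0 ≤ 2 * (16 * M + C₁ + 3 * N / |p.ω|) := by positivity
    linarith
  · refine hd1.trans (mul_le_mul_of_nonneg_right ?_ hr0)
    have : 0 ≤ 2 * (16 * M + C₁ + 3 * N / |p.ω|) := by positivity
    linarith
  · rw [angularSpeed_eq p μ (by linarith)]
    have h1 := H.le_mul_angularPoly hsρ φ
    have h2 := sq_pos_of_ne_zero H.ne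
    change 0 < p.ω * angularPoly p φ (radiusChange p φ r)
    linarith
  · beta_reduce
    rw [radialRHS_eq_mul_rate p μ hs0]
    set D := deriv (fun s => radiusChange p φ s) r with hD
    set T := deriv (fun θ => radiusChange p θ r) φ with hT
    set s := radiusChange p φ r with hs
    have hDpos : 0 < D := by linarith
    have hsplit : (s * rate p μ φ s - T) / D - avgField p ρ μ r
        = (s * rate p μ φ s - T - D * normalFormCubic p μ r) / D
          - (avgField p ρ μ r - normalFormCubic p μ r) := by
      field_simp; ring
    have hX : 0 ≤ r ^ 4 + |μ| * r ^ 2 := by positivity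
    have hmain : |s * rate p μ φ s - T - D * normalFormCubic p μ r|
        ≤ (16 * M + C₁ + 3 * N / |p.ω|) * (r ^ 4 + |μ| * r ^ 2) := by
      have h1 := H.rate_expand φ μ s hμρ hsρ
      have b2 := hQ (0, r, a, b, A, B) (mem_paramBox (by simp) (by rw [abs_of_nonneg hr0]; exact hr1)
        ((H.bound_div φ).trans (by linarith)) ((H.bound_rateCub φ).trans (by linarith))
        (hAφ.trans (by linarith)) (hBφ.trans (by linarith)))
      rw [hD, hT, deriv_radiusChange, deriv_radiusChange_angle, normalFormCubic_eq]
      exact averaging_remainder (s := s) rfl hr0 hr1 hs0 hs_hi hAφ hBφ (by linarith) h1 b2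
    rw [hsplit]
    refine (abs_sub _ _).trans ?_
    have c1 : |(s * rate p μ φ s - T - D * normalFormCubic p μ r) / D|
        ≤ 2 * ((16 * M + C₁ + 3 * N / |p.ω|) * (r ^ 4 + |μ| * r ^ 2)) := by
      rw [abs_div, abs_of_pos hDpos, div_le_iff₀ hDpos]
      have : 0 ≤ (16 * M + C₁ + 3 * N / |p.ω|) * (r ^ 4 + |μ| * r ^ 2) := by positivity
      nlinarith
    have c2 := hF μ r hμρ hr0 hrρ
    have c3 : 0 ≤ 5 * N * (r ^ 4 + |μ| * r ^ 2) := by positivity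
    rw [hC]
    linarith
  · have : deriv (fun s => radiusChange p φ s) r ≠ 0 := by linarith
    field_simp
    ring

end Averaging

/-! ### The planar field: polar form and local Lipschitz continuity -/

section PlanarField

theorem field_polar (p : Coeffs) (μ : ℝ) {r : ℝ} (hr : r ≠ 0) (φ : ℝ) :
    field p μ (r * Real.cos φ, r * Real.sin φ)
      = (radialSpeed p μ r φ * Real.cos φ - r * (Real.sin φ * angularSpeed p μ r φ),
        radialSpeed p μ r φ * Real.sin φ + r * (Real.cos φ * angularSpeed p μ r φ)) := by
  have h := Real.cos_sq_add_sin_sq φ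
  simp only [radialSpeed, angularSpeed]
  set F := field p μ (r * Real.cos φ, r * Real.sin φ)
  refine Prod.ext ?_ ?_
  · simp only
    field_simp
    linear_combination (-F.1) * h
  · simp only
    field_simp
    linear_combination (-F.2) * h

theorem continuous_field (p : Coeffs) (μ : ℝ) : Continuous (field p μ) := by
  unfold field nonlinV nonlinW; fun_prop

theorem field_zero (p : Coeffs) (μ : ℝ) : field p μ 0 = 0 := by
  simp [field, nonlinV, nonlinW]

/-- The field as a smooth function of `v, w, |v|, |w|`. -/
def fieldLift (p : Coeffs) (μ : ℝ) (q : ℝ × ℝ × ℝ × ℝ) : ℝ × ℝ :=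
  (μ * q.1 - p.ω * q.2.1 + ((p.a11 * q.1 * q.2.2.1 + p.a12 * q.1 * q.2.2.2
      + p.a21 * q.2.1 * q.2.2.1 + p.a22 * q.2.1 * q.2.2.2)
    + (p.a1 * q.1 ^ 2 + p.a2 * q.1 * q.2.1 + p.a3 * q.2.1 ^ 2)
    + (p.ca1 * q.1 ^ 3 + p.ca2 * q.1 * q.2.1 ^ 2 + p.ca3 * q.1 ^ 2 * q.2.1 + p.ca4 * q.2.1 ^ 3)),
   p.ω * q.1 + μ * q.2.1 + ((p.b11 * q.1 * q.2.2.1 + p.b12 * q.1 * q.2.2.2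
      + p.b21 * q.2.1 * q.2.2.1 + p.b22 * q.2.1 * q.2.2.2)
    + (p.b1 * q.1 ^ 2 + p.b2 * q.1 * q.2.1 + p.b3 * q.2.1 ^ 2)
    + (p.cb1 * q.1 ^ 3 + p.cb2 * q.1 * q.2.1 ^ 2 + p.cb3 * q.1 ^ 2 * q.2.1 + p.cb4 * q.2.1 ^ 3)))

/-- The field is a polynomial in `v, w, |v|, |w|`, composed with a map that is Lipschitz although
not differentiable. -/
theorem locallyLipschitz_field (p : Coeffs) (μ : ℝ) : LocallyLipschitz (field p μ) := by
  have h1 : ContDiff ℝ 1 (fieldLift p μ) := by unfold fieldLift; fun_prop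
  have h2 : LipschitzWith 1 fun z : ℝ × ℝ => (z.1, z.2, |z.1|, |z.2|) := by
    refine LipschitzWith.of_dist_le_mul fun z z' => ?_
    have e1 : dist z.1 z'.1 ≤ dist z z' := le_max_left _ _
    have e2 : dist z.2 z'.2 ≤ dist z z' := le_max_right _ _
    simp only [Prod.dist_eq, NNReal.coe_one, one_mul] at e1 e2 ⊢
    refine max_le e1 (max_le e2 (max_le ?_ ?_))
    · exact (abs_abs_sub_abs_le_abs_sub _ _).trans e1
    · exact (abs_abs_sub_abs_le_abs_sub _ _).trans e2
  have h3 := h1.locallyLipschitz.comp h2.locallyLipschitz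
  have h4 : field p μ = fieldLift p μ ∘ fun z : ℝ × ℝ => (z.1, z.2, |z.1|, |z.2|) := by
    funext z
    simp only [field, nonlinV, nonlinW, fieldLift, Function.comp]
  rw [h4]
  exact h3

theorem exists_lipschitzOnWith_field (p : Coeffs) (μ R : ℝ) :
    ∃ K, LipschitzOnWith K (field p μ) (Metric.closedBall 0 R) :=
  LocallyLipschitzOn.exists_lipschitzOnWith_of_compact (isCompact_closedBall _ _)
    ((locallyLipschitzOn_univ.2 (locallyLipschitz_field p μ)).mono (subset_univ _))

theorem norm_le_radius (z : ℝ × ℝ) : ‖z‖ ≤ radius z := by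
  refine max_le ?_ ?_
  · exact Real.abs_le_sqrt (by nlinarith [sq_nonneg z.2])
  · exact Real.abs_le_sqrt (by nlinarith [sq_nonneg z.1])

theorem radius_le_two_mul_norm (z : ℝ × ℝ) : radius z ≤ 2 * ‖z‖ := by
  refine Real.sqrt_le_iff.2 ⟨by positivity, ?_⟩
  have h1 : |z.1| ≤ ‖z‖ := le_max_left _ _
  have h2 : |z.2| ≤ ‖z‖ := le_max_right _ _
  rw [← sq_abs z.1, ← sq_abs z.2]
  nlinarith [abs_nonneg z.1, abs_nonneg z.2]

/-- The polar angle of `z` in `(-π, π]`. -/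
def angle (z : ℝ × ℝ) : ℝ := Complex.arg ⟨z.1, z.2⟩

theorem eq_radius_mul_angle (z : ℝ × ℝ) :
    z = (radius z * Real.cos (angle z), radius z * Real.sin (angle z)) := by
  have h : ‖(⟨z.1, z.2⟩ : ℂ)‖ = radius z := by
    rw [Complex.norm_eq_sqrt_sq_add_sq]; rfl
  have h1 := Complex.norm_mul_cos_arg ⟨z.1, z.2⟩
  have h2 := Complex.norm_mul_sin_arg ⟨z.1, z.2⟩
  rw [h] at h1 h2
  exact Prod.ext h1.symm h2.symm

theorem ne_zero_of_radius_pos {z : ℝ × ℝ} (h : 0 < radius z) : z ≠ 0 := by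
  rintro rfl
  simp [radius] at h

end PlanarField

/-! ### Periodic orbits from closed radial trajectories, and angular lifts of planar solutions -/

section Orbits
variable {p : Coeffs} {ρ M : ℝ}

/-- The curve traced in the plane by the trajectory of the radial equation through `r`. -/
def orbitOf (p : Coeffs) (ρ μ r : ℝ) : Set (ℝ × ℝ) :=
  range fun φ => (flow p ρ μ r φ * Real.cos φ, flow p ρ μ r φ * Real.sin φ)

theorem truncSpeed_of_abs_le {s : ℝ} (hs : |s| ≤ ρ) (μ φ : ℝ) :
    truncSpeed p ρ μ φ s = s * rate p μ φ s := by
  rw [truncSpeed, clamp_of_abs_le hs]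

/-- Reparametrisation by the angle: along a planar curve with angle `θ` and radius `R > 0`. -/
theorem RateBounds.speed_mul_angular (H : RateBounds p ρ M) (μ : ℝ) {s : ℝ} (hs0 : 0 < s)
    (hs : s ≤ ρ) (φ : ℝ) :
    s * rate p μ φ s * angularSpeed p μ s φ = radialSpeed p μ s φ := by
  have hne := H.angularPoly_ne (by rwa [abs_of_pos hs0] : |s| ≤ ρ) φ
  rw [radialSpeed_eq p μ hs0.le, angularSpeed_eq p μ hs0]
  change s * rate p μ φ s * angularPoly p φ s = _
  rw [rate]
  field_simp

structure ClosedTrajectory (p : Coeffs) (ρ μ r : ℝ) : Prop where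
  pos : 0 < r
  le : r ≤ ρ / 2
  closed : flow p ρ μ r (2 * Real.pi) = r

/-- A trajectory reaching a nonpositive value would cross the zero solution, against uniqueness. -/
theorem RateBounds.flow_pos (H : RateBounds p ρ M) {μ : ℝ} (hμ : |μ| ≤ ρ) {r : ℝ} (hr : 0 < r)
    (φ : ℝ) : 0 < flow p ρ μ r φ := by
  by_contra! hle
  have hc := (H.continuous_flow hμ r).continuousOn (s := uIcc 0 φ)
  have h0 : (0 : ℝ) ∈ uIcc (flow p ρ μ r 0) (flow p ρ μ r φ) := by
    rw [H.flow_zero hμ, mem_uIcc]; right; exact ⟨hle, hr.le⟩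
  obtain ⟨ψ, -, hψ⟩ := intermediate_value_uIcc hc h0
  have := H.solution_unique hμ (H.hasDerivAt_flow hμ r) (H.hasDerivAt_flow hμ 0) (φ₀ := ψ)
    (by rw [hψ, H.flow_of_zero hμ])
  have h1 := congrFun this 0
  rw [H.flow_zero hμ, H.flow_zero hμ] at h1
  linarith

theorem RateBounds.exists_mem_flow_eq (H : RateBounds p ρ M) {μ : ℝ} (hμ : |μ| ≤ ρ) {r : ℝ}
    (h : flow p ρ μ r (2 * Real.pi) = r) (φ : ℝ) :
    ∃ ψ ∈ Icc 0 (2 * Real.pi), flow p ρ μ r φ = flow p ρ μ r ψ := by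
  obtain ⟨ψ, hψ, h2⟩ := (H.flow_periodic hμ h).exists_mem_Ico₀ (by positivity) φ
  exact ⟨ψ, ⟨hψ.1, hψ.2.le⟩, h2⟩

theorem RateBounds.closed_flow_le (H : RateBounds p ρ M) {μ : ℝ} (hμ : |μ| ≤ ρ) {r : ℝ}
    (h : ClosedTrajectory p ρ μ r) (φ : ℝ) : flow p ρ μ r φ ≤ 2 * r := by
  obtain ⟨ψ, hψ, h2⟩ := H.exists_mem_flow_eq hμ h.closed φ
  have := H.abs_flow_le hμ r hψ
  rw [abs_of_pos h.pos] at this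
  rw [h2]; exact (le_abs_self _).trans this

/-- Time is recovered as the integral of the inverse angular velocity over the angle. Inverting it
gives an angle `θ t` that advances by `2π` in a fixed time `T`, and following the radial trajectory
at `θ t` solves the planar system. -/
theorem RateBounds.isPeriodicOrbit_orbitOf (H : RateBounds p ρ M) {μ : ℝ} (hμ : |μ| ≤ ρ) {r : ℝ}
    (h : ClosedTrajectory p ρ μ r) : IsPeriodicOrbit (field p μ) (orbitOf p ρ μ r) := by
  set X := flow p ρ μ r with hX
  have hXpos : ∀ φ, 0 < X φ := H.flow_pos hμ h.pos
  have hXρ : ∀ φ, X φ ≤ ρ := fun φ => (H.closed_flow_le hμ h φ).trans (by linarith [h.le])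
  have hXabs : ∀ φ, |X φ| ≤ ρ := fun φ => by rw [abs_of_pos (hXpos φ)]; exact hXρ φ
  have hXc : Continuous X := H.continuous_flow hμ r
  have hXper : Function.Periodic X (2 * Real.pi) := H.flow_periodic hμ h.closed
  have hXd : ∀ φ, HasDerivAt X (X φ * rate p μ φ (X φ)) φ := fun φ => by
    rw [← truncSpeed_of_abs_le (hXabs φ)]; exact H.hasDerivAt_flow hμ r φ
  set Ω : ℝ → ℝ := fun φ => angularPoly p φ (X φ) with hΩ
  have hΩne : ∀ φ, Ω φ ≠ 0 := fun φ => H.angularPoly_ne (hXabs φ) φ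
  have hΩc : Continuous Ω := by
    have h3 := continuous_angularQuad p
    have h4 := continuous_angularCub p
    simp only [hΩ, angularPoly]; fun_prop
  have hΩper : Function.Periodic (fun φ => (Ω φ)⁻¹) (2 * Real.pi) := fun φ => by
    simp only [hΩ, hXper φ, periodic_angularPoly]
  have hic : Continuous fun φ => (Ω φ)⁻¹ := hΩc.inv₀ hΩne
  have hω2 := sq_pos_of_ne_zero H.ne
  set τ : ℝ → ℝ := fun φ => ∫ ψ in (0 : ℝ)..φ, (Ω ψ)⁻¹ with hτ
  have hτd : ∀ φ, HasDerivAt τ (Ω φ)⁻¹ φ := fun φ => (hic.integral_hasStrictDerivAt 0 φ).hasDerivAt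
  -- The value `2/3` is the inverse of `3/2`, since `Ω` exceeds `ω` in modulus by at most one half.
  have hlow : ∀ φ, 2 / 3 ≤ p.ω * (Ω φ)⁻¹ := by
    intro φ
    have h1 := H.le_mul_angularPoly (hXabs φ) φ
    have h2 := H.angular φ _ (hXabs φ)
    have h3 : p.ω * Ω φ ≤ 3 / 2 * p.ω ^ 2 := by
      have h4 : |p.ω * (Ω φ - p.ω)| ≤ p.ω ^ 2 / 2 := by
        rw [abs_mul, ← sq_abs p.ω]
        nlinarith [abs_nonneg p.ω]
      nlinarith [(abs_le.1 h4).2]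
    have h5 : 0 < p.ω * Ω φ := by linarith
    have h6 : p.ω * (Ω φ)⁻¹ = p.ω ^ 2 / (p.ω * Ω φ) := by
      have := hΩne φ
      have := H.ne
      field_simp
    rw [h6, le_div_iff₀ h5]
    linarith
  obtain ⟨θ, hθ1, hθ2, hθ3⟩ := exists_inverse_of_deriv_ge (by norm_num : (0 : ℝ) < 2 / 3) hτd hlow
  simp only [inv_inv] at hθ3
  set T := ∫ ψ in (0 : ℝ)..2 * Real.pi, (Ω ψ)⁻¹ with hT
  have hτT : ∀ φ, τ (φ + 2 * Real.pi) = τ φ + T := by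
    intro φ
    have h1 := intervalIntegral.integral_add_adjacent_intervals
      (hic.intervalIntegrable (μ := MeasureTheory.volume) 0 φ)
      (hic.intervalIntegrable φ (φ + 2 * Real.pi))
    have h2 := hΩper.intervalIntegral_add_eq φ 0
    rw [zero_add] at h2
    simp only [hτ, ← h1, h2, hT]
  have hθT : ∀ t, θ (t + T) = θ t + 2 * Real.pi := by
    intro t
    have := hτT (θ t)
    rw [hθ1] at this
    rw [← this, hθ2]
  have hτ0 : τ 0 = 0 := by simp [hτ]
  have hθ0 : θ 0 = 0 := by
    have := hθ2 0
    rwa [hτ0] at this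
  have hTne : T ≠ 0 := by
    intro h0
    have := hθT 0
    rw [h0, add_zero] at this
    linarith [Real.pi_pos]
  set x : ℝ → ℝ × ℝ := fun t => (X (θ t) * Real.cos (θ t), X (θ t) * Real.sin (θ t)) with hx
  have hxT : Function.Periodic x T := fun t => by
    simp only [hx, hθT, hXper (θ t), Real.cos_add_two_pi, Real.sin_add_two_pi]
  -- For `ω < 0` the angle decreases in time and `T` is negative, so the positive period is `|T|`.
  refine ⟨x, |T|, abs_pos.2 hTne, fun t _ => ?_, ?_, ⟨τ Real.pi, ?_⟩, ?_⟩
  · have hpos := hXpos (θ t)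
    have hXθ : HasDerivAt (fun t => X (θ t)) (radialSpeed p μ (X (θ t)) (θ t)) t := by
      have h1 := (hXd (θ t)).comp t (hθ3 t)
      refine h1.congr_deriv ?_
      rw [← H.speed_mul_angular μ hpos (hXρ _) (θ t), angularSpeed_eq p μ hpos]
      rfl
    have hang : angularSpeed p μ (X (θ t)) (θ t) = Ω (θ t) := angularSpeed_eq p μ hpos _
    rw [hasDerivWithinAt_univ]
    have h2 := (hXθ.mul (hθ3 t).cos).prodMk (hXθ.mul (hθ3 t).sin)
    refine h2.congr_deriv ?_
    rw [hx, field_polar p μ hpos.ne', hang]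
    refine Prod.ext ?_ ?_
    · simp only; ring
    · rfl
  · rcases abs_choice T with h1 | h1 <;> rw [h1]
    · exact hxT
    · exact hxT.neg
  · intro heq
    have h1 := congrArg Prod.fst heq
    simp only [hx, hθ2, hθ0, Real.cos_pi, Real.cos_zero] at h1
    linarith [hXpos Real.pi, hXpos 0]
  · refine Subset.antisymm ?_ ?_
    · rintro _ ⟨φ, rfl⟩
      exact ⟨τ φ, by simp only [hx, hθ2]; rfl⟩
    · rintro _ ⟨t, rfl⟩
      exact ⟨θ t, rfl⟩

/-- A trajectory of the radial equation that returns to its initial value after `k ≠ 0` turns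
closes up after one turn. -/
theorem RateBounds.closed_of_return (H : RateBounds p ρ M) {μ : ℝ} (hμ : |μ| ≤ ρ) {r : ℝ} {k : ℤ}
    (hk : k ≠ 0) (h : flow p ρ μ r (k * (2 * Real.pi)) = r) :
    flow p ρ μ r (2 * Real.pi) = r := by
  set X := flow p ρ μ r with hX
  have hX0 : X 0 = r := H.flow_zero hμ r
  have hXc : Continuous X := H.continuous_flow hμ r
  have hshift : ∀ φ, HasDerivAt (fun φ => X (φ + 2 * Real.pi))
      (truncSpeed p ρ μ φ (X (φ + 2 * Real.pi))) φ := fun φ => by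
    have := (H.hasDerivAt_flow hμ r (φ + 2 * Real.pi)).comp_add_const φ (2 * Real.pi)
    rwa [truncSpeed_add_two_pi] at this
  by_contra hne
  -- The trajectory shifted by a full turn is again a trajectory. If it does not coincide with the
  -- original, the two never meet.
  have hnz : ∀ φ, X (φ + 2 * Real.pi) - X φ ≠ 0 := by
    intro φ h0
    have := H.solution_unique hμ hshift (H.hasDerivAt_flow hμ r) (φ₀ := φ) (sub_eq_zero.1 h0)
    have h1 := congrFun this 0
    simp only [zero_add] at h1
    exact hne (h1.trans hX0)
  have hcd : Continuous fun φ => X (φ + 2 * Real.pi) - X φ := by fun_prop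
  have hsucc : ∀ n : ℤ, X ((n + 1 : ℤ) * (2 * Real.pi)) = X (n * (2 * Real.pi) + 2 * Real.pi) := by
    intro n; congr 1; push_cast; ring
  -- The displacement over one turn keeps its sign, so the radii after successive turns form a
  -- strictly monotone sequence and cannot return to the initial one.
  have hinj : Function.Injective fun n : ℤ => X (n * (2 * Real.pi)) := by
    rcases lt_or_gt_of_ne (hnz 0) with h0 | h0
    · refine (strictAnti_int_of_succ_lt fun n => ?_).injective
      rw [hsucc]
      by_contra! hge
      obtain ⟨ψ, -, hψ⟩ := intermediate_value_uIcc (a := 0) (b := n * (2 * Real.pi))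
        hcd.continuousOn (show (0 : ℝ) ∈ _ from mem_uIcc.2 (Or.inl ⟨h0.le, sub_nonneg.2 hge⟩))
      exact hnz ψ hψ
    · refine (strictMono_int_of_lt_succ fun n => ?_).injective
      rw [hsucc]
      by_contra! hge
      obtain ⟨ψ, -, hψ⟩ := intermediate_value_uIcc (a := 0) (b := n * (2 * Real.pi))
        hcd.continuousOn (show (0 : ℝ) ∈ _ from mem_uIcc.2 (Or.inr ⟨sub_nonpos.2 hge, h0.le⟩))
      exact hnz ψ hψ
  refine hk (hinj ?_)
  simp only [Int.cast_zero, zero_mul, hX0, h]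

/-- Radius and angle along a planar solution that stays in the punctured ball of radius `ρ`. -/
theorem RateBounds.exists_lift (H : RateBounds p ρ M) (μ : ℝ) {I : Set ℝ} (hI : Convex ℝ I)
    (h0 : 0 ∈ I) {x : ℝ → ℝ × ℝ} (hx : IsSolutionOn (field p μ) x I)
    (hpos : ∀ t ∈ I, 0 < radius (x t)) (hρ : ∀ t ∈ I, radius (x t) ≤ ρ) {ψ : ℝ → ℝ}
    (hψc : Continuous ψ) (hψ : ∀ t ∈ I, ψ t * radius (x t) ^ 2
      = (x t).1 * (field p μ (x t)).2 - (x t).2 * (field p μ (x t)).1) :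
    ∃ θ : ℝ → ℝ, (∀ t ∈ I, x t = (radius (x t) * Real.cos (θ t), radius (x t) * Real.sin (θ t))) ∧
      (∀ t ∈ I, HasDerivAt θ (angularSpeed p μ (radius (x t)) (θ t)) t) ∧
      (∀ t ∈ I, p.ω ^ 2 / 2 ≤ p.ω * angularSpeed p μ (radius (x t)) (θ t)) ∧
      ∀ t ∈ I, HasDerivWithinAt (fun t => radius (x t))
        (radialSpeed p μ (radius (x t)) (θ t)) I t := by
  obtain ⟨θ, -, hθ, hxθ⟩ := exists_polar_lift hI h0 hx
    (fun t ht => ne_zero_of_radius_pos (hpos t ht)) hψc hψ (eq_radius_mul_angle (x 0))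
  have hfield : ∀ t ∈ I, field p μ (x t)
      = (radialSpeed p μ (radius (x t)) (θ t) * Real.cos (θ t)
          - radius (x t) * (Real.sin (θ t) * angularSpeed p μ (radius (x t)) (θ t)),
        radialSpeed p μ (radius (x t)) (θ t) * Real.sin (θ t)
          + radius (x t) * (Real.cos (θ t) * angularSpeed p μ (radius (x t)) (θ t))) :=
    fun t ht => by rw [← field_polar p μ (hpos t ht).ne' (θ t), ← hxθ t ht]
  have hψeq : ∀ t ∈ I, ψ t = angularSpeed p μ (radius (x t)) (θ t) := by
    intro t ht
    have h1 := hψ t ht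
    have hr := hpos t ht
    have e1 : (x t).1 = radius (x t) * Real.cos (θ t) := congrArg Prod.fst (hxθ t ht)
    have e2 : (x t).2 = radius (x t) * Real.sin (θ t) := congrArg Prod.snd (hxθ t ht)
    rw [hfield t ht, e1, e2] at h1
    have h3 : ψ t * radius (x t) ^ 2
        = angularSpeed p μ (radius (x t)) (θ t) * radius (x t) ^ 2 := by
      linear_combination h1 + radius (x t) ^ 2 * angularSpeed p μ (radius (x t)) (θ t)
        * Real.cos_sq_add_sin_sq (θ t)
    exact mul_right_cancel₀ (pow_ne_zero 2 hr.ne') h3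
  refine ⟨θ, hxθ, fun t ht => by rw [← hψeq t ht]; exact hθ t, fun t ht => ?_, fun t ht => ?_⟩
  · rw [angularSpeed_eq p μ (hpos t ht)]
    exact H.le_mul_angularPoly (by rw [abs_of_pos (hpos t ht)]; exact hρ t ht) (θ t)
  · have hr := hpos t ht
    refine (hasDerivWithinAt_radius (hx t ht) (ne_zero_of_radius_pos hr)).congr_deriv ?_
    have e1 : (x t).1 = radius (x t) * Real.cos (θ t) := congrArg Prod.fst (hxθ t ht)
    have e2 : (x t).2 = radius (x t) * Real.sin (θ t) := congrArg Prod.snd (hxθ t ht)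
    rw [div_eq_iff hr.ne', hfield t ht, e1, e2]
    linear_combination radius (x t) * radialSpeed p μ (radius (x t)) (θ t)
        * Real.cos_sq_add_sin_sq (θ t)

end Orbits

/-! ### One-to-one correspondence of equilibria and periodic orbits -/

section Correspondence
variable {p : Coeffs} {ρ M : ℝ}

/-- The origin is an equilibrium of a field that is Lipschitz on balls, so a bounded solution that
reaches it is constant. -/
theorem radius_pos_of_periodic (p : Coeffs) (μ R : ℝ) {x : ℝ → ℝ × ℝ}
    (hx : IsSolutionOn (field p μ) x univ) (hR : ∀ t, radius (x t) ≤ R) (hne : ∃ t, x t ≠ x 0)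
    (t : ℝ) : 0 < radius (x t) := by
  obtain ⟨K, hK⟩ := exists_lipschitzOnWith_field p μ R
  by_contra! h
  have h0 : x t = 0 := by
    by_contra h1
    exact (radius_pos h1).not_ge h
  have hR0 : 0 ≤ R := (radius_nonneg _).trans (hR 0)
  have h2 : x = fun _ => 0 := ODE_solution_unique_univ (v := fun _ => field p μ)
    (s := fun _ => Metric.closedBall 0 R) (K := K) (t₀ := t) (fun _ => hK)
    (fun t => ⟨hasDerivWithinAt_univ.1 (hx t (mem_univ t)), by
      rw [mem_closedBall_zero_iff]; exact (norm_le_radius _).trans (hR t)⟩)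
    (fun t => ⟨by rw [field_zero]; exact hasDerivAt_const t 0, by
      rw [mem_closedBall_zero_iff, norm_zero]; exact hR0⟩) h0
  obtain ⟨s, hs⟩ := hne
  exact hs (by rw [h2])

/-- The disc of radius `2 * δ` without the ray `v ≥ δ`, `w = 0`. -/
def slitDisc (δ : ℝ) : Set (ℝ × ℝ) := {z | radius z < 2 * δ ∧ ¬ (z.2 = 0 ∧ δ ≤ z.1)}

theorem isOpen_slitDisc (δ : ℝ) : IsOpen (slitDisc δ) := by
  have h : IsClosed {z : ℝ × ℝ | z.2 = 0 ∧ δ ≤ z.1} :=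
    (isClosed_eq continuous_snd continuous_const).inter
      (isClosed_le continuous_const continuous_fst)
  exact (isOpen_lt continuous_radius continuous_const).inter h.isOpen_compl

theorem zero_mem_slitDisc {δ : ℝ} (hδ : 0 < δ) : (0 : ℝ × ℝ) ∈ slitDisc δ :=
  ⟨by simpa [radius] using hδ, fun h => hδ.not_ge h.2⟩

/-- The angle along the solution is strictly monotone and onto `ℝ`, and the radius as a function of
it is a radial trajectory. At angle `0` the orbit meets the positive `v`-axis. There the slit forces
the radius to be below `δ`, which membership in a round disc would not give sharply. -/
theorem RateBounds.exists_orbitOf_eq (H : RateBounds p ρ M) {μ : ℝ} (hμ : |μ| ≤ ρ) {δ : ℝ}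
    (hδ : 2 * δ ≤ ρ) {γ : Set (ℝ × ℝ)} (hγ : IsPeriodicOrbit (field p μ) γ)
    (hU : γ ⊆ slitDisc δ) :
    ∃ r, 0 < r ∧ r < δ ∧ flow p ρ μ r (2 * Real.pi) = r ∧ orbitOf p ρ μ r = γ := by
  obtain ⟨x, T, hT, hx, hper, hne, rfl⟩ := hγ
  have hrad : ∀ t, radius (x t) ≤ ρ := fun t => (hU ⟨t, rfl⟩).1.le.trans hδ
  have hpos := radius_pos_of_periodic p μ ρ hx hrad hne
  have hxc : Continuous x := continuousOn_univ.1 hx.continuousOn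
  have hfc : Continuous fun t => field p μ (x t) := (continuous_field p μ).comp hxc
  have hrc : Continuous fun t => radius (x t) := continuous_radius.comp hxc
  obtain ⟨θ, h1, h2, h3, h4⟩ := H.exists_lift μ convex_univ (mem_univ 0) hx (fun t _ => hpos t)
    (fun t _ => hrad t)
    (ψ := fun t => ((x t).1 * (field p μ (x t)).2 - (x t).2 * (field p μ (x t)).1)
      / radius (x t) ^ 2)
    (Continuous.div ((hxc.fst.mul hfc.snd).sub (hxc.snd.mul hfc.fst)) (hrc.pow 2) fun t => (pow_pos (hpos t) 2).ne')
    (fun t _ => div_mul_cancel₀ _ (pow_pos (hpos t) 2).ne')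
  replace h1 := fun t => h1 t (mem_univ t)
  replace h2 := fun t => h2 t (mem_univ t)
  replace h3 := fun t => h3 t (mem_univ t)
  replace h4 := fun t => hasDerivWithinAt_univ.1 (h4 t (mem_univ t))
  have hω2 : 0 < p.ω ^ 2 / 2 := by have := sq_pos_of_ne_zero H.ne; positivity
  obtain ⟨τ, hτ1, hτ2, hτ3⟩ := exists_inverse_of_deriv_ge hω2 h2 h3
  set s : ℝ → ℝ := fun φ => radius (x (τ φ)) with hs
  have hsd : ∀ φ, HasDerivAt s (truncSpeed p ρ μ φ (s φ)) φ := by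
    intro φ
    have h5 := (h4 (τ φ)).comp φ (hτ3 φ)
    have h6 := hpos (τ φ)
    refine h5.congr_deriv ?_
    have hane : angularSpeed p μ (radius (x (τ φ))) (θ (τ φ)) ≠ 0 := fun h0 => by
      have := h3 (τ φ)
      rw [h0, mul_zero] at this
      linarith
    rw [truncSpeed_of_abs_le (by rw [abs_of_pos h6]; exact hrad _),
      ← H.speed_mul_angular μ h6 (hrad _), mul_inv_cancel_right₀ hane, hτ1]
  set r := s 0 with hr
  have hsflow : s = flow p ρ μ r :=
    H.solution_unique hμ hsd (H.hasDerivAt_flow hμ r) (φ₀ := 0) (by rw [H.flow_zero hμ])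
  have hxτ : ∀ φ, x (τ φ) = (s φ * Real.cos φ, s φ * Real.sin φ) := fun φ => by
    conv_lhs => rw [h1 (τ φ), hτ1]
  have hx0 : x (τ 0) = (r, 0) := by rw [hxτ]; simp [hr]
  refine ⟨r, hpos _, ?_, ?_, ?_⟩
  · by_contra! hle
    have := (hU ⟨τ 0, rfl⟩).2
    rw [hx0] at this
    exact this ⟨rfl, hle⟩
  · have h7 : x (τ 0 + T) = (r, 0) := by rw [hper, hx0]
    have h8 : radius (x (τ 0 + T)) = r := by rw [hper]
    have h9 := h1 (τ 0 + T)
    rw [h8, h7] at h9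
    have h10 : r = r * Real.cos (θ (τ 0 + T)) := congrArg Prod.fst h9
    have hcos : Real.cos (θ (τ 0 + T)) = 1 :=
      mul_left_cancel₀ (hpos (τ 0)).ne' (h10.symm.trans (mul_one r).symm)
    obtain ⟨n, hn⟩ := (Real.cos_eq_one_iff _).1 hcos
    -- The period `T` corresponds to `n` turns, with `n ≠ 0` because the angle is injective in time
    -- and `T > 0`.
    refine H.closed_of_return hμ (k := n) ?_ ?_
    · rintro rfl
      have h11 := hτ2 (τ 0 + T)
      rw [← hn] at h11
      simp only [Int.cast_zero, zero_mul] at h11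
      linarith
    · rw [← hsflow, hn]
      simp only [hs, hτ2, h8]
  · rw [orbitOf, ← hsflow]
    refine Subset.antisymm ?_ ?_
    · rintro _ ⟨φ, rfl⟩
      exact ⟨τ φ, hxτ φ⟩
    · rintro _ ⟨t, rfl⟩
      refine ⟨θ t, ?_⟩
      simp only [← hxτ, hτ2]

theorem RateBounds.flow_two_pi_eq_iff (H : RateBounds p ρ M) {μ : ℝ} (hμ : |μ| ≤ ρ) {r : ℝ}
    (hr0 : 0 < r) (hr : r ≤ ρ / 2) :
    flow p ρ μ r (2 * Real.pi) = r ↔ logGrowth p ρ μ r = 0 := by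
  rw [H.flow_two_pi hμ (by rwa [abs_of_pos hr0]), mul_eq_left₀ hr0.ne', Real.exp_eq_one_iff]

theorem one_sub_avgQuad_pos {δ r : ℝ} (hδ : Real.pi * |avgQuad p| * δ ≤ 1 / 2) (hr0 : 0 ≤ r)
    (hr : r ≤ δ) : 1 / 2 ≤ 1 - Real.pi * avgQuad p * r := by
  have h1 : Real.pi * avgQuad p * r ≤ Real.pi * |avgQuad p| * δ := by
    have := le_abs_self (avgQuad p)
    have := abs_nonneg (avgQuad p)
    have := Real.pi_pos
    gcongr
  linarith

theorem avgField_eq_zero_iff {μ δ r : ℝ} (hδ : Real.pi * |avgQuad p| * δ ≤ 1 / 2) (hr0 : 0 < r)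
    (hr : r ≤ δ) : avgField p ρ μ r = 0 ↔ logGrowth p ρ μ r = 0 := by
  have h1 := one_sub_avgQuad_pos (p := p) hδ hr0.le hr
  have h2 := Real.pi_pos
  rw [avgField, mul_eq_zero, mul_eq_zero, div_eq_zero_iff]
  constructor
  · rintro ((h | h) | h | h) <;> first | exact h | (exfalso; linarith)
  · exact fun h => Or.inr (Or.inl h)

/-- A closed trajectory meets the ray `v > 0`, `w = 0` only in its initial point. -/
theorem RateBounds.flow_eq_of_mem_ray (H : RateBounds p ρ M) {μ : ℝ} (hμ : |μ| ≤ ρ) {r φ : ℝ}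
    (h : ClosedTrajectory p ρ μ r) (h1 : flow p ρ μ r φ * Real.sin φ = 0)
    (h2 : 0 < flow p ρ μ r φ * Real.cos φ) : flow p ρ μ r φ = r ∧ Real.cos φ = 1 := by
  have hpos := H.flow_pos hμ h.pos φ
  have hs : Real.sin φ = 0 := (mul_eq_zero.1 h1).resolve_left hpos.ne'
  have hc : 0 < Real.cos φ := pos_of_mul_pos_right h2 hpos.le
  have hc1 : Real.cos φ = 1 := by
    have := Real.sin_sq_add_cos_sq φ
    rw [hs] at this
    nlinarith
  obtain ⟨n, hn⟩ := (Real.cos_eq_one_iff φ).1 hc1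
  have h3 := (H.flow_periodic hμ h.closed).int_mul n 0
  rw [zero_add, hn, H.flow_zero hμ] at h3
  exact ⟨h3, hc1⟩

/-- The radius at most doubles along the orbit, whence the disc of radius `2 δ`. The orbit meets the
positive `v`-axis only at `(r, 0)`, which lies off the removed ray. -/
theorem RateBounds.orbitOf_subset_slitDisc (H : RateBounds p ρ M) {μ : ℝ} (hμ : |μ| ≤ ρ)
    {r δ : ℝ} (h : ClosedTrajectory p ρ μ r) (hr : r < δ) : orbitOf p ρ μ r ⊆ slitDisc δ := by
  rintro _ ⟨φ, rfl⟩
  have hpos := H.flow_pos hμ h.pos φ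
  refine ⟨?_, ?_⟩
  · rw [radius_polar hpos.le]
    linarith [H.closed_flow_le hμ h φ]
  · rintro ⟨h1, h2⟩
    obtain ⟨h3, hc1⟩ := H.flow_eq_of_mem_ray hμ h h1 ((h.pos.trans hr).trans_le h2)
    simp only [h3, hc1, mul_one] at h2
    linarith

theorem RateBounds.eq_of_mem_orbitOf (H : RateBounds p ρ M) {μ : ℝ} (hμ : |μ| ≤ ρ) {r v : ℝ}
    (h : ClosedTrajectory p ρ μ r) (hv : 0 < v) (hz : (v, 0) ∈ orbitOf p ρ μ r) : v = r := by
  obtain ⟨φ, hφ⟩ := hz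
  have h1 : flow p ρ μ r φ * Real.cos φ = v := congrArg Prod.fst hφ
  have h2 : flow p ρ μ r φ * Real.sin φ = 0 := congrArg Prod.snd hφ
  obtain ⟨h3, hc1⟩ := H.flow_eq_of_mem_ray hμ h h2 (h1 ▸ hv)
  rw [← h1, hc1, h3, mul_one]

theorem RateBounds.mem_orbitOf (H : RateBounds p ρ M) {μ : ℝ} (hμ : |μ| ≤ ρ) (r : ℝ) :
    (r, 0) ∈ orbitOf p ρ μ r := ⟨0, by simp [H.flow_zero hμ]⟩

theorem RateBounds.closedTrajectory_of_equilibrium (H : RateBounds p ρ M) {μ δ r : ℝ}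
    (hμ : |μ| ≤ ρ) (hδ : 2 * δ ≤ ρ) (hδ' : Real.pi * |avgQuad p| * δ ≤ 1 / 2)
    (h : r ∈ equilibria (avgField p ρ μ) δ) : ClosedTrajectory p ρ μ r := by
  have hr : r ≤ ρ / 2 := by linarith [h.1.2]
  exact ⟨h.1.1, hr, (H.flow_two_pi_eq_iff hμ h.1.1 hr).2
    ((avgField_eq_zero_iff hδ' h.1.1 h.1.2.le).1 h.2)⟩

/-- Injectivity holds because the orbit determines its single intersection with the positive
`v`-axis. Nothing is required of `μ` beyond smallness, so the correspondence survives degenerate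
coefficients. -/
theorem RateBounds.bijOn_orbitOf (H : RateBounds p ρ M) {μ δ : ℝ} (hμ : |μ| ≤ ρ)
    (hδ : 2 * δ ≤ ρ) (hδ' : Real.pi * |avgQuad p| * δ ≤ 1 / 2) :
    BijOn (orbitOf p ρ μ) (equilibria (avgField p ρ μ) δ)
      (periodicOrbits (field p μ) (slitDisc δ)) := by
  refine ⟨fun r hr => ?_, fun r hr r' hr' heq => ?_, ?_⟩
  · have h := H.closedTrajectory_of_equilibrium hμ hδ hδ' hr
    exact ⟨H.isPeriodicOrbit_orbitOf hμ h, H.orbitOf_subset_slitDisc hμ h hr.1.2⟩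
  · refine H.eq_of_mem_orbitOf hμ (H.closedTrajectory_of_equilibrium hμ hδ hδ' hr') hr.1.1 ?_
    rw [← heq]
    exact H.mem_orbitOf hμ r
  · rintro γ ⟨hγ, hU⟩
    obtain ⟨r, hr0, hr, hc, rfl⟩ := H.exists_orbitOf_eq hμ hδ hγ hU
    refine ⟨r, ⟨⟨hr0, hr⟩, ?_⟩, rfl⟩
    rw [avgField_eq_zero_iff hδ' hr0 hr.le, ← H.flow_two_pi_eq_iff hμ hr0 (by linarith)]
    exact hc

/-- On a closed trajectory the growth vanishes at `r`, while at `0` it is `2π μ/ω`. The Lipschitz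
bound between these two points controls `|μ|` by `r`. -/
theorem RateBounds.abs_le_of_closed (H : RateBounds p ρ M) {μ r : ℝ} (hμ : |μ| ≤ ρ)
    (h : ClosedTrajectory p ρ μ r) : |μ| ≤ |p.ω| * (2 * M * Real.exp (2 * Real.pi)) * r := by
  have h1 := H.logGrowth_lip hμ hμ r 0
  rw [(H.flow_two_pi_eq_iff hμ h.pos h.le).1 h.closed, H.logGrowth_zero hμ, zero_sub, abs_neg,
    sub_self, abs_zero, zero_add, sub_zero, abs_of_pos h.pos, abs_mul,
    abs_of_pos Real.two_pi_pos, abs_div, mul_comm (2 * Real.pi)] at h1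
  have h2 := le_of_mul_le_mul_right h1 Real.two_pi_pos
  rw [div_le_iff₀ (abs_pos.2 H.ne)] at h2
  linarith

/-- Over a turn the radius moves by `O(r (|μ| + r))`. On closed trajectories `|μ| = O(r)`, which
makes this `O(r²)`. -/
theorem RateBounds.abs_radius_sub_le (H : RateBounds p ρ M) {μ r : ℝ} (hμ : |μ| ≤ ρ)
    (h : ClosedTrajectory p ρ μ r) {z : ℝ × ℝ} (hz : z ∈ orbitOf p ρ μ r) :
    |radius z - r|
      ≤ 8 * Real.pi * M * (|p.ω| * (2 * M * Real.exp (2 * Real.pi)) + 1) * r ^ 2 := by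
  obtain ⟨φ, rfl⟩ := hz
  simp only [radius_polar (H.flow_pos hμ h.pos φ).le]
  obtain ⟨ψ, hψ, h2⟩ := H.exists_mem_flow_eq hμ h.closed φ
  rw [h2]
  have h3 := H.abs_flow_sub_le hμ (r := r) (by rw [abs_of_pos h.pos]; exact h.le) hψ
  rw [abs_of_pos h.pos] at h3
  have h4 := H.abs_le_of_closed hμ h
  have hM : 0 ≤ M := zero_le_one.trans H.one_le
  have hr := h.pos.le
  calc _ ≤ _ := h3
    _ ≤ 8 * Real.pi * M * (r * (|p.ω| * (2 * M * Real.exp (2 * Real.pi)) * r + r)) := by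
      have := Real.pi_pos
      gcongr
    _ = _ := by ring

end Correspondence

/-! ### Solutions of truncated autonomous fields -/

/-- Solutions of a vector field that is truncated outside of a compact set `S` with a
nonexpansive retraction `π`. -/
theorem exists_truncated_solution {E : Type*} [NormedAddCommGroup E] [NormedSpace ℝ E]
    [CompleteSpace E] {X π : E → E} {S : Set E} {K : ℝ≥0} (hS : IsCompact S)
    (hX : LipschitzOnWith K X S) (hπ : LipschitzWith 1 π) (hπS : ∀ z, π z ∈ S)
    (hπ' : ∀ z ∈ S, π z = z) (z₀ : E) :
    ∃ x : ℝ → E, x 0 = z₀ ∧ Continuous x ∧ ∀ t, x t ∈ S → HasDerivAt x (X (x t)) t := by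
  obtain ⟨L, hL⟩ := hS.exists_bound_of_continuousOn hX.continuousOn
  have hlip : LipschitzWith (K * 1) fun z => X (π z) := by
    rw [← lipschitzOnWith_univ]
    exact hX.comp (lipschitzOnWith_univ.2 hπ) fun z _ => hπS z
  obtain ⟨x, hx0, hx⟩ := exists_global_solution (f := fun _ z => X (π z)) (K := K * 1)
    (L := L.toNNReal) (fun _ => hlip) (fun _ => continuous_const)
    (fun _ z => (hL _ (hπS z)).trans (Real.le_coe_toNNReal L)) z₀
  refine ⟨x, hx0, continuous_iff_continuousAt.2 fun t => (hx t).continuousAt, fun t ht => ?_⟩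
  have := hx t
  rwa [hπ' _ ht] at this

/-- Provides globally defined curves that solve the planar system while they stay in a ball, as the
instability criterion requires. Clamping both coordinates is a nonexpansive retraction onto the ball
of the sup norm. -/
theorem exists_truncated_field_solution (p : Coeffs) (μ : ℝ) {R : ℝ} (hR : 0 ≤ R) (z₀ : ℝ × ℝ) :
    ∃ x : ℝ → ℝ × ℝ, x 0 = z₀ ∧ Continuous x ∧
      ∀ t, ‖x t‖ ≤ R → HasDerivAt x (field p μ (x t)) t := by
  obtain ⟨K, hK⟩ := exists_lipschitzOnWith_field p μ R
  have h := exists_truncated_solution (π := fun z => (clamp R z.1, clamp R z.2))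
    (isCompact_closedBall (0 : ℝ × ℝ) R) hK
    (LipschitzWith.of_dist_le_mul fun z z' => by
      rw [NNReal.coe_one, one_mul]
      exact max_le_max (abs_clamp_sub_le _ _ _) (abs_clamp_sub_le _ _ _))
    (fun z => by
      rw [mem_closedBall_zero_iff]
      exact max_le (abs_clamp_le hR _) (abs_clamp_le hR _))
    (fun z hz => by
      rw [mem_closedBall_zero_iff] at hz
      exact Prod.ext (clamp_of_abs_le ((le_max_left _ _).trans hz))
        (clamp_of_abs_le ((le_max_right _ _).trans hz))) z₀
  simpa only [mem_closedBall_zero_iff] using h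

/-! ### Stability of the equilibrium at the origin -/

section Origin
variable {p : Coeffs} {ρ M : ℝ}

/-- The rotation drops out of the radial component, and the linear part contributes exactly `μ r²`.
The rest is of order `r³`. -/
theorem RateBounds.abs_radial_sub_le (H : RateBounds p ρ M) (μ : ℝ) {z : ℝ × ℝ}
    (hz : radius z ≤ 1) :
    |z.1 * (field p μ z).1 + z.2 * (field p μ z).2 - μ * radius z ^ 2|
      ≤ 2 * M * radius z * radius z ^ 2 := by
  obtain ⟨θ, hθ⟩ : ∃ θ, z = (radius z * Real.cos θ, radius z * Real.sin θ) :=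
    ⟨angle z, eq_radius_mul_angle z⟩
  have hr := radius_nonneg z
  set r := radius z with hrz
  have h1 := radialSpeed_eq p μ hr θ
  rw [radialSpeed, ← hθ] at h1
  have e1 : z.1 = r * Real.cos θ := congrArg Prod.fst hθ
  have e2 : z.2 = r * Real.sin θ := congrArg Prod.snd hθ
  have h2 : z.1 * (field p μ z).1 + z.2 * (field p μ z).2 - μ * r ^ 2
      = r ^ 3 * (radialQuad p θ + r * radialCub p θ) := by
    linear_combination (field p μ z).1 * e1 + (field p μ z).2 * e2 + r * h1
  rw [h2, abs_mul, abs_of_nonneg (pow_nonneg hr 3)]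
  have h3 : |radialQuad p θ + r * radialCub p θ| ≤ 2 * M := by
    have h4 : |r * radialCub p θ| ≤ 1 * M := by
      rw [abs_mul, abs_of_nonneg hr]
      exact mul_le_mul hz (H.bound_radialCub θ) (abs_nonneg _) zero_le_one
    calc _ ≤ _ := abs_add_le _ _
      _ ≤ M + 1 * M := add_le_add (H.bound_radialQuad θ) h4
      _ = 2 * M := by ring
  calc r ^ 3 * |radialQuad p θ + r * radialCub p θ| ≤ r ^ 3 * (2 * M) := by gcongr
    _ = _ := by ring

theorem hasDerivAt_radius_sq {x : ℝ → ℝ × ℝ} {x' : ℝ × ℝ} {t : ℝ} (h : HasDerivAt x x' t) :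
    HasDerivAt (fun t => radius (x t) ^ 2) (2 * ((x t).1 * x'.1 + (x t).2 * x'.2)) t := by
  simp only [radius_sq]
  have h1 : HasDerivAt (fun t => (x t).1) x'.1 t :=
    hasDerivWithinAt_univ.1 (hasDerivWithinAt_fst h.hasDerivWithinAt)
  have h2 : HasDerivAt (fun t => (x t).2) x'.2 t :=
    hasDerivWithinAt_univ.1 (hasDerivWithinAt_snd h.hasDerivWithinAt)
  refine ((h1.pow 2).add (h2.pow 2)).congr_deriv ?_
  push_cast
  ring

/-- The square of the radius grows or decays at a rate close to `2 * μ` near the origin. -/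
theorem RateBounds.exists_radial_rate (H : RateBounds p ρ M) {μ : ℝ} (hμ : μ ≠ 0) :
    ∃ ε₀ > 0, ∀ z : ℝ × ℝ, Metric.infDist z {0} < ε₀ →
      |2 * (z.1 * (field p μ z).1 + z.2 * (field p μ z).2) - 2 * μ * radius z ^ 2|
        ≤ |μ| * radius z ^ 2 := by
  have hM : 0 < M := zero_lt_one.trans_le H.one_le
  have hμ' := abs_pos.2 hμ
  -- The Euclidean radius is at most twice the sup norm. So `1/2` keeps it below `1`, and `|μ| / (8
  -- M)` makes `4 M` times the radius at most `|μ|`.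
  refine ⟨min (1 / 2) (|μ| / (8 * M)), by positivity, fun z hz => ?_⟩
  rw [Metric.infDist_singleton, dist_zero_right, lt_min_iff] at hz
  have hz2 := hz.2
  rw [lt_div_iff₀ (by positivity)] at hz2
  have h1 := radius_le_two_mul_norm z
  have h2 := H.abs_radial_sub_le μ (z := z) (by linarith [hz.1])
  have h3 : 4 * M * radius z ≤ |μ| := by nlinarith
  rw [mul_assoc 2 μ, ← mul_sub, abs_mul, abs_two]
  calc _ ≤ 2 * (2 * M * radius z * radius z ^ 2) := by gcongr
    _ = (4 * M * radius z) * radius z ^ 2 := by ring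
    _ ≤ _ := by gcongr

theorem RateBounds.asymptoticallyStable_origin (H : RateBounds p ρ M) {μ : ℝ} (hμ : μ < 0) :
    AsymptoticallyStable (field p μ) {0} := by
  obtain ⟨ε₀, hε₀, h⟩ := H.exists_radial_rate hμ.ne
  refine asymptoticallyStable_of_decay (V := fun z => radius z ^ 2) hε₀ (neg_pos.2 hμ)
    (fun z => sq_nonneg _) (fun ε hε => ?_) (fun ε hε => ⟨ε ^ 2, by positivity, fun z _ hz => ?_⟩)
    fun x T hx hxe => ?_
  · have hc : Continuous fun z => radius z ^ 2 := continuous_radius.pow 2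
    have h0 : radius (0 : ℝ × ℝ) ^ 2 < ε := by simpa [radius] using hε
    obtain ⟨η, hη, hball⟩ := Metric.mem_nhds_iff.1 ((hc.tendsto 0).eventually_lt_const h0)
    refine ⟨η, hη, fun z hz => hball ?_⟩
    rwa [Metric.infDist_singleton] at hz
  · rw [Metric.infDist_singleton, dist_zero_right]
    exact (norm_le_radius z).trans_lt (lt_of_pow_lt_pow_left₀ 2 hε.le hz)
  · refine le_mul_exp_of_deriv_le (u := fun t => radius (x t) ^ 2) ((continuous_radius.pow 2).comp_continuousOn hx.continuousOn)
      (fun t ht => hasDerivAt_radius_sq (hx.hasDerivAt ht)) fun t ht => ?_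
    have h1 := (abs_le.1 (h (x t) (hxe t ⟨ht.1.le, ht.2⟩))).2
    rw [abs_of_neg hμ] at h1
    linarith

theorem RateBounds.not_lyapunovStable_origin (H : RateBounds p ρ M) {μ : ℝ} (hμ : 0 < μ) :
    ¬ LyapunovStable (field p μ) {0} := by
  obtain ⟨ε₀, hε₀, h⟩ := H.exists_radial_rate hμ.ne'
  refine not_lyapunovStable_of_growth (V := fun z => radius z ^ 2) (B := (2 * ε₀) ^ 2) hε₀ hμ
    (fun z₀ => ?_) (fun η hη => ⟨(η / 2, 0), ?_, ?_⟩) (fun z hz => ?_) fun x T hx hxe => ?_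
  · obtain ⟨x, hx0, hxc, hx⟩ := exists_truncated_field_solution p μ hε₀.le z₀
    refine ⟨x, hx0, hxc, fun T hT t ht => (hx t ?_).hasDerivWithinAt⟩
    have := hT t ht
    rw [Metric.infDist_singleton, dist_zero_right] at this
    exact this.le
  · rw [Metric.infDist_singleton, dist_zero_right, Prod.norm_mk, norm_zero, Real.norm_eq_abs,
      abs_of_pos (half_pos hη), max_eq_left (half_pos hη).le]
    linarith
  · rw [radius_sq]; positivity
  · rw [Metric.infDist_singleton, dist_zero_right] at hz
    have := radius_le_two_mul_norm z
    exact pow_le_pow_left₀ (radius_nonneg z) (by linarith) 2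
  · refine mul_exp_le_of_le_deriv (u := fun t => radius (x t) ^ 2) ((continuous_radius.pow 2).comp_continuousOn hx.continuousOn)
      (fun t ht => hasDerivAt_radius_sq (hx.hasDerivAt ht)) fun t ht => ?_
    have h1 := (abs_le.1 (h (x t) (hxe t ⟨ht.1.le, ht.2⟩))).1
    rw [abs_of_pos hμ] at h1
    linarith

end Origin

/-! ### Existence, uniqueness and asymptotics of the equilibrium when `σ# ≠ 0` -/

/-- A range `|μ| ≤ δ`, `0 ≤ r ≤ δ` where `avgQuad p ≠ 0` dominates the derivative of the
logarithmic growth. -/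
structure TransversalRange (p : Coeffs) (ρ M δ : ℝ) : Prop where
  bounds : RateBounds p ρ M
  pos : 0 < δ
  lt : 2 * δ < ρ
  ne : avgQuad p ≠ 0
  avg : Real.pi * |avgQuad p| * δ ≤ 1 / 2
  deriv : ∀ μ r, |μ| ≤ δ → |r| ≤ δ →
    |logGrowthDeriv p ρ μ r - 2 * Real.pi * avgQuad p| ≤ Real.pi * |avgQuad p|

section Equilibrium
variable {p : Coeffs} {ρ M δ : ℝ}

theorem RateBounds.exists_transversalRange (H : RateBounds p ρ M) (hne : avgQuad p ≠ 0) :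
    ∃ δ₀ > 0, ∀ δ, 0 < δ → δ ≤ δ₀ → TransversalRange p ρ M δ := by
  obtain ⟨C, hC0, hC⟩ := H.exists_logGrowthDeriv_expand
  have hc := abs_pos.2 hne
  have hπ := Real.pi_pos
  have hρ := H.ρ_pos
  set D := |4 * Real.pi * avgCub p + (2 * Real.pi * avgQuad p) ^ 2| with hD
  have hD0 : 0 ≤ D := abs_nonneg _
  -- The three bounds serve the fields `lt`, `avg` and `deriv` in turn. For the last one, the
  -- deviation of the derivative from `2π c` is at most `δ (D + 2 C) ≤ π |c|`.
  refine ⟨min (ρ / 4) (min (1 / (2 * (Real.pi * |avgQuad p|)))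
    (Real.pi * |avgQuad p| / (D + 2 * C + 1))), by positivity, fun δ h0 h => ?_⟩
  rw [le_min_iff, le_min_iff, le_div_iff₀ (by positivity), le_div_iff₀ (by positivity)] at h
  have hδ1 : δ ≤ 1 := by linarith [H.ρ_le]
  refine ⟨H, h0, by linarith, hne, by linarith [h.2.1], fun μ r hμ hr => ?_⟩
  have h1 := hC μ r (by linarith) (by linarith)
  have h2 : r ^ 2 ≤ δ := by rw [← sq_abs]; nlinarith [abs_nonneg r]
  have h3 : |r * (4 * Real.pi * avgCub p + (2 * Real.pi * avgQuad p) ^ 2)| ≤ δ * D := by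
    rw [abs_mul]; exact mul_le_mul_of_nonneg_right hr (abs_nonneg _)
  have h4 : C * (r ^ 2 + |μ|) ≤ C * (δ + δ) := by gcongr
  have h5 := abs_add_le (logGrowthDeriv p ρ μ r - (2 * Real.pi * avgQuad p
    + r * (4 * Real.pi * avgCub p + (2 * Real.pi * avgQuad p) ^ 2)))
    (r * (4 * Real.pi * avgCub p + (2 * Real.pi * avgQuad p) ^ 2))
  have h6 : logGrowthDeriv p ρ μ r - (2 * Real.pi * avgQuad p
      + r * (4 * Real.pi * avgCub p + (2 * Real.pi * avgQuad p) ^ 2))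
      + r * (4 * Real.pi * avgCub p + (2 * Real.pi * avgQuad p) ^ 2)
      = logGrowthDeriv p ρ μ r - 2 * Real.pi * avgQuad p := by ring
  rw [h6] at h5
  have h7 := h.2.2
  rw [le_div_iff₀ (by positivity)] at h7
  linarith

theorem mul_avgQuad_div (hω : p.ω ≠ 0) (μ : ℝ) :
    avgQuad p * (μ / p.ω) = 2 / (3 * Real.pi * p.ω ^ 2) * (μ * sigmaSharp p) := by
  have := Real.pi_pos.ne'
  rw [avgQuad]
  field_simp

theorem mul_avgQuad (hω : p.ω ≠ 0) : p.ω * avgQuad p = 2 / (3 * Real.pi) * sigmaSharp p := by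
  have := Real.pi_pos.ne'
  rw [avgQuad]
  field_simp

theorem avgQuad_ne_zero (hω : p.ω ≠ 0) (hσ : sigmaSharp p ≠ 0) : avgQuad p ≠ 0 := by
  have := Real.pi_pos.ne'
  rw [avgQuad]
  positivity

namespace TransversalRange

theorem le_mul_logGrowthDeriv (H : TransversalRange p ρ M δ) {μ r : ℝ} (hμ : |μ| ≤ δ)
    (hr : |r| ≤ δ) : Real.pi * avgQuad p ^ 2 ≤ avgQuad p * logGrowthDeriv p ρ μ r := by
  have h1 : |avgQuad p * (logGrowthDeriv p ρ μ r - 2 * Real.pi * avgQuad p)|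
      ≤ Real.pi * avgQuad p ^ 2 := by
    rw [abs_mul, ← sq_abs (avgQuad p)]
    nlinarith [H.deriv μ r hμ hr, abs_nonneg (avgQuad p)]
  nlinarith [(abs_le.1 h1).1]

theorem le_rho (H : TransversalRange p ρ M δ) {μ : ℝ} (hμ : |μ| ≤ δ) : |μ| ≤ ρ := by
  linarith [H.lt, H.pos]

theorem hasDerivAt (H : TransversalRange p ρ M δ) {μ r : ℝ} (hμ : |μ| ≤ δ) (hr : |r| ≤ δ) :
    HasDerivAt (logGrowth p ρ μ) (logGrowthDeriv p ρ μ r) r :=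
  H.bounds.hasDerivAt_logGrowth (H.le_rho hμ) (by linarith [H.lt])

/-- Multiplying by `c` removes its sign: `c K` increases in the radius with slope at least `π c²`.
Uniqueness of the zero and all quantitative bounds on it rest on this. -/
theorem le_mul_sub (H : TransversalRange p ρ M δ) {μ r s : ℝ} (hμ : |μ| ≤ δ) (hr : 0 ≤ r)
    (hrs : r ≤ s) (hs : s ≤ δ) :
    Real.pi * avgQuad p ^ 2 * (s - r)
      ≤ avgQuad p * logGrowth p ρ μ s - avgQuad p * logGrowth p ρ μ r := by
  have hd : ∀ x ∈ Icc r s, HasDerivAt (fun x => avgQuad p * logGrowth p ρ μ x)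
      (avgQuad p * logGrowthDeriv p ρ μ x) x := fun x hx =>
    (H.hasDerivAt hμ (abs_le.2 ⟨by linarith [hx.1, H.pos], hx.2.trans hs⟩)).const_mul _
  refine (convex_Icc r s).mul_sub_le_image_sub_of_le_deriv
    (f := fun x => avgQuad p * logGrowth p ρ μ x)
    (fun x hx => (hd x hx).continuousAt.continuousWithinAt)
    (fun x hx => (hd x (interior_subset hx)).differentiableAt.differentiableWithinAt)
    (fun x hx => ?_) r (left_mem_Icc.2 hrs) s (right_mem_Icc.2 hrs) hrs
  have hx' := interior_subset hx
  rw [(hd x hx').deriv]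
  exact H.le_mul_logGrowthDeriv hμ (abs_le.2 ⟨by linarith [hx'.1, H.pos], hx'.2.trans hs⟩)

theorem eq_of_logGrowth_eq_zero (H : TransversalRange p ρ M δ) {μ r s : ℝ} (hμ : |μ| ≤ δ)
    (hr : 0 ≤ r) (hr' : r ≤ δ) (hs : 0 ≤ s) (hs' : s ≤ δ) (h1 : logGrowth p ρ μ r = 0)
    (h2 : logGrowth p ρ μ s = 0) : r = s := by
  have hc : 0 < Real.pi * avgQuad p ^ 2 := by
    have := Real.pi_pos
    have := sq_pos_of_ne_zero H.ne
    positivity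
  wlog hrs : r ≤ s generalizing r s
  · exact (this hs hs' hr hr' h2 h1 (le_of_not_ge hrs)).symm
  have h3 := H.le_mul_sub hμ hr hrs hs'
  rw [h1, h2, sub_self] at h3
  nlinarith

theorem equilibria_eq_empty (H : TransversalRange p ρ M δ) {μ : ℝ} (hμ : |μ| ≤ δ)
    (hσ : 0 ≤ μ * sigmaSharp p) : equilibria (avgField p ρ μ) δ = ∅ := by
  rw [eq_empty_iff_forall_notMem]
  rintro r ⟨hr, h0⟩
  rw [avgField_eq_zero_iff H.avg hr.1 hr.2.le] at h0
  have h1 := H.le_mul_sub hμ le_rfl hr.1.le hr.2.le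
  rw [h0, H.bounds.logGrowth_zero (H.le_rho hμ), mul_left_comm,
    mul_avgQuad_div H.bounds.ne] at h1
  have hπ := Real.pi_pos
  have hc : 0 < Real.pi * avgQuad p ^ 2 * (r - 0) := by
    have := sq_pos_of_ne_zero H.ne
    have := hr.1
    rw [sub_zero]
    positivity
  have h2 : 0 ≤ 2 * Real.pi * (2 / (3 * Real.pi * p.ω ^ 2) * (μ * sigmaSharp p)) := by
    positivity
  linarith

/-- `c K` starts at a positive multiple of `μ σ# < 0`. The smallness of `μ` ensures that the
increase `π c² δ / 2` up to `δ / 2` outweighs the starting value, and the intermediate value theorem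
applies. -/
theorem exists_root (H : TransversalRange p ρ M δ) {μ : ℝ} (hμ : |μ| ≤ δ)
    (hμ' : 4 * |μ| < |p.ω| * |avgQuad p| * δ) (hσ : μ * sigmaSharp p < 0) :
    ∃ r, 0 < r ∧ r < δ ∧ logGrowth p ρ μ r = 0 := by
  have hδ := H.pos
  have hπ := Real.pi_pos
  have hω := abs_pos.2 H.bounds.ne
  have hc := abs_pos.2 H.ne
  have h1 := H.le_mul_sub (μ := μ) (r := 0) (s := δ / 2) hμ le_rfl (by linarith) (by linarith)
  have hK0 : avgQuad p * logGrowth p ρ μ 0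
      = 2 * Real.pi * (2 / (3 * Real.pi * p.ω ^ 2) * (μ * sigmaSharp p)) := by
    rw [H.bounds.logGrowth_zero (H.le_rho hμ), mul_left_comm, mul_avgQuad_div H.bounds.ne]
  have hneg : avgQuad p * logGrowth p ρ μ 0 < 0 := by
    rw [hK0]
    have h2 : 0 < 2 / (3 * Real.pi * p.ω ^ 2) := by
      have := sq_pos_of_ne_zero H.bounds.ne
      positivity
    nlinarith [mul_neg_of_pos_of_neg h2 hσ]
  have hK0' : |avgQuad p * logGrowth p ρ μ 0| < Real.pi * avgQuad p ^ 2 * (δ / 2) := by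
    rw [H.bounds.logGrowth_zero (H.le_rho hμ), abs_mul, abs_mul, abs_of_pos Real.two_pi_pos,
      abs_div, ← sq_abs (avgQuad p)]
    have h3 : |μ| / |p.ω| < |avgQuad p| * δ / 4 := by
      rw [div_lt_iff₀ hω]; linarith
    calc |avgQuad p| * (2 * Real.pi * (|μ| / |p.ω|))
        < |avgQuad p| * (2 * Real.pi * (|avgQuad p| * δ / 4)) := by gcongr
      _ = _ := by ring
  have hpos : 0 < avgQuad p * logGrowth p ρ μ (δ / 2) := by
    linarith [(abs_lt.1 hK0').1]
  have hcont : ContinuousOn (fun r => avgQuad p * logGrowth p ρ μ r) (Icc 0 (δ / 2)) :=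
    fun x hx => ((H.hasDerivAt hμ (abs_le.2 ⟨by linarith [hx.1], by
      linarith [hx.2]⟩)).const_mul _).continuousAt.continuousWithinAt
  obtain ⟨r, hr, hr0⟩ := intermediate_value_Icc (by linarith : (0 : ℝ) ≤ δ / 2) hcont
    ⟨hneg.le, hpos.le⟩
  have hr1 : logGrowth p ρ μ r = 0 := (mul_eq_zero.1 hr0).resolve_left H.ne
  refine ⟨r, lt_of_le_of_ne hr.1 ?_, by linarith [hr.2], hr1⟩
  rintro rfl
  rw [hr1, mul_zero] at hneg
  exact lt_irrefl _ hneg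

theorem equilibria_eq_singleton (H : TransversalRange p ρ M δ) {μ r : ℝ} (hμ : |μ| ≤ δ)
    (hr0 : 0 < r) (hr : r < δ) (h : logGrowth p ρ μ r = 0) :
    equilibria (avgField p ρ μ) δ = {r} := by
  ext s
  rw [mem_singleton_iff]
  constructor
  · rintro ⟨hs, h0⟩
    exact H.eq_of_logGrowth_eq_zero hμ hs.1.le hs.2.le hr0.le hr.le
      ((avgField_eq_zero_iff H.avg hs.1 hs.2.le).1 h0) h
  · rintro rfl
    exact ⟨⟨hr0, hr⟩, (avgField_eq_zero_iff H.avg hr0 hr.le).2 h⟩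

/-- The zero must satisfy `π c² r ≤ -c K(0)`, and the right-hand side is at most `2π |c| |μ| / |ω|`.
-/
theorem root_le (H : TransversalRange p ρ M δ) {μ r : ℝ} (hμ : |μ| ≤ δ) (hr0 : 0 < r)
    (hr : r < δ) (h : logGrowth p ρ μ r = 0) : r ≤ 2 / (|p.ω| * |avgQuad p|) * |μ| := by
  have h1 := H.le_mul_sub hμ le_rfl hr0.le hr.le
  have hω := abs_pos.2 H.bounds.ne
  have hc := abs_pos.2 H.ne
  have hπ := Real.pi_pos
  rw [h, H.bounds.logGrowth_zero (H.le_rho hμ), mul_zero, zero_sub, sub_zero] at h1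
  have h2 : Real.pi * avgQuad p ^ 2 * r ≤ |avgQuad p| * (2 * Real.pi * (|μ| / |p.ω|)) := by
    refine h1.trans ((neg_le_abs _).trans ?_)
    rw [abs_mul, abs_mul, abs_of_pos Real.two_pi_pos, abs_div]
  rw [← sq_abs] at h2
  have h3 : (Real.pi * |avgQuad p|) * (|avgQuad p| * r)
      ≤ (Real.pi * |avgQuad p|) * (2 * (|μ| / |p.ω|)) := by linarith
  have h4 := le_of_mul_le_mul_left h3 (by positivity)
  have h5 : 2 / (|p.ω| * |avgQuad p|) * |μ| = 2 * (|μ| / |p.ω|) / |avgQuad p| := by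
    field_simp
  rw [h5, le_div_iff₀ hc]
  linarith

end TransversalRange

/-- Inserting `K = 0` into the expansion gives `μ/ω + c r = O(r² + |μ| r)`, which is `O(μ²)` because
`r = O(|μ|)`. Dividing by `c` produces the stated leading term. -/
theorem RateBounds.exists_root_expand (H : RateBounds p ρ M) (hσ : sigmaSharp p ≠ 0) :
    ∃ C, ∀ δ μ r, TransversalRange p ρ M δ → |μ| ≤ δ → 0 < r → r < δ → logGrowth p ρ μ r = 0 →
      |r - -(3 * Real.pi * μ / (2 * sigmaSharp p))| ≤ C * μ ^ 2 := by
  obtain ⟨C, hC0, hC⟩ := H.exists_logGrowth_expand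
  have hne := avgQuad_ne_zero H.ne hσ
  have hπ := Real.pi_pos
  have hω := abs_pos.2 H.ne
  have hc := abs_pos.2 hne
  set A := 2 / (|p.ω| * |avgQuad p|) with hA
  have hA0 : 0 ≤ A := by positivity
  set E := 2 * Real.pi * avgCub p + (2 * Real.pi * avgQuad p) ^ 2 / 2 with hE
  refine ⟨(|E| * A ^ 2 + C * (A ^ 2 + A)) / (2 * Real.pi * |avgQuad p|),
    fun δ μ r HT hμ hr0 hr h => ?_⟩
  have h1 := hC μ r (HT.le_rho hμ) hr0.le (by linarith [HT.lt])
  rw [h, zero_sub, abs_neg] at h1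
  have hrA := HT.root_le hμ hr0 hr h
  have hr1 : r ≤ 1 := by linarith [HT.lt, H.ρ_le, HT.pos]
  have h2 : r ^ 2 ≤ A ^ 2 * μ ^ 2 := by
    rw [← sq_abs μ, ← mul_pow]; exact pow_le_pow_left₀ hr0.le hrA 2
  have h3 : r ^ 3 ≤ A ^ 2 * μ ^ 2 := by nlinarith [sq_nonneg r]
  have h4 : |μ| * r ≤ A * μ ^ 2 := by
    rw [← sq_abs μ]; nlinarith [abs_nonneg μ]
  have h5 : |r - -(3 * Real.pi * μ / (2 * sigmaSharp p))| * (2 * Real.pi * |avgQuad p|)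
      = |2 * Real.pi * (μ / p.ω) + 2 * Real.pi * avgQuad p * r| := by
    have h6 : μ / p.ω = avgQuad p * (3 * Real.pi * μ / (2 * sigmaSharp p)) := by
      have := H.ne
      rw [avgQuad]; field_simp
    have h7 : 2 * Real.pi * |avgQuad p| = |2 * Real.pi * avgQuad p| := by
      rw [abs_mul, abs_of_pos Real.two_pi_pos]
    rw [h7, ← abs_mul, h6]
    congr 1
    ring
  rw [div_mul_eq_mul_div, le_div_iff₀ (by positivity), h5]
  have h8 := abs_sub (2 * Real.pi * (μ / p.ω) + 2 * Real.pi * avgQuad p * r + E * r ^ 2) (E * r ^ 2)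
  rw [add_sub_cancel_right, abs_mul E, abs_of_nonneg (sq_nonneg r)] at h8
  have h9 : |E| * r ^ 2 ≤ |E| * (A ^ 2 * μ ^ 2) := by gcongr
  have h10 : C * (r ^ 3 + |μ| * r) ≤ C * (A ^ 2 * μ ^ 2 + A * μ ^ 2) := by gcongr
  calc _ ≤ _ := h8
    _ ≤ C * (A ^ 2 * μ ^ 2 + A * μ ^ 2) + |E| * (A ^ 2 * μ ^ 2) :=
      add_le_add (h1.trans h10) h9
    _ = _ := by ring

end Equilibrium

/-! ### Stability of the equilibrium of the averaged equation -/

section ScalarStability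
variable {p : Coeffs} {ρ M δ : ℝ}

namespace TransversalRange

theorem mul_logGrowth_ge (H : TransversalRange p ρ M δ) {μ r x : ℝ} (hμ : |μ| ≤ δ)
    (hr0 : 0 < r) (hr : r < δ) (h : logGrowth p ρ μ r = 0) (hx0 : 0 ≤ x) (hx : x ≤ δ) :
    Real.pi * avgQuad p ^ 2 * (x - r) ^ 2 ≤ avgQuad p * logGrowth p ρ μ x * (x - r) := by
  rcases le_total r x with hrx | hrx
  · have h1 := H.le_mul_sub hμ hr0.le hrx hx
    rw [h, mul_zero, sub_zero] at h1
    nlinarith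
  · have h1 := H.le_mul_sub hμ hx0 hrx hr.le
    rw [h, mul_zero, zero_sub] at h1
    nlinarith

/-- Near the equilibrium `r`, the averaged equation in original time has the linear rate
`r * p.ω * avgQuad p` up to a factor. -/
theorem exists_scalar_rate (H : TransversalRange p ρ M δ) {μ r x : ℝ} (hμ : |μ| ≤ δ)
    (hr0 : 0 < r) (hr : r < δ) (h : logGrowth p ρ μ r = 0) (hx0 : r / 2 ≤ x) (hx : x ≤ δ) :
    ∃ b ≥ r / 4, 2 * (x - r) * (p.ω * avgField p ρ μ x)
      = b * (p.ω * avgQuad p) * (x - r) ^ 2 := by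
  have hπ := Real.pi_pos
  have hc2 := sq_pos_of_ne_zero H.ne
  rcases eq_or_ne x r with rfl | hxr
  · exact ⟨x / 4, le_rfl, by simp⟩
  have h1 := H.mul_logGrowth_ge hμ hr0 hr h (by linarith) hx
  have h2 := one_sub_avgQuad_pos (p := p) H.avg (by linarith : 0 ≤ x) hx
  have hsq := sq_pos_of_ne_zero (sub_ne_zero.2 hxr)
  -- `Q` is the difference quotient of `K` at the equilibrium divided by `c`. It is at least `π` by
  -- the slope bound, while `x (1 - π c x) ≥ r / 4` on the range considered.
  set Q := avgQuad p * logGrowth p ρ μ x * (x - r) / (avgQuad p ^ 2 * (x - r) ^ 2) with hQ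
  have hQ1 : Real.pi ≤ Q := by
    rw [hQ, le_div_iff₀ (by positivity)]; linarith
  refine ⟨x * (1 - Real.pi * avgQuad p * x) / Real.pi * Q, ?_, ?_⟩
  · have h3 : r / 4 ≤ x * (1 - Real.pi * avgQuad p * x) := by nlinarith
    calc r / 4 ≤ x * (1 - Real.pi * avgQuad p * x) := h3
      _ = x * (1 - Real.pi * avgQuad p * x) / Real.pi * Real.pi := by field_simp
      _ ≤ _ := mul_le_mul_of_nonneg_left hQ1 (div_nonneg (by linarith) hπ.le)
  · have h4 := H.ne
    have h5 := sub_ne_zero.2 hxr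
    rw [avgField, hQ]
    field_simp

theorem asymptoticallyStable_equilibrium (H : TransversalRange p ρ M δ) {μ r : ℝ} (hμ : |μ| ≤ δ)
    (hr0 : 0 < r) (hr : r < δ) (h : logGrowth p ρ μ r = 0) (hs : p.ω * avgQuad p < 0) :
    AsymptoticallyStable (fun x => p.ω * avgField p ρ μ x) {r} := by
  have hε : 0 < min (r / 2) (δ - r) := lt_min (by linarith) (by linarith)
  have hc : 0 < r / 4 * (-(p.ω * avgQuad p)) := mul_pos (by linarith) (by linarith)
  refine asymptoticallyStable_of_decay (V := fun x => (x - r) ^ 2) hε hc (fun _ => sq_nonneg _)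
    (fun ε hε => ⟨Real.sqrt ε, Real.sqrt_pos.2 hε, fun z hz => ?_⟩)
    (fun ε hε => ⟨ε ^ 2, by positivity, fun z _ hz => ?_⟩) fun x T hx hxe => ?_
  · rw [Metric.infDist_singleton, Real.dist_eq] at hz
    rw [← sq_abs]
    exact (Real.lt_sqrt (abs_nonneg _)).1 hz
  · rw [Metric.infDist_singleton, Real.dist_eq]
    exact abs_lt_of_sq_lt_sq hz hε.le
  · refine le_mul_exp_of_deriv_le (u := fun t => (x t - r) ^ 2)
      (u' := fun t => 2 * (x t - r) * (p.ω * avgField p ρ μ (x t)))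
      ((hx.continuousOn.sub continuousOn_const).pow 2)
      (fun t ht => (((hx.hasDerivAt ht).sub_const r).pow 2).congr_deriv (by push_cast; ring))
      fun t ht => ?_
    have h1 := hxe t ⟨ht.1.le, ht.2⟩
    rw [Metric.infDist_singleton, Real.dist_eq, lt_min_iff, abs_lt, abs_lt] at h1
    obtain ⟨b, hb, heq⟩ := H.exists_scalar_rate hμ hr0 hr h (x := x t) (by linarith [h1.1.1])
      (by linarith [h1.2.2])
    rw [heq]
    have h2 : b * (p.ω * avgQuad p) ≤ -(r / 4 * (-(p.ω * avgQuad p))) := by nlinarith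
    exact mul_le_mul_of_nonneg_right h2 (sq_nonneg _)

theorem not_lyapunovStable_equilibrium (H : TransversalRange p ρ M δ) {μ r : ℝ} (hμ : |μ| ≤ δ)
    (hr0 : 0 < r) (hr : r < δ) (h : logGrowth p ρ μ r = 0) (hs : 0 < p.ω * avgQuad p) :
    ¬ LyapunovStable (fun x => p.ω * avgField p ρ μ x) {r} := by
  set ε := min (r / 2) (δ - r) with hεdef
  have hε : 0 < ε := lt_min (by linarith) (by linarith)
  have hε1 : ε ≤ r / 2 := min_le_left _ _
  have hε2 : ε ≤ δ - r := min_le_right _ _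
  have hc : 0 < r / 4 * (p.ω * avgQuad p) := mul_pos (by linarith) (by linarith)
  refine not_lyapunovStable_of_growth (V := fun x => (x - r) ^ 2) (B := ε ^ 2) hε hc
    (fun z₀ => ?_) (fun η hη => ⟨r + η / 2, ?_, ?_⟩) (fun z hz => ?_) fun x T hx hxe => ?_
  · have hle : r - ε ≤ r + ε := by linarith
    -- The averaged field is `C¹` near the equilibrium, so projecting onto `[r - ε, r + ε]` gives a
    -- globally solvable truncated equation.
    obtain ⟨K, hK⟩ : ∃ K, LipschitzOnWith K (fun x => p.ω * avgField p ρ μ x)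
        (Icc (r - ε) (r + ε)) := by
      refine LocallyLipschitzOn.exists_lipschitzOnWith_of_compact isCompact_Icc ?_
      have h1 : ContDiffOn ℝ 1 (avgField p ρ μ) (Ico 0 (ρ / 2)) :=
        (H.bounds.hasNormalFormExpansion (μ₀ := ρ) le_rfl (by linarith [H.bounds.ρ_pos])
          le_rfl).2.1 μ (by linarith [H.lt, H.pos])
      exact ((contDiffOn_const.mul h1).locallyLipschitzOn (convex_Ico _ _)).mono fun x hx =>
        ⟨by linarith [hx.1], by linarith [hx.2, H.lt]⟩
    obtain ⟨x, hx0, hxc, hx⟩ := exists_truncated_solution (π := fun x => (projIcc _ _ hle x : ℝ))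
      isCompact_Icc hK (LipschitzWith.subtype_val _ |>.comp (LipschitzWith.projIcc hle) |>.weaken
        (by simp)) (fun z => (projIcc _ _ hle z).2) (fun z hz => by rw [projIcc_of_mem hle hz]) z₀
    refine ⟨x, hx0, hxc, fun T hT t ht => (hx t ?_).hasDerivWithinAt⟩
    have h1 := hT t ht
    rw [Metric.infDist_singleton, Real.dist_eq, abs_lt] at h1
    exact ⟨by linarith, by linarith⟩
  · rw [Metric.infDist_singleton, Real.dist_eq, add_sub_cancel_left, abs_of_pos (half_pos hη)]
    linarith
  · rw [add_sub_cancel_left]; positivity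
  · rw [Metric.infDist_singleton, Real.dist_eq] at hz
    rw [← sq_abs]
    exact pow_le_pow_left₀ (abs_nonneg _) hz.le 2
  · refine mul_exp_le_of_le_deriv (u := fun t => (x t - r) ^ 2)
      (u' := fun t => 2 * (x t - r) * (p.ω * avgField p ρ μ (x t)))
      ((hx.continuousOn.sub continuousOn_const).pow 2)
      (fun t ht => (((hx.hasDerivAt ht).sub_const r).pow 2).congr_deriv (by push_cast; ring))
      fun t ht => ?_
    have h1 := hxe t ⟨ht.1.le, ht.2⟩
    rw [Metric.infDist_singleton, Real.dist_eq, abs_lt] at h1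
    obtain ⟨b, hb, heq⟩ := H.exists_scalar_rate hμ hr0 hr h (x := x t) (by linarith [h1.1])
      (by linarith [h1.2])
    rw [heq]
    have h2 : r / 4 * (p.ω * avgQuad p) ≤ b * (p.ω * avgQuad p) := by nlinarith
    exact mul_le_mul_of_nonneg_right h2 (sq_nonneg _)

end TransversalRange
end ScalarStability

/-! ### Periodic functions of the polar angle -/

section Angle

/-- The principal argument differs from `θ` by a multiple of `2π`, which a periodic function does
not see. -/
theorem comp_angle_polar {f : ℝ → ℝ} (hp : Function.Periodic f (2 * Real.pi)) {R : ℝ}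
    (hR : 0 < R) (θ : ℝ) : f (angle (R * Real.cos θ, R * Real.sin θ)) = f θ := by
  have h1 : (angle (R * Real.cos θ, R * Real.sin θ) : Real.Angle) = (θ : Real.Angle) := by
    have h2 := Complex.arg_mul_cos_add_sin_mul_I_coe_angle hR (θ : Real.Angle)
    rw [Real.Angle.cos_coe, Real.Angle.sin_coe] at h2
    rw [← h2, angle]
    congr 2
    apply Complex.ext <;> simp [-Complex.ofReal_cos, -Complex.ofReal_sin]
  obtain ⟨k, hk⟩ := Real.Angle.angle_eq_iff_two_pi_dvd_sub.1 h1
  have h3 : angle (R * Real.cos θ, R * Real.sin θ) = θ + k * (2 * Real.pi) := by linarith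
  rw [h3]
  exact hp.int_mul k θ

/-- `angle` jumps across the negative axis, but a continuous periodic function factors through the
circle, where the argument is continuous away from the origin. -/
theorem continuousOn_comp_angle {f : ℝ → ℝ} (hf : Continuous f)
    (hp : Function.Periodic f (2 * Real.pi)) :
    ContinuousOn (fun z => f (angle z)) {0}ᶜ := by
  intro z hz
  have h1 : Continuous (hp.lift : Real.Angle → ℝ) := continuous_coinduced_dom.2 hf
  have h2 : Continuous fun z : ℝ × ℝ => (⟨z.1, z.2⟩ : ℂ) :=
    Complex.equivRealProdCLM.symm.continuous
  have hz' : (⟨z.1, z.2⟩ : ℂ) ≠ 0 := fun h0 => hz (Prod.ext (congrArg Complex.re h0)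
    (congrArg Complex.im h0))
  exact (h1.continuousAt.comp (x := z) ((Complex.continuousAt_arg_coe_angle hz').comp
    (f := fun z : ℝ × ℝ => (⟨z.1, z.2⟩ : ℂ)) h2.continuousAt)).continuousWithinAt

theorem exists_forall_infDist_lt {γ : Set (ℝ × ℝ)} (hγ : IsCompact γ) (hne : γ.Nonempty)
    (h0 : (0 : ℝ × ℝ) ∉ γ) {f : ℝ × ℝ → ℝ} (hf : ContinuousOn f {0}ᶜ) {c : ℝ}
    (hc : ∀ z ∈ γ, f z < c) : ∃ η > 0, ∀ z, Metric.infDist z γ < η → z ≠ 0 ∧ f z < c := by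
  obtain ⟨η, hη, hsub⟩ := hγ.exists_thickening_subset_open
    (hf.isOpen_inter_preimage isOpen_compl_singleton (isOpen_Iio (a := c)))
    (fun z hz => ⟨fun h => h0 (h ▸ hz), hc z hz⟩)
  exact ⟨η, hη, fun z hz => hsub ((Metric.mem_thickening_iff_infDist_lt hne).2 hz)⟩

end Angle

/-! ### Floquet exponent and orbital stability -/

section Floquet
variable {p : Coeffs} {ρ M : ℝ}

/-- The coefficient of the variational equation along the trajectory through `r`. -/
def variationCoeff (p : Coeffs) (ρ μ r θ : ℝ) : ℝ :=
  speedDeriv p μ θ (clamp ρ (flow p ρ μ r θ))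

/-- The Floquet exponent of the closed trajectory through `r`. -/
def floquetExponent (p : Coeffs) (ρ μ r : ℝ) : ℝ :=
  (∫ θ in (0 : ℝ)..2 * Real.pi, variationCoeff p ρ μ r θ) / (2 * Real.pi)

/-- Both sides are the derivative of the return map at the fixed point: one from the variational
equation, the other from differentiating `s exp (K s)` where `K = 0`. -/
theorem RateBounds.exp_floquetExponent (H : RateBounds p ρ M) {μ : ℝ} (hμ : |μ| ≤ ρ) {r : ℝ}
    (h : ClosedTrajectory p ρ μ r) (hr : r < ρ / 2) :
    Real.exp (2 * Real.pi * floquetExponent p ρ μ r) = 1 + r * logGrowthDeriv p ρ μ r := by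
  have hπ := Real.pi_pos
  have hr' : |r| < ρ / 2 := by rwa [abs_of_pos h.pos]
  have h1 := H.hasDerivAt_flow_initial hμ hr' two_pi_mem
  have h2 : flowDeriv p ρ μ r (2 * Real.pi)
      = Real.exp (2 * Real.pi * floquetExponent p ρ μ r) := by
    rw [floquetExponent, mul_div_cancel₀ _ (by positivity)]; rfl
  have hK := H.hasDerivAt_logGrowth hμ hr'
  have hK0 := (H.flow_two_pi_eq_iff hμ h.pos h.le).1 h.closed
  have h3 := (hasDerivAt_id r).mul hK.exp
  rw [hK0, Real.exp_zero] at h3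
  have hev : (fun s => flow p ρ μ s (2 * Real.pi))
      =ᶠ[𝓝 r] fun s => id s * Real.exp (logGrowth p ρ μ s) := by
    filter_upwards [(continuous_abs.tendsto r).eventually_lt_const hr'] with s hs
    exact H.flow_two_pi hμ hs.le
  rw [← h2, h1.unique (h3.congr_of_eventuallyEq hev)]
  simp

theorem RateBounds.periodic_variationCoeff (H : RateBounds p ρ M) {μ : ℝ} (hμ : |μ| ≤ ρ) {r : ℝ}
    (h : ClosedTrajectory p ρ μ r) :
    Function.Periodic (variationCoeff p ρ μ r) (2 * Real.pi) := fun φ => by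
  simp only [variationCoeff, speedDeriv, H.flow_periodic hμ h.closed φ, rate_add_two_pi,
    rateDeriv_add_two_pi]

/-- A weight that makes the variational equation autonomous. -/
def orbitWeight (p : Coeffs) (ρ μ r φ : ℝ) : ℝ :=
  Real.exp (-oscPrimitive (variationCoeff p ρ μ r) (floquetExponent p ρ μ r) φ)

theorem RateBounds.hasDerivAt_orbitWeight (H : RateBounds p ρ M) {μ : ℝ} (hμ : |μ| ≤ ρ)
    (r φ : ℝ) : HasDerivAt (orbitWeight p ρ μ r)
      (orbitWeight p ρ μ r φ * -(variationCoeff p ρ μ r φ - floquetExponent p ρ μ r)) φ :=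
  (hasDerivAt_oscPrimitive (H.continuous_speedDeriv_flow hμ r) _ φ).neg.exp

theorem RateBounds.periodic_orbitWeight (H : RateBounds p ρ M) {μ : ℝ} (hμ : |μ| ≤ ρ) {r : ℝ}
    (h : ClosedTrajectory p ρ μ r) : Function.Periodic (orbitWeight p ρ μ r) (2 * Real.pi) := by
  intro φ
  have := periodic_oscPrimitive (H.continuous_speedDeriv_flow hμ r)
    (H.periodic_variationCoeff hμ h) (c := floquetExponent p ρ μ r)
    (by rw [floquetExponent, mul_div_cancel₀ _ Real.two_pi_pos.ne']; rfl) φ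
  exact congrArg (fun x => Real.exp (-x)) this

/-- The radial distance of `z` from the closed trajectory through `r`. -/
def orbitGap (p : Coeffs) (ρ μ r : ℝ) (z : ℝ × ℝ) : ℝ := radius z - flow p ρ μ r (angle z)

/-- A Lyapunov function for the closed trajectory through `r`. -/
def orbitEnergy (p : Coeffs) (ρ μ r : ℝ) (z : ℝ × ℝ) : ℝ :=
  (orbitWeight p ρ μ r (angle z) * orbitGap p ρ μ r z) ^ 2

theorem RateBounds.continuous_orbitWeight (H : RateBounds p ρ M) {μ : ℝ} (hμ : |μ| ≤ ρ) (r : ℝ) :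
    Continuous (orbitWeight p ρ μ r) :=
  continuous_iff_continuousAt.2 fun φ => (H.hasDerivAt_orbitWeight hμ r φ).continuousAt

theorem RateBounds.continuousOn_orbitGap (H : RateBounds p ρ M) {μ : ℝ} (hμ : |μ| ≤ ρ) {r : ℝ}
    (h : ClosedTrajectory p ρ μ r) : ContinuousOn (orbitGap p ρ μ r) {0}ᶜ :=
  continuous_radius.continuousOn.sub
    (continuousOn_comp_angle (H.continuous_flow hμ r) (H.flow_periodic hμ h.closed))

theorem RateBounds.continuousOn_orbitEnergy (H : RateBounds p ρ M) {μ : ℝ} (hμ : |μ| ≤ ρ) {r : ℝ}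
    (h : ClosedTrajectory p ρ μ r) : ContinuousOn (orbitEnergy p ρ μ r) {0}ᶜ :=
  ((continuousOn_comp_angle (H.continuous_orbitWeight hμ r) (H.periodic_orbitWeight hμ h)).mul
    (H.continuousOn_orbitGap hμ h)).pow 2

theorem RateBounds.orbitGap_polar (H : RateBounds p ρ M) {μ : ℝ} (hμ : |μ| ≤ ρ) {r : ℝ}
    (h : ClosedTrajectory p ρ μ r) {R : ℝ} (hR : 0 < R) (θ : ℝ) :
    orbitGap p ρ μ r (R * Real.cos θ, R * Real.sin θ) = R - flow p ρ μ r θ := by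
  rw [orbitGap, radius_polar hR.le, comp_angle_polar (H.flow_periodic hμ h.closed) hR]

theorem RateBounds.orbitEnergy_polar (H : RateBounds p ρ M) {μ : ℝ} (hμ : |μ| ≤ ρ) {r : ℝ}
    (h : ClosedTrajectory p ρ μ r) {R : ℝ} (hR : 0 < R) (θ : ℝ) :
    orbitEnergy p ρ μ r (R * Real.cos θ, R * Real.sin θ)
      = (orbitWeight p ρ μ r θ * (R - flow p ρ μ r θ)) ^ 2 := by
  rw [orbitEnergy, H.orbitGap_polar hμ h hR, comp_angle_polar (H.periodic_orbitWeight hμ h) hR]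

theorem RateBounds.orbitGap_of_mem (H : RateBounds p ρ M) {μ : ℝ} (hμ : |μ| ≤ ρ) {r : ℝ}
    (h : ClosedTrajectory p ρ μ r) {z : ℝ × ℝ} (hz : z ∈ orbitOf p ρ μ r) :
    orbitGap p ρ μ r z = 0 := by
  obtain ⟨φ, rfl⟩ := hz
  simp only [H.orbitGap_polar hμ h (H.flow_pos hμ h.pos φ), sub_self]

theorem RateBounds.isCompact_orbitOf (H : RateBounds p ρ M) {μ : ℝ} (hμ : |μ| ≤ ρ) {r : ℝ}
    (h : ClosedTrajectory p ρ μ r) : IsCompact (orbitOf p ρ μ r) := by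
  have hX := H.flow_periodic hμ h.closed
  have hXc := H.continuous_flow hμ r
  refine Function.Periodic.compact_of_continuous (c := 2 * Real.pi) (fun φ => ?_)
    Real.two_pi_pos.ne' (by fun_prop)
  simp only [hX φ, Real.cos_add_two_pi, Real.sin_add_two_pi]

theorem RateBounds.zero_notMem_orbitOf (H : RateBounds p ρ M) {μ : ℝ} (hμ : |μ| ≤ ρ) {r : ℝ}
    (h : ClosedTrajectory p ρ μ r) : (0 : ℝ × ℝ) ∉ orbitOf p ρ μ r := by
  rintro ⟨φ, hφ⟩
  have h1 := H.flow_pos hμ h.pos φ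
  have h2 := congrArg radius hφ
  simp only [radius_polar h1.le] at h2
  simp [radius] at h2
  exact h1.ne' h2

/-- Comparison with the point of the orbit at the same angle. -/
theorem infDist_orbitOf_le (p : Coeffs) (ρ μ r : ℝ) (z : ℝ × ℝ) :
    Metric.infDist z (orbitOf p ρ μ r) ≤ |orbitGap p ρ μ r z| := by
  have hz := eq_radius_mul_angle z
  have hmem : (flow p ρ μ r (angle z) * Real.cos (angle z),
      flow p ρ μ r (angle z) * Real.sin (angle z)) ∈ orbitOf p ρ μ r := ⟨angle z, rfl⟩
  refine (Metric.infDist_le_dist_of_mem hmem).trans ?_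
  rw [orbitGap]
  set R := radius z
  set φ := angle z
  rw [hz, Prod.dist_eq, Real.dist_eq, Real.dist_eq]
  simp only [← sub_mul, abs_mul]
  exact max_le (mul_le_of_le_one_right (abs_nonneg _) (Real.abs_cos_le_one _))
    (mul_le_of_le_one_right (abs_nonneg _) (Real.abs_sin_le_one _))

/-- `G` is the radial gap, `a` the variational coefficient, `e` the nonlinear remainder, `l` the
Floquet exponent, `Ω` the angular velocity and `m` the weight. The weight's derivative cancels `a`
and leaves `l`. As `|e| ≤ |l| |G| / 2` and `Ω / ω ≥ 1/2`, the factor `k` is at least `2 ⬝ 1/2 ⬝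
1/2`. -/
theorem energy_deriv_identity {m G Ω a l e ω : ℝ} (hω : ω ≠ 0) (hl : l ≠ 0)
    (hΩ : ω ^ 2 / 2 ≤ ω * Ω) (he : |e| ≤ |l| / 2 * |G|) :
    ∃ k ≥ 1 / 2, 2 * (m * G) * (m * -(a - l) * Ω * G + m * ((a * G + e) * Ω))
      = k * (ω * l) * (m * G) ^ 2 := by
  rcases eq_or_ne G 0 with rfl | hG
  · exact ⟨1 / 2, le_rfl, by ring⟩
  have hω2 := sq_pos_of_ne_zero hω
  have hlG : 0 < |l * G| := abs_pos.2 (mul_ne_zero hl hG)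
  have h1 : |e / (l * G)| ≤ 1 / 2 := by
    rw [abs_div, div_le_iff₀ hlG, abs_mul]; linarith
  have h2 := (abs_le.1 h1).1
  refine ⟨2 * ((ω * Ω) / ω ^ 2) * (1 + e / (l * G)), ?_, ?_⟩
  · have h3 : 1 / 2 ≤ ω * Ω / ω ^ 2 := by rw [le_div_iff₀ hω2]; linarith
    nlinarith
  · field_simp
    ring

/-- The gap along a solution obeys the variational equation up to the Taylor error `7 M G²`. The
smallness of the gap turns this error into at most half of the linear term. -/
theorem RateBounds.hasDerivAt_orbitEnergy (H : RateBounds p ρ M) {μ : ℝ} (hμ : |μ| ≤ ρ) {r : ℝ}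
    (h : ClosedTrajectory p ρ μ r) (hl : floquetExponent p ρ μ r ≠ 0) {x : ℝ → ℝ × ℝ} {T : ℝ}
    (hx : IsSolutionOn (field p μ) x (Ico 0 T)) (hx0 : ∀ t ∈ Ico 0 T, x t ≠ 0)
    (hxρ : ∀ t ∈ Ico 0 T, radius (x t) ≤ ρ)
    (hgap : ∀ t ∈ Ico 0 T, 7 * M * |orbitGap p ρ μ r (x t)| ≤ |floquetExponent p ρ μ r| / 2)
    {t : ℝ} (ht : t ∈ Ioo 0 T) :
    ∃ k ≥ 1 / 2, HasDerivAt (fun t => orbitEnergy p ρ μ r (x t))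
      (k * (p.ω * floquetExponent p ρ μ r) * orbitEnergy p ρ μ r (x t)) t := by
  -- The angular lift needs an angular velocity that is continuous on all of `ℝ`. Passing to a
  -- compact interval `[0, b]` inside `[0, T)` allows a constant extension beyond its ends.
  set b := (t + T) / 2 with hb
  have htb : t < b := by linarith [ht.2]
  have hbT : b < T := by linarith [ht.2]
  have hb0 : 0 ≤ b := by linarith [ht.1]
  have hsub : Icc 0 b ⊆ Ico 0 T := fun s hs => ⟨hs.1, hs.2.trans_lt hbT⟩
  have hxb : IsSolutionOn (field p μ) x (Icc 0 b) := hx.mono hsub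
  have hxc : ContinuousOn x (Icc 0 b) := hxb.continuousOn
  have hfc : ContinuousOn (fun t => field p μ (x t)) (Icc 0 b) :=
    (continuous_field p μ).comp_continuousOn hxc
  have hrc : ContinuousOn (fun t => radius (x t)) (Icc 0 b) :=
    continuous_radius.comp_continuousOn hxc
  have hpos : ∀ s ∈ Icc 0 b, 0 < radius (x s) := fun s hs => radius_pos (hx0 s (hsub hs))
  have hq : ContinuousOn (fun t => ((x t).1 * (field p μ (x t)).2
      - (x t).2 * (field p μ (x t)).1) / radius (x t) ^ 2) (Icc 0 b) :=
    ((hxc.fst.mul hfc.snd).sub (hxc.snd.mul hfc.fst)).div (hrc.pow 2)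
      fun s hs => (pow_pos (hpos s hs) 2).ne'
  obtain ⟨θ, h1, h2, h3, h4⟩ := H.exists_lift μ (convex_Icc 0 b) (left_mem_Icc.2 hb0) hxb hpos
    (fun s hs => hxρ s (hsub hs))
    (ψ := IccExtend hb0 ((Icc 0 b).domRestrict fun t => ((x t).1 * (field p μ (x t)).2
      - (x t).2 * (field p μ (x t)).1) / radius (x t) ^ 2))
    (continuousOn_iff_continuous_domRestrict.1 hq).Icc_extend' (fun s hs => by
      rw [IccExtend_of_mem hb0 _ hs]
      exact div_mul_cancel₀ _ (pow_pos (hpos s hs) 2).ne')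
  have htI : t ∈ Icc 0 b := ⟨ht.1.le, htb.le⟩
  have hnhds : Icc 0 b ∈ 𝓝 t := Icc_mem_nhds ht.1 htb
  have hRt := hpos t htI
  have hRρ := hxρ t (hsub htI)
  set X := flow p ρ μ r with hX
  have hXpos : ∀ φ, 0 < X φ := H.flow_pos hμ h.pos
  have hXρ : ∀ φ, |X φ| ≤ ρ := fun φ => by
    rw [abs_of_pos (hXpos φ)]
    exact (H.closed_flow_le hμ h φ).trans (by linarith [h.le])
  set R := fun s => radius (x s) with hR
  set Ω := angularSpeed p μ (R t) (θ t) with hΩ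
  have hRd : HasDerivAt R (R t * rate p μ (θ t) (R t) * Ω) t := by
    rw [H.speed_mul_angular μ hRt hRρ]
    exact (h4 t htI).hasDerivAt hnhds
  have hXd : HasDerivAt (fun s => X (θ s)) (X (θ t) * rate p μ (θ t) (X (θ t)) * Ω) t := by
    rw [← truncSpeed_of_abs_le (hXρ (θ t))]
    exact (H.hasDerivAt_flow hμ r (θ t)).comp t (h2 t htI)
  have hmd := (H.hasDerivAt_orbitWeight hμ r (θ t)).comp t (h2 t htI)
  have hyd := (hmd.mul (hRd.sub hXd)).pow 2
  have hV : ∀ s ∈ Icc 0 b, orbitEnergy p ρ μ r (x s)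
      = (orbitWeight p ρ μ r (θ s) * (R s - X (θ s))) ^ 2 := fun s hs => by
    have := H.orbitEnergy_polar hμ h (hpos s hs) (θ s)
    rwa [← h1 s hs] at this
  have hGt : orbitGap p ρ μ r (x t) = R t - X (θ t) := by
    have := H.orbitGap_polar hμ h hRt (θ t)
    rwa [← h1 t htI] at this
  have hgt := hgap t (hsub htI)
  rw [hGt] at hgt
  have htay := H.speed_taylor hμ (x := R t) (y := X (θ t)) (by rwa [abs_of_pos hRt]) (hXρ _) (θ t)
  obtain ⟨k, hk, heq⟩ := energy_deriv_identity (m := orbitWeight p ρ μ r (θ t))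
    (a := variationCoeff p ρ μ r (θ t)) H.ne hl (h3 t htI)
    (htay.trans (mul_le_mul_of_nonneg_right hgt (abs_nonneg _)))
  refine ⟨k, hk, ?_⟩
  rw [hV t htI, ← heq]
  have hev : (fun s => orbitEnergy p ρ μ r (x s))
      =ᶠ[𝓝 t] fun s => (orbitWeight p ρ μ r (θ s) * (R s - X (θ s))) ^ 2 := by
    filter_upwards [hnhds] with s hs using hV s hs
  refine HasDerivAt.congr_of_eventuallyEq (hyd.congr_deriv ?_) hev
  have hvar : variationCoeff p ρ μ r (θ t) = speedDeriv p μ (θ t) (X (θ t)) := by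
    rw [variationCoeff, clamp_of_abs_le (hXρ _)]
  rw [hvar]
  simp only [Function.comp, Pi.mul_apply, Pi.sub_apply]
  push_cast
  ring

/-- The orbit is compact, avoids the origin, has radius below `ρ` and zero gap. By continuity the
needed inequalities persist in a tube around it. -/
theorem RateBounds.exists_orbit_neighbourhood (H : RateBounds p ρ M) {μ : ℝ} (hμ : |μ| ≤ ρ)
    {r : ℝ} (h : ClosedTrajectory p ρ μ r) (hr : r < ρ / 2)
    (hl : floquetExponent p ρ μ r ≠ 0) :
    ∃ ε₀ > 0, ∀ z, Metric.infDist z (orbitOf p ρ μ r) < ε₀ →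
      z ≠ 0 ∧ radius z ≤ ρ ∧ 7 * M * |orbitGap p ρ μ r z| ≤ |floquetExponent p ρ μ r| / 2 := by
  have hc := H.isCompact_orbitOf hμ h
  have hne : (orbitOf p ρ μ r).Nonempty := ⟨_, H.mem_orbitOf hμ r⟩
  have h0 := H.zero_notMem_orbitOf hμ h
  obtain ⟨η₁, hη₁, h1⟩ := exists_forall_infDist_lt hc hne h0 continuous_radius.continuousOn
    (c := ρ) (by
      rintro _ ⟨φ, rfl⟩
      simp only [radius_polar (H.flow_pos hμ h.pos φ).le]
      linarith [H.closed_flow_le hμ h φ])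
  obtain ⟨η₂, hη₂, h2⟩ := exists_forall_infDist_lt hc hne h0
    (f := fun z => 7 * M * |orbitGap p ρ μ r z|) (c := |floquetExponent p ρ μ r| / 2)
    (continuousOn_const.mul (H.continuousOn_orbitGap hμ h).abs) (fun z hz => by
      rw [H.orbitGap_of_mem hμ h hz, abs_zero, mul_zero]
      exact half_pos (abs_pos.2 hl))
  refine ⟨min η₁ η₂, lt_min hη₁ hη₂, fun z hz => ?_⟩
  rw [lt_min_iff] at hz
  exact ⟨(h1 z hz.1).1, (h1 z hz.1).2.le, (h2 z hz.2).2.le⟩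

theorem RateBounds.exists_orbitWeight_bounds (H : RateBounds p ρ M) {μ : ℝ} (hμ : |μ| ≤ ρ)
    {r : ℝ} (h : ClosedTrajectory p ρ μ r) :
    ∃ m B, 0 < m ∧ ∀ φ, m ≤ orbitWeight p ρ μ r φ ∧ orbitWeight p ρ μ r φ ≤ B := by
  have hosc := H.continuous_speedDeriv_flow hμ r
  obtain ⟨B, -, hB⟩ := exists_abs_le_of_periodic
    (continuous_oscPrimitive hosc (floquetExponent p ρ μ r))
    (periodic_oscPrimitive hosc (H.periodic_variationCoeff hμ h)
      (by rw [floquetExponent, mul_div_cancel₀ _ Real.two_pi_pos.ne']; rfl))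
  refine ⟨Real.exp (-B), Real.exp B, Real.exp_pos _, fun φ => ⟨?_, ?_⟩⟩
  · exact Real.exp_le_exp.2 (neg_le_neg ((le_abs_self _).trans (hB φ)))
  · exact Real.exp_le_exp.2 ((neg_le_abs _).trans (hB φ))

/-- The energy is small near the orbit by continuity. Conversely it controls the distance because
the weight is bounded below. It decays at a rate of at least `|ω λ| / 2`. -/
theorem RateBounds.asymptoticallyStable_orbitOf (H : RateBounds p ρ M) {μ : ℝ} (hμ : |μ| ≤ ρ)
    {r : ℝ} (h : ClosedTrajectory p ρ μ r) (hr : r < ρ / 2)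
    (hl : p.ω * floquetExponent p ρ μ r < 0) :
    AsymptoticallyStable (field p μ) (orbitOf p ρ μ r) := by
  have hl0 : floquetExponent p ρ μ r ≠ 0 := fun h0 => by simp [h0] at hl
  obtain ⟨ε₀, hε₀, hnb⟩ := H.exists_orbit_neighbourhood hμ h hr hl0
  obtain ⟨m, B, hm, hmB⟩ := H.exists_orbitWeight_bounds hμ h
  refine asymptoticallyStable_of_decay (V := orbitEnergy p ρ μ r) hε₀
    (c := 1 / 2 * -(p.ω * floquetExponent p ρ μ r)) (by linarith) (fun _ => sq_nonneg _)
    (fun ε hε => ?_) (fun ε hε => ⟨(m * ε) ^ 2, by positivity, fun z _ hz => ?_⟩)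
    fun x T hx hxe => ?_
  · obtain ⟨η, hη, h1⟩ := exists_forall_infDist_lt (H.isCompact_orbitOf hμ h)
      ⟨_, H.mem_orbitOf hμ r⟩ (H.zero_notMem_orbitOf hμ h) (H.continuousOn_orbitEnergy hμ h)
      (c := ε) (fun z hz => by simp [orbitEnergy, H.orbitGap_of_mem hμ h hz, hε])
    exact ⟨η, hη, fun z hz => (h1 z hz).2⟩
  · refine (infDist_orbitOf_le p ρ μ r z).trans_lt ?_
    have h1 := abs_lt_of_sq_lt_sq hz (by positivity)
    rw [abs_mul] at h1
    have h2 : m ≤ |orbitWeight p ρ μ r (angle z)| := (hmB _).1.trans (le_abs_self _)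
    refine lt_of_mul_lt_mul_left (h1.trans_le' ?_) hm.le
    exact mul_le_mul_of_nonneg_right h2 (abs_nonneg _)
  · have hd := fun t (ht : t ∈ Ioo 0 T) => H.hasDerivAt_orbitEnergy hμ h hl0 hx
      (fun t ht => (hnb _ (hxe t ht)).1) (fun t ht => (hnb _ (hxe t ht)).2.1)
      (fun t ht => (hnb _ (hxe t ht)).2.2) ht
    refine le_mul_exp_of_deriv_le (u := fun t => orbitEnergy p ρ μ r (x t))
      ((H.continuousOn_orbitEnergy hμ h).comp hx.continuousOn fun t ht => (hnb _ (hxe t ht)).1)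
      (fun t ht => (hd t ht).elim fun k hk => hk.2.differentiableAt.hasDerivAt) fun t ht => ?_
    obtain ⟨k, hk, hkd⟩ := hd t ht
    rw [hkd.deriv]
    refine mul_le_mul_of_nonneg_right ?_ (sq_nonneg _)
    nlinarith

theorem RateBounds.not_lyapunovStable_orbitOf (H : RateBounds p ρ M) {μ : ℝ} (hμ : |μ| ≤ ρ)
    {r : ℝ} (h : ClosedTrajectory p ρ μ r) (hr : r < ρ / 2)
    (hl : 0 < p.ω * floquetExponent p ρ μ r) :
    ¬ LyapunovStable (field p μ) (orbitOf p ρ μ r) := by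
  have hl0 : floquetExponent p ρ μ r ≠ 0 := fun h0 => by simp [h0] at hl
  obtain ⟨ε₀, hε₀, hnb⟩ := H.exists_orbit_neighbourhood hμ h hr hl0
  obtain ⟨m, B, hm, hmB⟩ := H.exists_orbitWeight_bounds hμ h
  refine not_lyapunovStable_of_growth (V := orbitEnergy p ρ μ r) hε₀
    (c := 1 / 2 * (p.ω * floquetExponent p ρ μ r))
    (B := (B * |floquetExponent p ρ μ r|) ^ 2) (by linarith)
    (fun z₀ => ?_) (fun η hη => ⟨(r + η / 2, 0), ?_, ?_⟩) (fun z hz => ?_) fun x T hx hxe => ?_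
  · obtain ⟨x, hx0, hxc, hx⟩ := exists_truncated_field_solution p μ H.ρ_pos.le z₀
    exact ⟨x, hx0, hxc, fun T hT t ht => (hx t ((norm_le_radius _).trans
      (hnb _ (hT t ht)).2.1)).hasDerivWithinAt⟩
  · refine (Metric.infDist_le_dist_of_mem (H.mem_orbitOf hμ r)).trans_lt ?_
    rw [Prod.dist_eq, Real.dist_eq, dist_self, add_sub_cancel_left, abs_of_pos (half_pos hη),
      max_eq_left (half_pos hη).le]
    linarith
  · have h1 := H.orbitEnergy_polar hμ h (R := r + η / 2) (by linarith [h.pos]) 0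
    rw [Real.cos_zero, Real.sin_zero, mul_one, mul_zero, H.flow_zero hμ, add_sub_cancel_left] at h1
    rw [h1]
    have := hm.trans_le (hmB 0).1
    positivity
  -- In the tube `7 M |gap| ≤ |λ| / 2`, so `|gap| ≤ |λ|`. This explains the bound chosen for the
  -- energy.
  · have h1 := (hnb z hz).2.2
    have h2 := (hmB (angle z)).1
    have h3 : |orbitGap p ρ μ r z| ≤ |floquetExponent p ρ μ r| := by
      nlinarith [abs_nonneg (orbitGap p ρ μ r z), H.one_le, abs_nonneg (floquetExponent p ρ μ r)]
    rw [orbitEnergy, ← sq_abs, abs_mul, abs_of_pos (hm.trans_le h2)]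
    refine pow_le_pow_left₀ (mul_nonneg (hm.le.trans h2) (abs_nonneg _)) ?_ 2
    exact mul_le_mul (hmB _).2 h3 (abs_nonneg _) ((hm.le.trans h2).trans (hmB (angle z)).2)
  · have hd := fun t (ht : t ∈ Ioo 0 T) => H.hasDerivAt_orbitEnergy hμ h hl0 hx
      (fun t ht => (hnb _ (hxe t ht)).1) (fun t ht => (hnb _ (hxe t ht)).2.1)
      (fun t ht => (hnb _ (hxe t ht)).2.2) ht
    refine mul_exp_le_of_le_deriv (u := fun t => orbitEnergy p ρ μ r (x t))
      ((H.continuousOn_orbitEnergy hμ h).comp hx.continuousOn fun t ht => (hnb _ (hxe t ht)).1)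
      (fun t ht => (hd t ht).elim fun k hk => hk.2.differentiableAt.hasDerivAt) fun t ht => ?_
    obtain ⟨k, hk, hkd⟩ := hd t ht
    rw [hkd.deriv]
    refine mul_le_mul_of_nonneg_right ?_ (sq_nonneg _)
    nlinarith

end Floquet

/-! ### Stability along the branch and direction of the bifurcation -/

section Bifurcation
variable {p : Coeffs} {ρ M δ : ℝ}

namespace TransversalRange

theorem closedTrajectory (H : TransversalRange p ρ M δ) {μ r : ℝ} (hμ : |μ| ≤ δ)
    (hr0 : 0 < r) (hr : r < δ) (h : logGrowth p ρ μ r = 0) : ClosedTrajectory p ρ μ r := by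
  have hr' : r ≤ ρ / 2 := by linarith [H.lt]
  exact ⟨hr0, hr', (H.bounds.flow_two_pi_eq_iff (H.le_rho hμ) hr0 hr').2 h⟩

/-- The multiplier `1 + r ∂K/∂r` lies above or below `1` according to the sign of `∂K/∂r`, which is
the sign of `c`. -/
theorem mul_floquetExponent_pos (H : TransversalRange p ρ M δ) {μ r : ℝ} (hμ : |μ| ≤ δ)
    (hr0 : 0 < r) (hr : r < δ) (h : logGrowth p ρ μ r = 0) :
    0 < avgQuad p * floquetExponent p ρ μ r := by
  have h1 := H.bounds.exp_floquetExponent (H.le_rho hμ) (H.closedTrajectory hμ hr0 hr h)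
    (by linarith [H.lt])
  have h2 := H.le_mul_logGrowthDeriv (r := r) hμ (by rw [abs_of_pos hr0]; exact hr.le)
  have hπ := Real.pi_pos
  have hc := sq_pos_of_ne_zero H.ne
  have h3 : 0 < avgQuad p * logGrowthDeriv p ρ μ r := h2.trans_lt' (by positivity)
  rcases lt_or_gt_of_ne H.ne with hneg | hpos
  · refine mul_pos_of_neg_of_neg hneg ?_
    have h4 : logGrowthDeriv p ρ μ r < 0 := neg_of_mul_pos_right h3 hneg.le
    have h5 : Real.exp (2 * Real.pi * floquetExponent p ρ μ r) < 1 := by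
      rw [h1]; linarith [mul_neg_of_pos_of_neg hr0 h4]
    rw [Real.exp_lt_one_iff] at h5
    exact neg_of_mul_neg_right h5 (by positivity)
  · refine mul_pos hpos ?_
    have h4 : 0 < logGrowthDeriv p ρ μ r := pos_of_mul_pos_right h3 hpos.le
    have h5 : 1 < Real.exp (2 * Real.pi * floquetExponent p ρ μ r) := by
      rw [h1]; linarith [mul_pos hr0 h4]
    rw [Real.one_lt_exp_iff] at h5
    exact pos_of_mul_pos_right h5 (by positivity)

/-- `ω c` and `ω λ` both have the sign of `σ#`, so the orbit and the averaged equilibrium share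
their stability type, whichever way the flow rotates. -/
theorem stable_of_pos (H : TransversalRange p ρ M δ) {μ r : ℝ} (hμ : |μ| ≤ δ)
    (hr0 : 0 < r) (hr : r < δ) (h : logGrowth p ρ μ r = 0) (hσ : sigmaSharp p < 0) :
    AsymptoticallyStable (field p μ) (orbitOf p ρ μ r) ∧
      AsymptoticallyStable (fun x => p.ω * avgField p ρ μ x) {r} := by
  have h1 : p.ω * avgQuad p < 0 := by
    rw [mul_avgQuad H.bounds.ne]
    exact mul_neg_of_pos_of_neg (by have := Real.pi_pos; positivity) hσ
  refine ⟨H.bounds.asymptoticallyStable_orbitOf (H.le_rho hμ) (H.closedTrajectory hμ hr0 hr h)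
    (by linarith [H.lt]) ?_, H.asymptoticallyStable_equilibrium hμ hr0 hr h h1⟩
  have h2 := H.mul_floquetExponent_pos hμ hr0 hr h
  have h3 := sq_pos_of_ne_zero H.ne
  nlinarith [mul_neg_of_neg_of_pos h1 h2]

theorem unstable_of_neg (H : TransversalRange p ρ M δ) {μ r : ℝ} (hμ : |μ| ≤ δ)
    (hr0 : 0 < r) (hr : r < δ) (h : logGrowth p ρ μ r = 0) (hσ : 0 < sigmaSharp p) :
    ¬ LyapunovStable (field p μ) (orbitOf p ρ μ r) ∧
      ¬ LyapunovStable (fun x => p.ω * avgField p ρ μ x) {r} := by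
  have h1 : 0 < p.ω * avgQuad p := by
    rw [mul_avgQuad H.bounds.ne]
    exact mul_pos (by have := Real.pi_pos; positivity) hσ
  refine ⟨H.bounds.not_lyapunovStable_orbitOf (H.le_rho hμ) (H.closedTrajectory hμ hr0 hr h)
    (by linarith [H.lt]) ?_, H.not_lyapunovStable_equilibrium hμ hr0 hr h h1⟩
  have h2 := H.mul_floquetExponent_pos hμ hr0 hr h
  have h3 := sq_pos_of_ne_zero H.ne
  nlinarith [mul_pos h1 h2]

theorem bijOn (H : TransversalRange p ρ M δ) {μ : ℝ} (hμ : |μ| ≤ δ) :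
    BijOn (orbitOf p ρ μ) (equilibria (avgField p ρ μ) δ)
      (periodicOrbits (field p μ) (slitDisc δ)) :=
  H.bounds.bijOn_orbitOf (H.le_rho hμ) H.lt.le H.avg

theorem periodicOrbits_eq_empty (H : TransversalRange p ρ M δ) {μ : ℝ} (hμ : |μ| ≤ δ)
    (hσ : 0 ≤ μ * sigmaSharp p) : periodicOrbits (field p μ) (slitDisc δ) = ∅ := by
  rw [← (H.bijOn hμ).image_eq, H.equilibria_eq_empty hμ hσ, image_empty]

/-- The orbit stays within radius `2 r`, and `r` is bounded by a multiple of `|μ|`. The last bound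
on `μ` makes `2 r < ε`. -/
theorem exists_small_orbit (H : TransversalRange p ρ M δ) {ε : ℝ} (hε : 0 < ε) :
    ∃ μ₁ > 0, μ₁ ≤ δ ∧ ∀ μ, |μ| < μ₁ → μ * sigmaSharp p < 0 →
      ∃ γ, IsPeriodicOrbit (field p μ) γ ∧ γ ⊆ Metric.ball 0 ε := by
  have hω := abs_pos.2 H.bounds.ne
  have hc := abs_pos.2 H.ne
  have hδ := H.pos
  set A := 2 / (|p.ω| * |avgQuad p|) with hA
  have hA0 : 0 < A := by positivity
  refine ⟨min δ (min (|p.ω| * |avgQuad p| * δ / 4) (ε / (2 * A))), by positivity, min_le_left _ _,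
    fun μ hμ hσ => ?_⟩
  rw [lt_min_iff, lt_min_iff, lt_div_iff₀ (by positivity), lt_div_iff₀ (by positivity)] at hμ
  obtain ⟨r, hr0, hr, hK⟩ := H.exists_root hμ.1.le (by linarith [hμ.2.1]) hσ
  have hcl := H.closedTrajectory hμ.1.le hr0 hr hK
  have hρ := H.le_rho hμ.1.le
  refine ⟨orbitOf p ρ μ r, H.bounds.isPeriodicOrbit_orbitOf hρ hcl, ?_⟩
  rintro _ ⟨φ, rfl⟩
  rw [mem_ball_zero_iff]
  refine (norm_le_radius _).trans_lt ?_
  rw [radius_polar (H.bounds.flow_pos hρ hr0 φ).le]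
  have h1 := H.bounds.closed_flow_le hρ hcl φ
  have h2 := H.root_le hμ.1.le hr0 hr hK
  linarith [hμ.2.2]

/-- Inside the slit disc there are no periodic orbits for `μ σ# ≥ 0`. For the other sign the orbit
shrinks into any given neighbourhood, and the origin is stable or not according to the sign of `μ`.
-/
theorem isSubcritical (H : TransversalRange p ρ M δ) (hσ : 0 < sigmaSharp p) :
    IsSubcritical (field p) := by
  refine ⟨slitDisc δ, (isOpen_slitDisc δ).mem_nhds (zero_mem_slitDisc H.pos), fun W hW hWV => ?_⟩
  obtain ⟨ε, hε, hball⟩ := Metric.mem_nhds_iff.1 hW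
  obtain ⟨μ₁, hμ₁, hμδ, hex⟩ := H.exists_small_orbit hε
  refine ⟨μ₁, hμ₁, fun μ h0 hμ => ?_⟩
  rcases lt_or_gt_of_ne (abs_pos.1 h0) with hneg | hpos
  · obtain ⟨γ, hγ, hγs⟩ := hex μ hμ (mul_neg_of_neg_of_pos hneg hσ)
    exact iff_of_true ⟨γ, hγ, hγs.trans hball⟩ (H.bounds.asymptoticallyStable_origin hneg)
  · refine iff_of_false ?_ fun h => H.bounds.not_lyapunovStable_origin hpos h.1
    rintro ⟨γ, hγ, hγW⟩
    have h1 : γ ∈ periodicOrbits (field p μ) (slitDisc δ) := ⟨hγ, hγW.trans hWV⟩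
    rwa [H.periodicOrbits_eq_empty (hμ.le.trans hμδ) (mul_pos hpos hσ).le] at h1

theorem isSupercritical (H : TransversalRange p ρ M δ) (hσ : sigmaSharp p < 0) :
    IsSupercritical (field p) := by
  refine ⟨slitDisc δ, (isOpen_slitDisc δ).mem_nhds (zero_mem_slitDisc H.pos), fun W hW hWV => ?_⟩
  obtain ⟨ε, hε, hball⟩ := Metric.mem_nhds_iff.1 hW
  obtain ⟨μ₁, hμ₁, hμδ, hex⟩ := H.exists_small_orbit hε
  refine ⟨μ₁, hμ₁, fun μ h0 hμ => ?_⟩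
  rcases lt_or_gt_of_ne (abs_pos.1 h0) with hneg | hpos
  · refine iff_of_false ?_ fun h => h (H.bounds.asymptoticallyStable_origin hneg).1
    rintro ⟨γ, hγ, hγW⟩
    have h1 : γ ∈ periodicOrbits (field p μ) (slitDisc δ) := ⟨hγ, hγW.trans hWV⟩
    rwa [H.periodicOrbits_eq_empty (hμ.le.trans hμδ) (mul_pos_of_neg_of_neg hneg hσ).le] at h1
  · obtain ⟨γ, hγ, hγs⟩ := hex μ hμ (mul_neg_of_pos_of_neg hpos hσ)
    exact iff_of_true ⟨γ, hγ, hγs.trans hball⟩ (H.bounds.not_lyapunovStable_origin hpos)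

end TransversalRange

/-- The constant in the estimate for the radius along a closed trajectory. -/
def radiusConst (p : Coeffs) (M : ℝ) : ℝ :=
  8 * Real.pi * M * (|p.ω| * (2 * M * Real.exp (2 * Real.pi)) + 1)

theorem RateBounds.radiusConst_nonneg (H : RateBounds p ρ M) : 0 ≤ radiusConst p M := by
  have := zero_le_one.trans H.one_le
  have := Real.pi_pos
  unfold radiusConst
  positivity

/-- The deviation of the radius along the orbit is `O(r²)`, hence `O(μ²)`, and is added to the error
of the root. -/
theorem RateBounds.exists_orbit_expand (H : RateBounds p ρ M) (hσ : sigmaSharp p ≠ 0) :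
    ∃ C, ∀ δ μ r, TransversalRange p ρ M δ → |μ| ≤ δ → 0 < r → r < δ → logGrowth p ρ μ r = 0 →
      |r - -(3 * Real.pi * μ / (2 * sigmaSharp p))| ≤ C * μ ^ 2 ∧
      ∀ z ∈ orbitOf p ρ μ r,
        |radius z - -(3 * Real.pi * μ / (2 * sigmaSharp p))| ≤ C * μ ^ 2 := by
  obtain ⟨C, hC⟩ := H.exists_root_expand hσ
  have hR := H.radiusConst_nonneg
  set A := 2 / (|p.ω| * |avgQuad p|) with hA
  have hA0 : 0 ≤ A := by positivity
  refine ⟨C + radiusConst p M * A ^ 2, fun δ μ r HT hμ hr0 hr h => ?_⟩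
  have h1 := hC δ μ r HT hμ hr0 hr h
  have h2 : radiusConst p M * r ^ 2 ≤ radiusConst p M * A ^ 2 * μ ^ 2 := by
    rw [mul_assoc, ← sq_abs μ, ← mul_pow]
    exact mul_le_mul_of_nonneg_left (pow_le_pow_left₀ hr0.le (HT.root_le hμ hr0 hr h) 2) hR
  rw [add_mul]
  refine ⟨h1.trans (le_add_of_nonneg_right ((by positivity : 0 ≤ radiusConst p M * r ^ 2).trans
    h2)), fun z hz => ?_⟩
  have h3 := H.abs_radius_sub_le (HT.le_rho hμ) (HT.closedTrajectory hμ hr0 hr h) hz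
  have h4 := abs_sub_le (radius z) r (-(3 * Real.pi * μ / (2 * sigmaSharp p)))
  have h5 : |radius z - r| ≤ radiusConst p M * r ^ 2 := h3
  linarith

end Bifurcation

end NonsmoothHopf

end

/-! ### The theorem and its corollary -/

open NonsmoothHopf
theorem theorem3p1 (p : Coeffs) (hω : p.ω ≠ 0) :
    ∃ (μ₀ δ C : ℝ) (F : ℝ → ℝ → ℝ) (U : Set (ℝ × ℝ)) (Φ : ℝ → ℝ → Set (ℝ × ℝ)),
      0 < μ₀ ∧ 0 < δ ∧ IsOpen U ∧ 0 ∈ U ∧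
      -- the averaged normal form `r̄' = F μ r̄`
      HasNormalFormExpansion p μ₀ δ F ∧ IsObtainedByAveraging p μ₀ δ F ∧
      -- its equilibria correspond one-to-one to the periodic orbits
      (∀ μ, 0 < |μ| → |μ| < μ₀ →
        BijOn (Φ μ) (equilibria (F μ) δ) (periodicOrbits (field p μ) U) ∧
        ∀ r ∈ equilibria (F μ) δ, ∀ z ∈ Φ μ r, |radius z - r| ≤ C * r ^ 2) ∧
      (sigmaSharp p ≠ 0 →
        -- the degenerate pitchfork and Hopf bifurcations, with stability
        (∀ μ, |μ| < μ₀ →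
          (0 ≤ μ * sigmaSharp p → equilibria (F μ) δ = ∅) ∧
          (0 < μ * sigmaSharp p → periodicOrbits (field p μ) U = ∅) ∧
          (μ * sigmaSharp p < 0 →
            ∃ r₀ : ℝ, equilibria (F μ) δ = {r₀} ∧
              periodicOrbits (field p μ) U = {Φ μ r₀} ∧
              |r₀ - -(3 * Real.pi * μ / (2 * sigmaSharp p))| ≤ C * μ ^ 2 ∧
              (∀ z ∈ Φ μ r₀,
                |radius z - -(3 * Real.pi * μ / (2 * sigmaSharp p))| ≤ C * μ ^ 2) ∧
              (LyapunovStable (field p μ) (Φ μ r₀) ↔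
                LyapunovStable (fun r => p.ω * F μ r) {r₀}) ∧
              (AsymptoticallyStable (field p μ) (Φ μ r₀) ↔
                AsymptoticallyStable (fun r => p.ω * F μ r) {r₀}) ∧
              (0 < μ → AsymptoticallyStable (field p μ) (Φ μ r₀)) ∧
              (μ < 0 → ¬ LyapunovStable (field p μ) (Φ μ r₀)))) ∧
        (0 < sigmaSharp p → IsSubcritical (field p)) ∧
        (sigmaSharp p < 0 → IsSupercritical (field p))) := by
  obtain ⟨ρ, M, H⟩ := exists_rateBounds p hω
  obtain ⟨δ₁, hδ₁, havg⟩ := H.exists_isObtainedByAveraging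
  have hρ := H.ρ_pos
  have hπ := Real.pi_pos
  have hω' := abs_pos.2 hω
  -- The non-degeneracy condition is placed inside the quantified statement, with a dummy value when
  -- `σ# = 0`. One choice of `δ`, `μ₀`, `C` and `F` then serves both the general part and the
  -- corollary.
  obtain ⟨δ₀, hδ₀, htrans⟩ : ∃ δ₀ > 0, sigmaSharp p ≠ 0 → ∀ δ, 0 < δ → δ ≤ δ₀ →
      TransversalRange p ρ M δ := by
    by_cases hσ : sigmaSharp p = 0
    · exact ⟨1, one_pos, fun h => absurd hσ h⟩
    · obtain ⟨δ₀, h0, h⟩ := H.exists_transversalRange (avgQuad_ne_zero hω hσ)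
      exact ⟨δ₀, h0, fun _ => h⟩
  obtain ⟨δ, hδ, hδδ₁, hδδ₀, hδρ, hδc⟩ : ∃ δ > 0, δ ≤ δ₁ ∧ δ ≤ δ₀ ∧ 2 * δ ≤ ρ ∧
      Real.pi * |avgQuad p| * δ ≤ 1 / 2 := by
    refine ⟨min (min δ₁ δ₀) (min (ρ / 2) (1 / (2 * (Real.pi * |avgQuad p| + 1)))), by positivity,
      (min_le_left _ _).trans (min_le_left _ _), (min_le_left _ _).trans (min_le_right _ _), ?_, ?_⟩
    · have := (min_le_right (min δ₁ δ₀) _).trans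
        (min_le_left (ρ / 2) (1 / (2 * (Real.pi * |avgQuad p| + 1))))
      linarith
    · set d := min (min δ₁ δ₀) (min (ρ / 2) (1 / (2 * (Real.pi * |avgQuad p| + 1))))
      have h0 : 0 < d := by positivity
      have h1 : d ≤ 1 / (2 * (Real.pi * |avgQuad p| + 1)) :=
        (min_le_right (min δ₁ δ₀) _).trans (min_le_right _ _)
      rw [le_div_iff₀ (by positivity)] at h1
      linarith
  -- The extra bound on `μ₀` is the smallness that `exists_root` asks for.
  obtain ⟨μ₀, hμ₀, hμδ, hμc⟩ : ∃ μ₀ > 0, μ₀ ≤ δ ∧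
      (sigmaSharp p ≠ 0 → 4 * μ₀ ≤ |p.ω| * |avgQuad p| * δ) := by
    by_cases hσ : sigmaSharp p = 0
    · exact ⟨δ, hδ, le_rfl, fun h => absurd hσ h⟩
    · have hc := abs_pos.2 (avgQuad_ne_zero hω hσ)
      refine ⟨min δ (|p.ω| * |avgQuad p| * δ / 4), by positivity, min_le_left _ _, fun _ => ?_⟩
      linarith [min_le_right δ (|p.ω| * |avgQuad p| * δ / 4)]
  obtain ⟨C, hC⟩ : ∃ C, sigmaSharp p ≠ 0 → ∀ δ μ r, TransversalRange p ρ M δ → |μ| ≤ δ →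
      0 < r → r < δ → logGrowth p ρ μ r = 0 →
      |r - -(3 * Real.pi * μ / (2 * sigmaSharp p))| ≤ C * μ ^ 2 ∧
      ∀ z ∈ orbitOf p ρ μ r,
        |radius z - -(3 * Real.pi * μ / (2 * sigmaSharp p))| ≤ C * μ ^ 2 := by
    by_cases hσ : sigmaSharp p = 0
    · exact ⟨0, fun h => absurd hσ h⟩
    · obtain ⟨C, h⟩ := H.exists_orbit_expand hσ
      exact ⟨C, fun _ => h⟩
  have hmax : ∀ t : ℝ, C * t ^ 2 ≤ max C (radiusConst p M) * t ^ 2 := fun t =>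
    mul_le_mul_of_nonneg_right (le_max_left _ _) (sq_nonneg t)
  refine ⟨μ₀, δ, max C (radiusConst p M), avgField p ρ, slitDisc δ, orbitOf p ρ, hμ₀, hδ,
    isOpen_slitDisc δ, zero_mem_slitDisc hδ,
    H.hasNormalFormExpansion (by linarith) hδ (by linarith), havg μ₀ δ (by linarith) hδδ₁,
    fun μ _ hμ => ⟨H.bijOn_orbitOf (by linarith) hδρ hδc, fun r hr z hz => ?_⟩, fun hσ => ?_⟩
  · have hμρ : |μ| ≤ ρ := by linarith
    refine (H.abs_radius_sub_le hμρ
      (H.closedTrajectory_of_equilibrium hμρ hδρ hδc hr) hz).trans ?_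
    exact mul_le_mul_of_nonneg_right (le_max_right C (radiusConst p M)) (sq_nonneg r)
  have HT := htrans hσ δ hδ hδδ₀
  refine ⟨fun μ hμ => ?_, HT.isSubcritical, HT.isSupercritical⟩
  have hμδ' : |μ| ≤ δ := by linarith
  refine ⟨HT.equilibria_eq_empty hμδ', fun h => HT.periodicOrbits_eq_empty hμδ' h.le,
    fun hneg => ?_⟩
  obtain ⟨r, hr0, hr, hK⟩ := HT.exists_root hμδ' (by linarith [hμc hσ]) hneg
  have heq := HT.equilibria_eq_singleton hμδ' hr0 hr hK
  obtain ⟨hC1, hC2⟩ := hC hσ δ μ r HT hμδ' hr0 hr hK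
  refine ⟨r, heq, ?_, hC1.trans (hmax μ), fun z hz => (hC2 z hz).trans (hmax μ), ?_⟩
  · rw [← (HT.bijOn hμδ').image_eq, heq, image_singleton]
  -- Both equivalences hold because the two sides are simultaneously true (`σ# < 0`) or
  -- simultaneously false (`σ# > 0`). As `μ σ# < 0`, these cases correspond to `μ > 0` and `μ < 0`.
  · rcases lt_or_gt_of_ne hσ with hσ' | hσ'
    · obtain ⟨h1, h2⟩ := HT.stable_of_pos hμδ' hr0 hr hK hσ'
      exact ⟨iff_of_true h1.1 h2.1, iff_of_true h1 h2, fun _ => h1,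
        fun h => absurd hneg (mul_pos_of_neg_of_neg h hσ').not_gt⟩
    · obtain ⟨h1, h2⟩ := HT.unstable_of_neg hμδ' hr0 hr hK hσ'
      exact ⟨iff_of_false h1 h2, iff_of_false (fun h => h1 h.1) (fun h => h2 h.1),
        fun h => absurd hneg (mul_pos h hσ').not_gt, fun _ => h1⟩
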